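/- Let $f\in C^2(\mathbb R)$ with $f''$ bounded, let $\varepsilon>0$, and let $f_\varepsilon$ be the piecewise affine interpolation of $f$ with nodes $\mathbb Z\varepsilon$. Let $\bar u:\mathbb R\to\mathbb R$ have bounded variation, and let $\bar u_\varepsilon:\mathbb R\to\mathbb Z\varepsilon$ be right continuous, compactly supported (hence piecewise constant), with $\mathrm{TV}(\bar u_\varepsilon)\le\mathrm{TV}(\bar u)$. Let $u_\varepsilon$ be the wavefront tracking solution of $u_t+f_\varepsilon(u)_x=0$ with initial datum $\bar u_\varepsilon$: the Riemann problems at all discontinuities are solved by the entropy solution for the flux $f_\varepsilon$, the discontinuity lines (wavefronts) are prolonged until some of them meet, the new Riemann problem is solved, and so on. Let $t_0=0$ and let $t_1<t_2<\dots$ be the times at which wavefronts meet (interaction-cancellation times). Assume that at each $t_j$, $j\ge1$, exactly two wavefronts meet. Enumeration of waves. Let $\mathcal W=\{1,\dots,\mathrm{TV}(\bar u_\varepsilon)/\varepsilon\}$ be the set of waves, each of strength $|s|:=\varepsilon$. With $U(x)=\mathrm{TV}(\bar u_\varepsilon;(-\infty,x])$, the wave $s\in\mathcal W$ has initial position $\mathtt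 x(0,s)=\min\{x:\varepsilon s\le U(x)\}=:x_s$, sign $\mathcal S(s)=\operatorname{sign}[\bar u_\varepsilon(x_s)-\bar u_\varepsilon(x_s-)]$ and right state $\hat u(s)=\bar u_\varepsilon(x_s-)+\mathcal S(s)[\varepsilon s-U(x_s-)]$. For $t\in[t_j,t_{j+1})$ its speed $\sigma(t,s)=\sigma(t_j,s)$ is the one given by the Riemann problem at $(t_j,x)$, $x=\mathtt x(t_j,s)$: if $u_\varepsilon(t_j,x-)<u_\varepsilon(t_j,x)$, it is the derivative of the convex envelope of $f_\varepsilon$ in $[u_\varepsilon(t_j,x-),u_\varepsilon(t_j,x)]$ on the cell $(\hat u(s)-\varepsilon,\hat u(s))$; if $u_\varepsilon(t_j,x-)>u_\varepsilon(t_j,x)$, it is the derivative of the concave envelope in $[u_\varepsilon(t_j,x),u_\varepsilon(t_j,x-)]$ on $(\hat u(s),\hat u(s)+\varepsilon)$. The wave moves with this speed up to $t_{j+1}$, where it is removed ($\mathtt x=+\infty$ from then on) if it reaches the collision point $x_{j+1}$ and $\mathcal S(s)u_\varepsilon(t_{j+1},x_{j+1}-)\le\mathcal S(s)\hat u(s)-\varepsilon\le\mathcal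 S(s)\hat u(s)\le\mathcal S(s)u_\varepsilon(t_{j+1},x_{j+1})$ fails. Let $\mathcal W(t)=\{s\in\mathcal W:\mathtt x(t,s)<+\infty\}$. Then the number $J$ of interaction-cancellation times is finite and $$\sum_{j=1}^J\sum_{s\in\mathcal W(t_j)}|\sigma(t_j,s)-\sigma(t_{j-1},s)||s|\le(3+2\log 2)\,\|f''\|_{L^\infty}\,\mathrm{TV}(\bar u)^2 .$$ Consequently, $$\sum_{\text{interactions}}\frac{|\sigma(w)-\sigma(w')||w||w'|}{|w|+|w'|}\le\frac{3+2\log2}{2}\,\|f''\|_{L^\infty}\,\mathrm{TV}(\bar u)^2 ,$$ where the sum runs over the collisions of two wavefronts $w,w'$ of the same sign, $\sigma(w)$ is the speed of $w$ just before the collision, and the strength $|w|$ is $\varepsilon$ times the number of waves carried by $w$. -/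

import Mathlib

open Set Function MeasureTheory

namespace WavefrontTracking

noncomputable section

/-! ### Flux and convex envelopes -/

/-- The piecewise affine interpolation of `f` with grid size `ε`: the function that coincides with
`f` on `ℤ ε` and is affine on each cell `[m ε, (m + 1) ε]`. -/
def interpolation (f : ℝ → ℝ) (ε u : ℝ) : ℝ :=
  f (⌊u / ε⌋ * ε) + Int.fract (u / ε) * (f ((⌊u / ε⌋ + 1) * ε) - f (⌊u / ε⌋ * ε))

/-- The convex envelope of `g` in `[a, b]`, evaluated at `u ∈ [a, b]`. -/
def convexEnvelope (g : ℝ → ℝ) (a b u : ℝ) : ℝ :=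
  sSup {y | ∃ h : ℝ → ℝ, ConvexOn ℝ (Icc a b) h ∧ (∀ v ∈ Icc a b, h v ≤ g v) ∧ y = h u}

/-- The concave envelope of `g` in `[a, b]`, evaluated at `u ∈ [a, b]`. -/
def concaveEnvelope (g : ℝ → ℝ) (a b u : ℝ) : ℝ :=
  sInf {y | ∃ h : ℝ → ℝ, ConcaveOn ℝ (Icc a b) h ∧ (∀ v ∈ Icc a b, g v ≤ h v) ∧ y = h u}

/-! ### The Riemann solver for the interpolated flux -/

/-- The right states of the elementary waves (of size `ε`) in which the jump from `uL` to `uR` is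
decomposed: `(uL, uR] ∩ ℤ ε` if `uL < uR`, and `[uR, uL) ∩ ℤ ε` if `uR < uL`. -/
def riemannStates (ε uL uR : ℝ) : Set ℝ :=
  {w | (∃ k : ℤ, w = k * ε) ∧ ((uL < w ∧ w ≤ uR) ∨ (uR ≤ w ∧ w < uL))}

/-- The speed given by the Riemann problem `(uL, uR)` to the elementary wave with right state `w`:
the constant value of the derivative of the convex envelope of the interpolated flux on the cell
`(w - ε, w)` if `uL < uR`, and of the concave envelope on the cell `(w, w + ε)` if `uR < uL`
(computed at the midpoint of the cell). -/
def riemannSpeed (f : ℝ → ℝ) (ε uL uR w : ℝ) : ℝ :=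
  if uL < uR then deriv (convexEnvelope (interpolation f ε) uL uR) (w - ε / 2)
  else deriv (concaveEnvelope (interpolation f ε) uR uL) (w + ε / 2)

/-- The entropy solution, at time `τ ≥ 0` and at the point `x`, of the Riemann problem for the
interpolated flux with a jump from `uL` to `uR` at the origin: all the elementary waves that at
time `τ` are located in `(-∞, x]` have been crossed. It is right continuous in `x`, and for `τ = 0`
it is the initial datum of the Riemann problem. -/
def riemannSolution (f : ℝ → ℝ) (ε uL uR τ x : ℝ) : ℝ :=
  uL + Real.sign (uR - uL) * ε *
    ({w ∈ riemannStates ε uL uR | τ * riemannSpeed f ε uL uR w ≤ x}.ncard : ℝ)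

/-! ### Wavefront tracking -/

/-- The profile obtained from the piecewise constant, right continuous, compactly supported profile
`v` after a time `τ`, not exceeding the first collision time, by solving the Riemann problems at all
discontinuities of `v` and juxtaposing them (the state at `-∞` is `0`). -/
def evolve (f : ℝ → ℝ) (ε : ℝ) (v : ℝ → ℝ) (τ x : ℝ) : ℝ :=
  ∑ᶠ y ∈ {y : ℝ | leftLim v y ≠ v y},
    (riemannSolution f ε (leftLim v y) (v y) τ (x - y) - leftLim v y)

/-- The wavefronts `(y, c)` emerging from the discontinuities of the profile `v`: the discontinuity
lines `τ ↦ y + c τ`, where `c` is one of the speeds in the solution of the Riemann problem at `y`. -/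
def fronts (f : ℝ → ℝ) (ε : ℝ) (v : ℝ → ℝ) : Set (ℝ × ℝ) :=
  {p | ∃ w ∈ riemannStates ε (leftLim v p.1) (v p.1),
    p.2 = riemannSpeed f ε (leftLim v p.1) (v p.1) w}

/-- The times `τ > 0` at which two wavefronts emerging from `v`, prolonged with constant speed, meet
(two wavefronts emerging from the same point have different speeds and never meet). -/
def meetingTimes (f : ℝ → ℝ) (ε : ℝ) (v : ℝ → ℝ) : Set ℝ :=
  {τ | 0 < τ ∧ ∃ p ∈ fronts f ε v, ∃ q ∈ fronts f ε v, p.1 < q.1 ∧ p.1 + τ * p.2 = q.1 + τ * q.2}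

/-- The time that elapses before the first collision of wavefronts emerging from `v`
(`0` if there is no collision). -/
def firstMeeting (f : ℝ → ℝ) (ε : ℝ) (v : ℝ → ℝ) : ℝ := sInf (meetingTimes f ε v)

/-- The pairs of wavefronts emerging from `v`, ordered from left to right, that collide at the first
collision time. -/
def collidingPairs (f : ℝ → ℝ) (ε : ℝ) (v : ℝ → ℝ) : Set ((ℝ × ℝ) × (ℝ × ℝ)) :=
  {w | w.1 ∈ fronts f ε v ∧ w.2 ∈ fronts f ε v ∧ w.1.1 < w.2.1 ∧
    w.1.1 + firstMeeting f ε v * w.1.2 = w.2.1 + firstMeeting f ε v * w.2.2}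

/-- The pairs of colliding wavefronts that have the same sign. -/
def interactingPairs (f : ℝ → ℝ) (ε : ℝ) (v : ℝ → ℝ) : Set ((ℝ × ℝ) × (ℝ × ℝ)) :=
  {w ∈ collidingPairs f ε v | 0 < (v w.1.1 - leftLim v w.1.1) * (v w.2.1 - leftLim v w.2.1)}

/-- `x` is a point where wavefronts emerging from `v` meet at the first collision time. -/
def IsCollisionPoint (f : ℝ → ℝ) (ε : ℝ) (v : ℝ → ℝ) (x : ℝ) : Prop :=
  ∃ w ∈ collidingPairs f ε v, w.1.1 + firstMeeting f ε v * w.1.2 = x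

/-- The profile `u_ε(t_j, ·)` of the wavefront tracking solution with initial datum `v₀` at the
`j`-th interaction-cancellation time `t_j`, where `t_0 = 0` (the sequence becomes stationary if
there are no more collisions). -/
def profile (f : ℝ → ℝ) (ε : ℝ) (v₀ : ℝ → ℝ) : ℕ → ℝ → ℝ
  | 0 => v₀
  | j + 1 => evolve f ε (profile f ε v₀ j) (firstMeeting f ε (profile f ε v₀ j))

/-- The `j`-th interaction-cancellation time `t_j`; `t_0 = 0`. -/
def collisionTime (f : ℝ → ℝ) (ε : ℝ) (v₀ : ℝ → ℝ) (j : ℕ) : ℝ :=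
  ∑ i ∈ Finset.range j, firstMeeting f ε (profile f ε v₀ i)

/-- After the time `t_j` there is another collision, that is, `t_{j+1}` exists. -/
def HasNextCollision (f : ℝ → ℝ) (ε : ℝ) (v₀ : ℝ → ℝ) (j : ℕ) : Prop :=
  (meetingTimes f ε (profile f ε v₀ j)).Nonempty

/-- The index `j` such that `t ∈ [t_j, t_{j+1})`, or `t ∈ [t_j, ∞)` for the last collision `j`. -/
def stage (f : ℝ → ℝ) (ε : ℝ) (v₀ : ℝ → ℝ) (t : ℝ) : ℕ :=
  sInf {j | t < collisionTime f ε v₀ (j + 1) ∨ ¬ HasNextCollision f ε v₀ j}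

/-- The `ε`-wavefront tracking solution `u_ε(t, x)` with initial datum `v₀`. -/
def solution (f : ℝ → ℝ) (ε : ℝ) (v₀ : ℝ → ℝ) (t x : ℝ) : ℝ :=
  evolve f ε (profile f ε v₀ (stage f ε v₀ t)) (t - collisionTime f ε v₀ (stage f ε v₀ t)) x

/-! ### Enumeration of waves -/

/-- The set of waves `{1, 2, …, Tot.Var.(v₀) / ε}`. -/
def waveSet (ε : ℝ) (v₀ : ℝ → ℝ) : Finset ℕ :=
  Finset.Icc 1 ⌊(eVariationOn v₀ univ).toReal / ε⌋₊

/-- The total variation function `U(x) = Tot.Var.(v₀; (-∞, x])`. -/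
def variationFunction (v₀ : ℝ → ℝ) (x : ℝ) : ℝ := (eVariationOn v₀ (Iic x)).toReal

/-- The initial position of the wave `s`: the smallest `x` such that `ε s ≤ U(x)`. -/
def initialPosition (ε : ℝ) (v₀ : ℝ → ℝ) (s : ℕ) : ℝ :=
  sInf {x | ε * s ≤ variationFunction v₀ x}

/-- The sign of the wave `s`. -/
def waveSign (ε : ℝ) (v₀ : ℝ → ℝ) (s : ℕ) : ℝ :=
  Real.sign (v₀ (initialPosition ε v₀ s) - leftLim v₀ (initialPosition ε v₀ s))

/-- The right state `û(s)` of the wave `s`. -/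
def rightState (ε : ℝ) (v₀ : ℝ → ℝ) (s : ℕ) : ℝ :=
  leftLim v₀ (initialPosition ε v₀ s) +
    waveSign ε v₀ s * (ε * s - leftLim (variationFunction v₀) (initialPosition ε v₀ s))

open Classical in
/-- The position `x(t_j, s)` of the wave `s` at time `t_j`; it is `⊤` if the wave has been removed.
A wave that survives moves, from `t_j` to `t_{j+1}`, with the speed given to it by the Riemann
problem at `x(t_j, s)`; it is removed at `t_{j+1}` if it reaches the collision point and the cell
between its left and its right state is not contained in the jump that is left over there. -/
def collisionPosition (f : ℝ → ℝ) (ε : ℝ) (v₀ : ℝ → ℝ) : ℕ → ℕ → WithTop ℝ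
  | 0, s => (initialPosition ε v₀ s : ℝ)
  | j + 1, s =>
    if collisionPosition f ε v₀ j s = ⊤ then ⊤ else
      let v : ℝ → ℝ := profile f ε v₀ j
      let v' : ℝ → ℝ := profile f ε v₀ (j + 1)
      let x : ℝ := (collisionPosition f ε v₀ j s).untopD 0
      let x' : ℝ := x + riemannSpeed f ε (leftLim v x) (v x) (rightState ε v₀ s) * firstMeeting f ε v
      if IsCollisionPoint f ε v x' ∧
          ¬ (waveSign ε v₀ s * leftLim v' x' ≤ waveSign ε v₀ s * rightState ε v₀ s - ε ∧
            waveSign ε v₀ s * rightState ε v₀ s ≤ waveSign ε v₀ s * v' x')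
      then ⊤ else (x' : ℝ)

/-- The speed `σ(t_j, s)` given to the wave `s` by the Riemann problem at `(t_j, x(t_j, s))`
(to be used only for waves that have not been removed; for the other ones it is meaningless). -/
def collisionSpeed (f : ℝ → ℝ) (ε : ℝ) (v₀ : ℝ → ℝ) (j s : ℕ) : ℝ :=
  let x : ℝ := (collisionPosition f ε v₀ j s).untopD 0
  riemannSpeed f ε (leftLim (profile f ε v₀ j) x) (profile f ε v₀ j x) (rightState ε v₀ s)

/-- The position `x(t, s)` of the wave `s` at time `t`. -/
def wavePosition (f : ℝ → ℝ) (ε : ℝ) (v₀ : ℝ → ℝ) (t : ℝ) (s : ℕ) : WithTop ℝ :=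
  (collisionPosition f ε v₀ (stage f ε v₀ t) s).map fun x =>
    x + collisionSpeed f ε v₀ (stage f ε v₀ t) s * (t - collisionTime f ε v₀ (stage f ε v₀ t))

/-- The speed `σ(t, s)` of the wave `s` at time `t`; it is constant in `[t_j, t_{j+1})`, and it is
to be used only for waves that have not been removed at time `t`. -/
def waveSpeed (f : ℝ → ℝ) (ε : ℝ) (v₀ : ℝ → ℝ) (t : ℝ) (s : ℕ) : ℝ :=
  collisionSpeed f ε v₀ (stage f ε v₀ t) s

open Classical in
/-- The set `W(t)` of the waves that have not been removed at time `t`. -/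
def realWaves (f : ℝ → ℝ) (ε : ℝ) (v₀ : ℝ → ℝ) (t : ℝ) : Finset ℕ :=
  {s ∈ waveSet ε v₀ | wavePosition f ε v₀ t s ≠ ⊤}

open Classical in
/-- The strength of the wavefront `p = (y, c)` that emerges from `y` with speed `c` at time `t_j`:
`ε` times the number of the waves that it carries. -/
def frontStrength (f : ℝ → ℝ) (ε : ℝ) (v₀ : ℝ → ℝ) (j : ℕ) (p : ℝ × ℝ) : ℝ :=
  ε * (({s ∈ waveSet ε v₀ | collisionPosition f ε v₀ j s = (p.1 : WithTop ℝ) ∧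
    collisionSpeed f ε v₀ j s = p.2} : Finset ℕ).card : ℝ)

/-- The amount of interaction `|σ(w) - σ(w')| |w| |w'| / (|w| + |w'|)` at the collision time
`t_{j+1}`, where `w`, `w'` are the colliding wavefronts, if they have the same sign; it is `0` if
the collision is a cancellation. -/
def interactionAmount (f : ℝ → ℝ) (ε : ℝ) (v₀ : ℝ → ℝ) (j : ℕ) : ℝ :=
  ∑ᶠ w ∈ interactingPairs f ε (profile f ε v₀ j),
    |w.1.2 - w.2.2| * frontStrength f ε v₀ j w.1 * frontStrength f ε v₀ j w.2 /
      (frontStrength f ε v₀ j w.1 + frontStrength f ε v₀ j w.2)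

end

end WavefrontTracking

namespace WavefrontTracking

/-! The right state of a wave never changes, so each wave carries for ever the slope `d`
(`cellSlope`) of the interpolated flux on its cell. In a Riemann problem the speeds are the
increments of the convex envelope of the primitive of `d` along the waves of the jump; for a
negative jump the concave envelope becomes a convex one after changing sign and reading the states
backwards. This is recorded in `BlockSpeeds`, and from there on only finite sums over sets of waves
occur. In particular the speed of a wavefront is the mean of `d` over its waves. Write `L` for the
bound on `|f''|`, `K = L ε`, and `n` for the initial number of waves; along consecutive waves of one
sign `d` varies by at most `K` per wave.

Cancellation. Only one of the two wavefronts can survive, and it loses waves at one end. Its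
remaining waves all change speed in the same direction, and the changes sum to at most `K n` times
the number of removed waves (`sum_abs_speed_sub_of_cancellation`). As at most `n` waves are ever
removed, all cancellations together cost at most `K n ^ 2`.

Interaction of `P` and `Q`. They merge into one shock whose speed is the weighted mean, so the
changes of speed sum to `2 (σ_P - σ_Q) |P| |Q| / (|P| + |Q|)` (`sum_abs_speed_sub_of_merge`). If no
wave of `P` has met a wave of `Q` before, `σ_P - σ_Q ≤ K (|P| + |Q|)` and the cost is paid by the
`|P| |Q|` pairs that interact now for the first time. The difficulty is that waves can meet, be
split by a cancellation, and meet again, and a pair can pay only once.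

The remedy is `Tangency`: at a point that separates waves that have already interacted there is a
slope `c` that is at least the mean of `d` over the interacted waves on the left and at most the
mean over those on the right. If `L ⊆ P` and `R ⊆ Q` are the waves that have interacted with some
wave of the other front, then `σ_P - c ≤ K |P \ L|` and `c - σ_Q ≤ K |Q \ R|`. Since `|P \ L| |Q|`
and `|P| |Q \ R|` are both at most the number of pairs in `P × Q` that have not interacted, the cost
is at most `4 K` times that number (`speed_sub_mul_le`). There are at most `n ^ 2 / 2` pairs, so all
interactions cost at most `2 K n ^ 2`.

Tangency persists. A merge creates no new separation point. A cancellation may split a wavefront,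
but only where the new envelope touches the primitive of `d`; this gives tangency inside the old
front, and the old tangency at its two ends extends it outwards (`Tangency.of_cancellation`). No
wave between two survivors that have interacted is removed, because they and all waves between them
have one sign, whereas the removed waves are consecutive and of both signs.

Adding up and multiplying by the strength `ε` gives `3 L (n ε) ^ 2`, and `L (n ε) ^ 2` for the
amounts of interaction alone; both are below the stated bounds, and `n ε` is at most the total
variation. The collisions are finitely many because a cancellation lowers the number of waves, while
an interaction keeps it and lowers the number of pairs of waves in different wavefronts. -/

/-! ### Discrete convex envelopes -/

/-- The discretely convex minorants of the sequence `G` on `[a, b]`. -/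
def discreteMinorants (G : ℤ → ℝ) (a b : ℤ) : Set (ℤ → ℝ) :=
  {h | (∀ k, a < k → k < b → 2 * h k ≤ h (k - 1) + h (k + 1)) ∧ ∀ k, a ≤ k → k ≤ b → h k ≤ G k}

/-- The largest discretely convex minorant of `G` on `[a, b]`. -/
noncomputable def discreteEnvelope (G : ℤ → ℝ) (a b k : ℤ) : ℝ :=
  sSup ((fun h : ℤ → ℝ => h k) '' discreteMinorants G a b)

lemma discreteMinorants_nonempty (G : ℤ → ℝ) (a b : ℤ) : (discreteMinorants G a b).Nonempty := by
  obtain ⟨m, hm⟩ := ((Finset.Icc a b).image G).bddBelow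
  refine ⟨fun _ => m, fun k _ _ => by linarith, fun k h1 h2 => hm ?_⟩
  exact Finset.mem_coe.2 (Finset.mem_image_of_mem _ (Finset.mem_Icc.2 ⟨h1, h2⟩))

lemma le_discreteEnvelope {G : ℤ → ℝ} {a b : ℤ} {h : ℤ → ℝ} (hh : h ∈ discreteMinorants G a b)
    {k : ℤ} (h1 : a ≤ k) (h2 : k ≤ b) : h k ≤ discreteEnvelope G a b k := by
  refine le_csSup ⟨G k, ?_⟩ (mem_image_of_mem _ hh)
  rintro _ ⟨g, hg, rfl⟩
  exact hg.2 k h1 h2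

/-- Both conditions on a minorant pass to a pointwise supremum: the upper bound trivially, and the
midpoint inequality because its right-hand side increases with the neighbouring values. -/
lemma discreteEnvelope_mem (G : ℤ → ℝ) (a b : ℤ) :
    discreteEnvelope G a b ∈ discreteMinorants G a b := by
  have hne := discreteMinorants_nonempty G a b
  refine ⟨fun k h1 h2 => ?_, fun k h1 h2 => ?_⟩
  · rw [← le_div_iff₀' two_pos]
    refine csSup_le (hne.image _) ?_
    rintro _ ⟨h, hh, rfl⟩
    have e1 := le_discreteEnvelope hh (k := k - 1) (by omega) (by omega)
    have e2 := le_discreteEnvelope hh (k := k + 1) (by omega) (by omega)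
    have := hh.1 k h1 h2
    simp only
    linarith
  · refine csSup_le (hne.image _) ?_
    rintro _ ⟨h, hh, rfl⟩
    exact hh.2 k h1 h2

/-- Where the envelope is strictly convex, or at an endpoint, its value could be raised a little
without losing convexity; maximality leaves only contact with `G`. -/
lemma discreteEnvelope_eq_of_update {G : ℤ → ℝ} {a b k : ℤ} (h1 : a ≤ k) (h2 : k ≤ b)
    (hk : a < k → k < b → 2 * discreteEnvelope G a b k <
      discreteEnvelope G a b (k - 1) + discreteEnvelope G a b (k + 1)) :
    discreteEnvelope G a b k = G k := by
  set E := discreteEnvelope G a b with hE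
  have hmem : E ∈ discreteMinorants G a b := discreteEnvelope_mem G a b
  refine le_antisymm (hmem.2 k h1 h2) (not_lt.1 fun hlt => ?_)
  -- The increment must respect both the gap to `G` and, at interior points, half of the second
  -- difference. At an endpoint only the gap matters.
  obtain ⟨δ, hδ, hδ1, hδ2⟩ : ∃ δ : ℝ, 0 < δ ∧ E k + δ ≤ G k ∧
      (a < k → k < b → 2 * (E k + δ) ≤ E (k - 1) + E (k + 1)) := by
    by_cases hin : a < k ∧ k < b
    · have := hk hin.1 hin.2
      refine ⟨min (G k - E k) ((E (k - 1) + E (k + 1) - 2 * E k) / 2), ?_, ?_, fun _ _ => ?_⟩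
      · exact lt_min (by linarith) (by linarith)
      · linarith [min_le_left (G k - E k) ((E (k - 1) + E (k + 1) - 2 * E k) / 2)]
      · linarith [min_le_right (G k - E k) ((E (k - 1) + E (k + 1) - 2 * E k) / 2)]
    · exact ⟨G k - E k, by linarith, by linarith, fun h h' => absurd ⟨h, h'⟩ hin⟩
  have hup : Function.update E k (E k + δ) ∈ discreteMinorants G a b := by
    refine ⟨fun m hm1 hm2 => ?_, fun m hm1 hm2 => ?_⟩
    · have := hmem.1 m hm1 hm2
      by_cases e0 : m = k
      · subst e0
        have := hδ2 hm1 hm2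
        simpa [Function.update_of_ne] using this
      · rw [Function.update_of_ne e0]
        have l : ∀ i, E i ≤ Function.update E k (E k + δ) i := by
          intro i
          by_cases hi : i = k
          · subst hi; simp; linarith
          · rw [Function.update_of_ne hi]
        linarith [l (m - 1), l (m + 1)]
    · by_cases e0 : m = k
      · subst e0; simpa using hδ1
      · rw [Function.update_of_ne e0]; exact hmem.2 m hm1 hm2
  have := le_discreteEnvelope hup h1 h2
  rw [Function.update_self, ← hE] at this
  linarith

lemma discreteMinorants_slope_le {G h : ℤ → ℝ} {a b : ℤ} (hh : h ∈ discreteMinorants G a b)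
    {k m : ℤ} (h1 : a < k) (hkm : k ≤ m) (h2 : m ≤ b) :
    h k - h (k - 1) ≤ h m - h (m - 1) := by
  induction m, hkm using Int.leInduction with
  | base => rfl
  | succ m hm ih =>
    have := hh.1 m (by omega) (by omega)
    have := ih (by omega)
    rw [show m + 1 - 1 = m by ring]
    linarith

/-- A discretely convex sequence lies above its supporting lines. -/
lemma discreteMinorants_line_le {G h : ℤ → ℝ} {a b : ℤ} (hh : h ∈ discreteMinorants G a b)
    {k m : ℤ} (h1 : a < k) (h2 : k ≤ b) (hm1 : a ≤ m) (hm2 : m ≤ b) :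
    h k + ((m : ℝ) - k) * (h k - h (k - 1)) ≤ h m := by
  rcases le_total k m with hkm | hkm
  · induction m, hkm using Int.leInduction with
    | base => simp
    | succ m hm ih =>
      have e1 := ih (by omega) (by omega)
      have e2 := discreteMinorants_slope_le hh h1 (show k ≤ m + 1 by omega) hm2
      rw [show m + 1 - 1 = m by ring] at e2
      push_cast
      linarith
  · induction m, hkm using Int.leInductionDown with
    | base => simp
    | pred m hm ih =>
      have e1 := ih (by omega) (by omega)
      have e2 := discreteMinorants_slope_le hh (show a < m by omega) hm h2
      push_cast
      linarith

/-! ### The convex envelope of the interpolated flux -/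

lemma interpolation_cell (f : ℝ → ℝ) {ε u : ℝ} (hε : 0 < ε) {k : ℤ} (h1 : (k - 1) * ε ≤ u)
    (h2 : u ≤ k * ε) : interpolation f ε u =
      f ((k - 1) * ε) + (u / ε - (k - 1)) * (f (k * ε) - f ((k - 1) * ε)) := by
  have h1' : (k : ℝ) - 1 ≤ u / ε := (le_div_iff₀ hε).2 h1
  have h2' : u / ε ≤ k := (div_le_iff₀ hε).2 h2
  rcases h2'.lt_or_eq with h | h
  · have hfl : ⌊u / ε⌋ = k - 1 := by
      rw [Int.floor_eq_iff]; push_cast; constructor <;> linarith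
    rw [interpolation, Int.fract, hfl]; push_cast; ring_nf
  · rw [interpolation, h]; simp

lemma interpolation_node (f : ℝ → ℝ) {ε : ℝ} (hε : 0 < ε) (k : ℤ) :
    interpolation f ε (k * ε) = f (k * ε) := by
  rw [interpolation, mul_div_assoc, div_self hε.ne']; simp

lemma exists_cell {ε u : ℝ} (hε : 0 < ε) {a b : ℤ} (hab : a < b) (h1 : a * ε ≤ u)
    (h2 : u ≤ b * ε) : ∃ k : ℤ, a < k ∧ k ≤ b ∧ (k - 1) * ε ≤ u ∧ u ≤ k * ε := by
  rcases h1.eq_or_lt with h | h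
  · refine ⟨a + 1, by omega, by omega, ?_, ?_⟩ <;> push_cast <;> nlinarith
  · refine ⟨⌈u / ε⌉, ?_, ?_, ?_, ?_⟩
    · rw [Int.lt_ceil, lt_div_iff₀ hε]; exact h
    · rw [Int.ceil_le, div_le_iff₀ hε]; exact h2
    · have := Int.ceil_lt_add_one (u / ε)
      rw [← le_div_iff₀ hε]; linarith
    · rw [← div_le_iff₀ hε]; exact Int.le_ceil _

/-- The supremum is attained by one affine function: the line through the two nodes of the cell
supports the discrete envelope, hence lies below the flux at all nodes and so everywhere.
Conversely, the node values of any convex minorant form a discrete minorant, and convexity bounds it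
inside the cell. -/
lemma convexEnvelope_cell (f : ℝ → ℝ) {ε u : ℝ} (hε : 0 < ε) {a b k : ℤ} (h1 : a < k)
    (h2 : k ≤ b) (hu1 : (k - 1) * ε ≤ u) (hu2 : u ≤ k * ε) :
    convexEnvelope (interpolation f ε) (a * ε) (b * ε) u =
      discreteEnvelope (fun m => f (m * ε)) a b k + (u / ε - k) *
        (discreteEnvelope (fun m => f (m * ε)) a b k -
          discreteEnvelope (fun m => f (m * ε)) a b (k - 1)) := by
  set G : ℤ → ℝ := fun m => f (m * ε) with hG
  set E := discreteEnvelope G a b with hE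
  have hmem : E ∈ discreteMinorants G a b := discreteEnvelope_mem G a b
  have hak : (a : ℝ) ≤ k - 1 := by exact_mod_cast (by omega : a ≤ k - 1)
  have hkb : (k : ℝ) ≤ b := by exact_mod_cast h2
  have huε1 : (k : ℝ) - 1 ≤ u / ε := (le_div_iff₀ hε).2 hu1
  have huε2 : u / ε ≤ k := (div_le_iff₀ hε).2 hu2
  have node_mem : ∀ m : ℤ, a ≤ m → m ≤ b → (m : ℝ) * ε ∈ Icc (a * ε) (b * ε) := by
    intro m hm1 hm2
    constructor
    · exact mul_le_mul_of_nonneg_right (by exact_mod_cast hm1) hε.le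
    · exact mul_le_mul_of_nonneg_right (by exact_mod_cast hm2) hε.le
  refine IsGreatest.csSup_eq ⟨?_, ?_⟩
  · refine ⟨fun v => E k + (v / ε - k) * (E k - E (k - 1)), ⟨convex_Icc _ _, ?_⟩, ?_, rfl⟩
    · intro x _ y _ s t _ _ hst
      simp only [smul_eq_mul]
      apply le_of_eq
      have : s = 1 - t := by linarith
      subst this
      field_simp
      ring
    · intro v hv
      obtain ⟨m, hm1, hm2, hv1, hv2⟩ := exists_cell hε (by omega : a < b) hv.1 hv.2
      rw [interpolation_cell f hε hv1 hv2]
      have e1 := discreteMinorants_line_le hmem h1 h2 (by omega : a ≤ m) hm2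
      have e2 := discreteMinorants_line_le hmem h1 h2 (by omega : a ≤ m - 1) (by omega)
      have e3 := hmem.2 m (by omega) hm2
      have e4 := hmem.2 (m - 1) (by omega) (by omega)
      simp only [hG] at e3 e4
      push_cast at e2 e4
      have hv1' : 0 ≤ v / ε - (m - 1) := by rw [sub_nonneg, le_div_iff₀ hε]; exact hv1
      have hv2' : 0 ≤ m - v / ε := by rw [sub_nonneg, div_le_iff₀ hε]; exact hv2
      have f1 := mul_le_mul_of_nonneg_left (e1.trans e3) hv1'
      have f2 := mul_le_mul_of_nonneg_left (e2.trans e4) hv2'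
      linarith
  · rintro _ ⟨h, hconv, hle, rfl⟩
    have hseq : (fun m : ℤ => h (m * ε)) ∈ discreteMinorants G a b := by
      refine ⟨fun m hm1 hm2 => ?_, fun m hm1 hm2 => ?_⟩
      · have := hconv.2 (node_mem (m - 1) (by omega) (by omega))
          (node_mem (m + 1) (by omega) (by omega)) (by norm_num : (0 : ℝ) ≤ 1 / 2)
          (by norm_num : (0 : ℝ) ≤ 1 / 2) (by norm_num)
        simp only [smul_eq_mul] at this
        rw [show (1 / 2 : ℝ) * (((m - 1 : ℤ) : ℝ) * ε) + 1 / 2 * (((m + 1 : ℤ) : ℝ) * ε) = m * ε by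
          push_cast; ring] at this
        simp only
        linarith
      · have := hle _ (node_mem m hm1 hm2)
        rwa [interpolation_node f hε] at this
    have e1 := le_discreteEnvelope hseq (k := k) (by omega) h2
    have e2 := le_discreteEnvelope hseq (k := k - 1) (by omega) (by omega)
    rw [← hE] at e1 e2
    have := hconv.2 (node_mem (k - 1) (by omega) (by omega)) (node_mem k (by omega) (by omega))
      (by linarith : 0 ≤ k - u / ε) (by linarith : 0 ≤ u / ε - (k - 1)) (by ring)
    simp only [smul_eq_mul] at this
    rw [show ((k : ℝ) - u / ε) * (((k - 1 : ℤ) : ℝ) * ε) + (u / ε - (k - 1)) * (k * ε) = u by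
      push_cast; field_simp; ring] at this
    have f1 := mul_le_mul_of_nonneg_left e1 (by linarith : 0 ≤ u / ε - (k - 1))
    have f2 := mul_le_mul_of_nonneg_left e2 (by linarith : 0 ≤ k - u / ε)
    linarith

lemma deriv_convexEnvelope_midpoint (f : ℝ → ℝ) {ε : ℝ} (hε : 0 < ε) {a b k : ℤ} (h1 : a < k)
    (h2 : k ≤ b) :
    deriv (convexEnvelope (interpolation f ε) (a * ε) (b * ε)) (k * ε - ε / 2) =
      (discreteEnvelope (fun m => f (m * ε)) a b k -
          discreteEnvelope (fun m => f (m * ε)) a b (k - 1)) / ε := by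
  set E := discreteEnvelope (fun m => f (m * ε)) a b
  have hev : convexEnvelope (interpolation f ε) (a * ε) (b * ε) =ᶠ[nhds (k * ε - ε / 2)]
      fun u => E k + (u / ε - k) * (E k - E (k - 1)) := by
    filter_upwards [Icc_mem_nhds (show (k - 1) * ε < k * ε - ε / 2 by linarith)
      (show k * ε - ε / 2 < k * ε by linarith)] with u hu
    exact convexEnvelope_cell f hε h1 h2 hu.1 hu.2
  rw [hev.deriv_eq]
  have : HasDerivAt (fun u => E k + (u / ε - k) * (E k - E (k - 1)))
      (1 / ε * (E k - E (k - 1))) (k * ε - ε / 2) :=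
    ((((hasDerivAt_id _).div_const ε).sub_const (k : ℝ)).mul_const _).const_add _
  rw [this.deriv]; ring

/-- This reduces negative jumps to the convex case for the flux `-f`. -/
lemma concaveEnvelope_eq_neg (g : ℝ → ℝ) (a b : ℝ) :
    concaveEnvelope g a b = fun u => -convexEnvelope (fun v => -g v) a b u := by
  funext u
  rw [concaveEnvelope, convexEnvelope, Real.sInf_def]
  congr 2
  ext y
  simp only [Set.mem_neg, mem_ofPred_eq]
  constructor
  · rintro ⟨h, hc, hle, hy⟩
    exact ⟨fun v => -h v, hc.neg, fun v hv => neg_le_neg (hle v hv), by linarith⟩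
  · rintro ⟨h, hc, hle, hy⟩
    exact ⟨fun v => -h v, hc.neg, fun v hv => by linarith [hle v hv], by linarith⟩

lemma interpolation_neg (f : ℝ → ℝ) (ε : ℝ) :
    (fun v => -interpolation f ε v) = interpolation (fun v => -f v) ε := by
  funext v
  simp only [interpolation]
  ring

/-! ### The speeds given by a Riemann problem -/

/-- The speeds given by a Riemann problem to its `m` elementary waves are the increments of the
convex envelope of the flux along the states crossed by the waves. -/
lemma riemannSpeed_structure (f : ℝ → ℝ) {ε : ℝ} (hε : 0 < ε) (a S : ℤ) (hS : S = 1 ∨ S = -1)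
    {m : ℕ} (hm : 0 < m) : ∃ E : ℕ → ℝ,
      (∀ i < m, riemannSpeed f ε (a * ε) ((a + S * m : ℤ) * ε) ((a + S * (i + 1 : ℕ) : ℤ) * ε) =
        (E (i + 1) - E i) / ε) ∧
      (∀ i, i + 1 < m → E (i + 1) - E i ≤ E (i + 2) - E (i + 1)) ∧
      (∀ i ≤ m, E i ≤ S * f ((a + S * i : ℤ) * ε)) ∧
      E 0 = S * f (a * ε) ∧ E m = S * f ((a + S * m : ℤ) * ε) ∧
      (∀ i, i + 1 < m → E (i + 1) - E i < E (i + 2) - E (i + 1) →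
        E (i + 1) = S * f ((a + S * (i + 1 : ℕ) : ℤ) * ε)) := by
  have hm' : (0 : ℝ) < m := by exact_mod_cast hm
  rcases hS with rfl | rfl
  · set E := discreteEnvelope (fun k => f (k * ε)) a (a + m) with hE
    have hmem := discreteEnvelope_mem (fun k => f (k * ε)) a (a + m)
    have hend : ∀ i : ℕ, i ≤ m → (0 < i → i < m → 2 * E (a + i) < E (a + i - 1) + E (a + i + 1)) →
        E (a + i) = f ((a + i : ℤ) * ε) := by
      intro i hi h
      exact discreteEnvelope_eq_of_update (G := fun k => f (k * ε)) (by omega) (by omega)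
        fun h1 h2 => h (by omega) (by omega)
    refine ⟨fun i => E (a + i), ?_, ?_, ?_, ?_, ?_, ?_⟩
    · intro i hi
      rw [riemannSpeed, if_pos (by push_cast; nlinarith), one_mul, one_mul,
        deriv_convexEnvelope_midpoint f hε (by omega) (by omega)]
      congr 3
      push_cast; ring_nf
    · intro i hi
      have := hmem.1 (a + i + 1) (by omega) (by omega)
      rw [← hE] at this
      push_cast
      rw [show a + (i : ℤ) + 1 - 1 = a + i by ring, show a + (i : ℤ) + 1 + 1 = a + (i + 2) by ring,
        show a + (i : ℤ) + 1 = a + (i + 1) by ring] at this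
      linarith
    · intro i hi
      have := hmem.2 (a + i) (by omega) (by omega)
      simpa using this
    · have := hend 0 (by omega) (by omega)
      simpa using this
    · have := hend m le_rfl (by omega)
      simpa using this
    · intro i hi h
      have := hend (i + 1) hi.le ?_
      · simpa using this
      · intro _ _
        push_cast at h ⊢
        rw [show a + ((i : ℤ) + 1) - 1 = a + i by ring,
          show a + ((i : ℤ) + 1) + 1 = a + (i + 2) by ring]
        linarith
  · set E := discreteEnvelope (fun k => -f (k * ε)) (a - m) a with hE
    have hmem := discreteEnvelope_mem (fun k => -f (k * ε)) (a - m) a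
    have hend : ∀ i : ℕ, i ≤ m → (0 < i → i < m → 2 * E (a - i) < E (a - i - 1) + E (a - i + 1)) →
        E (a - i) = -f ((a - i : ℤ) * ε) := by
      intro i hi h
      exact discreteEnvelope_eq_of_update (G := fun k => -f (k * ε)) (by omega) (by omega)
        fun h1 h2 => h (by omega) (by omega)
    -- In a negative jump the states are crossed downwards from `a`, so the envelope of `-f` is read
    -- backwards. This reversal and the sign of `-f` compensate each other in the increments.
    refine ⟨fun i => E (a - i), ?_, ?_, ?_, ?_, ?_, ?_⟩
    · intro i hi
      rw [riemannSpeed, if_neg (by push_cast; nlinarith), concaveEnvelope_eq_neg,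
        interpolation_neg, deriv.fun_neg,
        show ((a + -1 * (i + 1 : ℕ) : ℤ) : ℝ) * ε + ε / 2 = ((a - i : ℤ) : ℝ) * ε - ε / 2 by
          push_cast; ring, show a + -1 * (m : ℤ) = a - m by ring,
        deriv_convexEnvelope_midpoint (fun v => -f v) hε (by omega) (by omega)]
      push_cast
      rw [show a - (i : ℤ) - 1 = a - (i + 1) by ring, ← hE]
      ring
    · intro i hi
      have := hmem.1 (a - (i + 1)) (by omega) (by omega)
      rw [← hE] at this
      push_cast
      rw [show a - ((i : ℤ) + 1) - 1 = a - (i + 2) by ring,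
        show a - ((i : ℤ) + 1) + 1 = a - i by ring] at this
      linarith
    · intro i hi
      have := hmem.2 (a - i) (by omega) (by omega)
      rw [← hE] at this
      simpa [sub_eq_add_neg] using this
    · have := hend 0 (by omega) (by omega)
      simpa using this
    · have := hend m le_rfl (by omega)
      simpa [sub_eq_add_neg] using this
    · intro i hi h
      have := hend (i + 1) hi.le ?_
      · simpa [sub_eq_add_neg] using this
      · intro _ _
        push_cast at h ⊢
        rw [show a - ((i : ℤ) + 1) - 1 = a - (i + 2) by ring,
          show a - ((i : ℤ) + 1) + 1 = a - i by ring]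
        linarith

/-! ### Convex envelopes along finite sequences of waves -/

/-- The waves in `A` with position `x` are given the speeds `σ` that are the increments of the
convex envelope of the primitive of `d`: the speeds are nondecreasing along each set of waves with
the same position, the primitive of `σ` lies below the one of `d`, and the two primitives coincide
where the speed jumps. -/
structure BlockSpeeds (A : Finset ℕ) (X d σ : ℕ → ℝ) : Prop where
  mono : ∀ s ∈ A, ∀ t ∈ A, X s = X t → s ≤ t → σ s ≤ σ t
  nonneg : ∀ (x : ℝ) (n : ℕ), 0 ≤ ∑ t ∈ A with X t = x ∧ t < n, (d t - σ t)
  eq_zero : ∀ (x : ℝ) (n : ℕ),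
    (∀ s ∈ A, ∀ t ∈ A, X s = x → X t = x → s < n → n ≤ t → σ s < σ t) →
    ∑ t ∈ A with X t = x ∧ t < n, (d t - σ t) = 0

/-- `P` is a wavefront: the set of all waves in `A` with a given position and a given speed. -/
def IsFront (A : Finset ℕ) (X σ : ℕ → ℝ) (P : Finset ℕ) : Prop :=
  P ⊆ A ∧ ∀ s ∈ P, ∀ t ∈ A, t ∈ P ↔ X t = X s ∧ σ t = σ s

section Envelope

variable {A : Finset ℕ} {X d σ : ℕ → ℝ}

lemma BlockSpeeds.sum_eq_zero (h : BlockSpeeds A X d σ) (x : ℝ) :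
    ∑ t ∈ A with X t = x, (d t - σ t) = 0 := by
  obtain ⟨N, hN⟩ := A.bddAbove
  have hlt : ∀ t ∈ A, t < N + 1 := fun t ht => Nat.lt_succ_of_le (hN ht)
  -- Past the last wave the condition for contact holds vacuously.
  rw [← h.eq_zero x (N + 1) fun s _ t ht _ _ _ hn => absurd (hlt t ht) (by omega)]
  refine Finset.sum_congr (Finset.filter_congr fun t ht => ?_) fun _ _ => rfl
  simp [hlt t ht]

lemma sum_filter_lt_add (A : Finset ℕ) (p : ℕ → Prop) [DecidablePred p] (g : ℕ → ℝ) (n : ℕ) :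
    ∑ t ∈ A with p t, g t = ∑ t ∈ A with p t ∧ t < n, g t + ∑ t ∈ A with p t ∧ n ≤ t, g t := by
  simp only [Finset.sum_filter, ← Finset.sum_add_distrib]
  refine Finset.sum_congr rfl fun t _ => ?_
  by_cases h1 : p t <;> by_cases h2 : t < n <;> simp [h1, h2, not_le.2, not_lt.1]

/-- If the averages of `d` over the initial segments of a block are at least `c`, the speeds in the
block are at least `c`. -/
lemma BlockSpeeds.le_of_prefix (h : BlockSpeeds A X d σ) {x c : ℝ}
    (hc : ∀ n, 0 ≤ ∑ t ∈ A with X t = x ∧ t < n, (d t - c)) {u : ℕ} (hu : u ∈ A) (hux : X u = x) :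
    c ≤ σ u := by
  set B := {t ∈ A | X t = x} with hB
  have hne : B.Nonempty := ⟨u, by simp [hB, hu, hux]⟩
  obtain ⟨s₀, hs₀, hmin⟩ := B.exists_min_image id hne
  have hs₀' := Finset.mem_filter.1 hs₀
  have hmin' : ∀ t ∈ A, X t = x → σ s₀ ≤ σ t := fun t ht htx =>
    h.mono _ hs₀'.1 _ ht (by rw [hs₀'.2, htx]) (hmin t (by simp [hB, ht, htx]))
  refine le_trans ?_ (hmin' u hu hux)
  obtain ⟨m, hm, hmax⟩ := {t ∈ B | σ t = σ s₀}.exists_max_image id ⟨s₀, by simp [hs₀]⟩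
  simp only [Finset.mem_filter, hB] at hm hmax
  have hprop : ∀ t ∈ A, X t = x → (t < m + 1 ↔ σ t = σ s₀) := by
    intro t ht htx
    constructor
    · intro hlt
      refine le_antisymm ?_ (hmin' t ht htx)
      rw [← hm.2]
      exact h.mono _ ht _ hm.1.1 (by rw [htx, hm.1.2]) (by omega)
    · intro he
      have := hmax t ⟨⟨ht, htx⟩, he⟩
      simp only [id] at this
      omega
  have h0 := h.eq_zero x (m + 1) fun s hs t ht hsx htx hsn hnt => by
    rw [(hprop s hs hsx).1 hsn]
    refine lt_of_le_of_ne (hmin' t ht htx) fun he => ?_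
    exact absurd ((hprop t ht htx).2 he.symm) (by omega)
  have h1 := hc (m + 1)
  have h2 : ∑ t ∈ A with X t = x ∧ t < m + 1, (d t - σ t) =
      ∑ t ∈ A with X t = x ∧ t < m + 1, (d t - σ s₀) := by
    refine Finset.sum_congr rfl fun t ht => ?_
    simp only [Finset.mem_filter] at ht
    rw [(hprop t ht.1 ht.2.1).1 ht.2.2]
  rw [h2] at h0
  by_contra hlt
  push Not at hlt
  have hlt' : ∑ t ∈ A with X t = x ∧ t < m + 1, (d t - c) <
      ∑ t ∈ A with X t = x ∧ t < m + 1, (d t - σ s₀) := by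
    refine Finset.sum_lt_sum_of_nonempty ⟨m, by simp [hm]⟩ fun t _ => by linarith
  linarith

/-- If the averages of `d` over the final segments of a block are at most `c`, the speeds in the
block are at most `c`. -/
lemma BlockSpeeds.le_of_suffix (h : BlockSpeeds A X d σ) {x c : ℝ}
    (hc : ∀ n, ∑ t ∈ A with X t = x ∧ n ≤ t, (d t - c) ≤ 0) {u : ℕ} (hu : u ∈ A) (hux : X u = x) :
    σ u ≤ c := by
  set B := {t ∈ A | X t = x} with hB
  have hne : B.Nonempty := ⟨u, by simp [hB, hu, hux]⟩
  obtain ⟨s₀, hs₀, hmax⟩ := B.exists_max_image id hne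
  have hs₀' := Finset.mem_filter.1 hs₀
  have hmax' : ∀ t ∈ A, X t = x → σ t ≤ σ s₀ := fun t ht htx =>
    h.mono _ ht _ hs₀'.1 (by rw [hs₀'.2, htx]) (hmax t (by simp [hB, ht, htx]))
  refine (hmax' u hu hux).trans ?_
  obtain ⟨m, hm, hmin⟩ := {t ∈ B | σ t = σ s₀}.exists_min_image id ⟨s₀, by simp [hs₀]⟩
  simp only [Finset.mem_filter, hB] at hm hmin
  have hprop : ∀ t ∈ A, X t = x → (m ≤ t ↔ σ t = σ s₀) := by
    intro t ht htx
    constructor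
    · intro hlt
      refine le_antisymm (hmax' t ht htx) ?_
      rw [← hm.2]
      exact h.mono _ hm.1.1 _ ht (by rw [htx, hm.1.2]) hlt
    · intro he
      exact hmin t ⟨⟨ht, htx⟩, he⟩
  have h0 := h.eq_zero x m fun s hs t ht hsx htx hsn hnt => by
    rw [(hprop t ht htx).1 hnt]
    refine lt_of_le_of_ne (hmax' s hs hsx) fun he => ?_
    exact absurd ((hprop s hs hsx).2 he) (by omega)
  have htot := h.sum_eq_zero x
  rw [sum_filter_lt_add A _ _ m, h0, zero_add] at htot
  have h1 := hc m
  have h2 : ∑ t ∈ A with X t = x ∧ m ≤ t, (d t - σ t) =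
      ∑ t ∈ A with X t = x ∧ m ≤ t, (d t - σ s₀) := by
    refine Finset.sum_congr rfl fun t ht => ?_
    simp only [Finset.mem_filter] at ht
    rw [(hprop t ht.1 ht.2.1).1 ht.2.2]
  rw [h2] at htot
  by_contra hlt
  push Not at hlt
  have hlt' : ∑ t ∈ A with X t = x ∧ m ≤ t, (d t - σ s₀) <
      ∑ t ∈ A with X t = x ∧ m ≤ t, (d t - c) := by
    refine Finset.sum_lt_sum_of_nonempty ⟨m, by simp [hm]⟩ fun t _ => by linarith
  linarith

/-- A block with the structure of a single shock of speed `c` travels with speed `c`. -/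
lemma BlockSpeeds.eq_of_shock (h : BlockSpeeds A X d σ) {x c : ℝ}
    (hc : ∀ n, 0 ≤ ∑ t ∈ A with X t = x ∧ t < n, (d t - c))
    (hc0 : ∑ t ∈ A with X t = x, (d t - c) = 0) {u : ℕ} (hu : u ∈ A) (hux : X u = x) :
    σ u = c := by
  refine le_antisymm (h.le_of_suffix (fun n => ?_) hu hux) (h.le_of_prefix hc hu hux)
  have := hc n
  rw [sum_filter_lt_add A _ _ n] at hc0
  linarith

lemma IsFront.eq {P : Finset ℕ} (hP : IsFront A X σ P) {s t : ℕ} (hs : s ∈ P) (ht : t ∈ P) :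
    X t = X s ∧ σ t = σ s := (hP.2 s hs t (hP.1 ht)).1 ht

/-- The envelope touches the primitive of `d` at the left end of the front, since the waves before
it in the block are strictly slower, and stays below it afterwards. -/
lemma IsFront.sum_prefix_nonneg (h : BlockSpeeds A X d σ) {P : Finset ℕ} (hP : IsFront A X σ P)
    {u : ℕ} (hu : u ∈ P) (n : ℕ) : 0 ≤ ∑ t ∈ P with t < n, (d t - σ u) := by
  obtain ⟨k, hk, hkmin⟩ := P.exists_min_image id ⟨u, hu⟩
  obtain ⟨m, hm, hmmax⟩ := P.exists_max_image id ⟨u, hu⟩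
  simp only [id] at hkmin hmmax
  have hkA := hP.1 hk
  have hmA := hP.1 hm
  have hmk := hP.eq hk hm
  have huk := hP.eq hk hu
  have h0 := h.eq_zero (X k) k fun s hs t ht hsx htx hsn hnt => by
    refine lt_of_lt_of_le (lt_of_le_of_ne (h.mono s hs k hkA hsx hsn.le) fun he => ?_)
      (h.mono k hkA t ht htx.symm hnt)
    have := hkmin s ((hP.2 k hk s hs).2 ⟨hsx, he⟩)
    omega
  -- The cut `n` is clipped to the range of the front, so that no later wave of the block is
  -- counted.
  have h1 := h.nonneg (X k) (max k (min n (m + 1)))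
  have h2 : ∑ t ∈ A with X t = X k ∧ t < max k (min n (m + 1)), (d t - σ t) =
      ∑ t ∈ A with X t = X k ∧ t < k, (d t - σ t) + ∑ t ∈ P with t < n, (d t - σ u) := by
    have e : {t ∈ P | t < n} = {t ∈ A | t ∈ P ∧ t < n} := by
      ext t
      simp only [Finset.mem_filter]
      exact ⟨fun h => ⟨hP.1 h.1, h⟩, fun h => h.2⟩
    rw [e]
    simp only [Finset.sum_filter, ← Finset.sum_add_distrib]
    refine Finset.sum_congr rfl fun t ht => ?_
    by_cases htP : t ∈ P
    · have e1 := hkmin t htP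
      have e2 := hmmax t htP
      have e3 := hP.eq hk htP
      rw [huk.2, e3.2]
      have : t < max k (min n (m + 1)) ↔ t < n := by omega
      simp [e3.1, htP, this, not_lt.2 e1]
    · by_cases htx : X t = X k
      · have : t < max k (min n (m + 1)) ↔ t < k := by
          constructor
          · intro hlt
            by_contra hge
            push Not at hge
            refine htP ((hP.2 k hk t ht).2 ⟨htx, le_antisymm ?_ (h.mono k hkA t ht htx.symm hge)⟩)
            rw [← hmk.2]
            exact h.mono t ht m hmA (by rw [htx, hmk.1]) (by omega)
          · omega
        simp [htx, htP, this]
      · simp [htx, htP]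
  rw [h2, h0] at h1
  linarith

/-- This is the Rankine-Hugoniot condition: the envelope touches at both ends of the front, so the
speed is the mean of `d`. For the upper bound, contact at the right end suffices; the lower bound is
the prefix inequality for the whole front. -/
lemma IsFront.sum_eq_zero (h : BlockSpeeds A X d σ) {P : Finset ℕ} (hP : IsFront A X σ P)
    {u : ℕ} (hu : u ∈ P) : ∑ t ∈ P, (d t - σ u) = 0 := by
  refine le_antisymm ?_ ?_
  · obtain ⟨m, hm, hmmax⟩ := P.exists_max_image id ⟨u, hu⟩
    simp only [id] at hmmax
    obtain ⟨k, hk, hkmin⟩ := P.exists_min_image id ⟨u, hu⟩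
    simp only [id] at hkmin
    have hkA := hP.1 hk
    have hmA := hP.1 hm
    have huk := hP.eq hk hu
    have hmk := hP.eq hk hm
    have h0 := h.eq_zero (X k) (m + 1) fun s hs t ht hsx htx hsn hnt => by
      refine lt_of_le_of_lt (h.mono s hs m hmA (by rw [hsx, hmk.1]) (by omega)) (lt_of_le_of_ne
        (h.mono m hmA t ht (by rw [htx, hmk.1]) (by omega)) fun he => ?_)
      have := hmmax t ((hP.2 m hm t ht).2 ⟨by rw [htx, hmk.1], he.symm⟩)
      omega
    have h1 := h.nonneg (X k) k
    have h2 : ∑ t ∈ A with X t = X k ∧ t < m + 1, (d t - σ t) =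
        ∑ t ∈ A with X t = X k ∧ t < k, (d t - σ t) + ∑ t ∈ P, (d t - σ u) := by
      have e : P = {t ∈ A | t ∈ P} := by
        ext t
        simp only [Finset.mem_filter]
        exact ⟨fun h => ⟨hP.1 h, h⟩, fun h => h.2⟩
      rw [e]
      simp only [Finset.sum_filter, ← Finset.sum_add_distrib]
      refine Finset.sum_congr rfl fun t ht => ?_
      by_cases htP : t ∈ P
      · have e1 := hkmin t htP
        have e2 := hmmax t htP
        have e3 := hP.eq hk htP
        rw [huk.2, e3.2]
        simp [e3.1, htP, not_lt.2 e1, Nat.lt_succ_of_le e2]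
      · by_cases htx : X t = X k
        · have : t < m + 1 ↔ t < k := by
            constructor
            · intro hlt
              by_contra hge
              push Not at hge
              refine htP ((hP.2 k hk t ht).2 ⟨htx, le_antisymm ?_ (h.mono k hkA t ht htx.symm hge)⟩)
              rw [← hmk.2]
              exact h.mono t ht m hmA (by rw [htx, hmk.1]) (by omega)
            · have := hkmin m hm
              omega
          simp [htx, htP, this]
        · simp [htx, htP]
    linarith
  · obtain ⟨N, hN⟩ := P.bddAbove
    have := hP.sum_prefix_nonneg h hu (N + 1)
    rwa [Finset.filter_true_of_mem fun t ht => Nat.lt_succ_of_le (hN ht)] at this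

lemma IsFront.sum_suffix_nonpos (h : BlockSpeeds A X d σ) {P : Finset ℕ} (hP : IsFront A X σ P)
    {u : ℕ} (hu : u ∈ P) (n : ℕ) : ∑ t ∈ P with n ≤ t, (d t - σ u) ≤ 0 := by
  have h1 := hP.sum_eq_zero h hu
  have h2 := hP.sum_prefix_nonneg h hu n
  rw [← Finset.sum_filter_add_sum_filter_not P (· < n)] at h1
  simp only [not_lt] at h1
  linarith

end Envelope

/-! ### Tangency of the envelopes at the points that separate waves that have interacted -/

/-- The sum of `d - c` over the waves of `A` in `[m, n)`. -/
noncomputable def window (A : Finset ℕ) (d : ℕ → ℝ) (c : ℝ) (m n : ℕ) : ℝ :=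
  ∑ t ∈ A with m ≤ t ∧ t < n, (d t - c)

section Window

variable {A A' : Finset ℕ} {d : ℕ → ℝ} {c c' : ℝ} {m k n : ℕ}

lemma window_add (hmk : m ≤ k) (hkn : k ≤ n) :
    window A d c m n = window A d c m k + window A d c k n := by
  simp only [window, Finset.sum_filter, ← Finset.sum_add_distrib]
  refine Finset.sum_congr rfl fun t _ => ?_
  by_cases h1 : t < k
  · have : ¬ k ≤ t := by omega
    have h2 : t < n := by omega
    simp [h1, this, h2]
  · have : k ≤ t := by omega
    have h2 : m ≤ t := by omega
    simp [h1, this, h2]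

lemma window_anti (h : c ≤ c') : window A d c' m n ≤ window A d c m n :=
  Finset.sum_le_sum fun _ _ => by linarith

lemma window_congr (h : ∀ t, m ≤ t → t < n → (t ∈ A ↔ t ∈ A')) :
    window A d c m n = window A' d c m n := by
  refine Finset.sum_congr ?_ fun _ _ => rfl
  ext t
  simp only [Finset.mem_filter]
  constructor
  · rintro ⟨h1, h2, h3⟩; exact ⟨(h t h2 h3).1 h1, h2, h3⟩
  · rintro ⟨h1, h2, h3⟩; exact ⟨(h t h2 h3).2 h1, h2, h3⟩

/-- The mean of `d` over the window lies between `c` and `c'`; the wave `t` makes the window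
nonempty. -/
lemma le_of_window {t : ℕ} (ht : t ∈ A) (h1 : m ≤ t) (h2 : t < n) (hc : 0 ≤ window A d c m n)
    (hc' : window A d c' m n ≤ 0) : c ≤ c' := by
  by_contra hlt
  push Not at hlt
  have : window A d c m n < window A d c' m n :=
    Finset.sum_lt_sum_of_nonempty ⟨t, by simp [ht, h1, h2]⟩ fun t _ => by linarith
  linarith

end Window

/-- No wavefront contains both waves `< n` and waves `≥ n`. -/
def Separates (A : Finset ℕ) (X σ : ℕ → ℝ) (n : ℕ) : Prop :=
  ∀ s ∈ A, ∀ t ∈ A, s < n → n ≤ t → ¬ (X s = X t ∧ σ s = σ t)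

/-- The properties of the relation `I` between the waves in `A` that have already interacted. -/
structure IsInteraction (A : Finset ℕ) (X : ℕ → ℝ) (S : ℕ → ℤ) (I : ℕ → ℕ → Prop) : Prop where
  of_eq : ∀ s ∈ A, ∀ t ∈ A, X s = X t → I s t
  between : ∀ s ∈ A, ∀ u ∈ A, ∀ t ∈ A, s ≤ u → u ≤ t → I s t → I s u ∧ I u t
  sign : ∀ s ∈ A, ∀ t ∈ A, I s t → S s = S t

/-- Waves that have already interacted are separated only at points where the convex envelope
along these waves is tangent to the flux. -/
def Tangency (A : Finset ℕ) (X d σ : ℕ → ℝ) (I : ℕ → ℕ → Prop) : Prop :=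
  ∀ n, Separates A X σ n → ∀ l ∈ A, ∀ z ∈ A, l < n → n ≤ z → (∃ q ∈ A, n ≤ q ∧ I l q) →
    (∃ p ∈ A, p < n ∧ I p z) → ∃ c, window A d c l n ≤ 0 ∧ 0 ≤ window A d c n (z + 1)

section Tangency

variable {A A' : Finset ℕ} {X X' d σ σ' : ℕ → ℝ} {S : ℕ → ℤ} {I : ℕ → ℕ → Prop}

/-- A separation point inside a block is a point where the speed jumps, so the envelope touches
there. Since the envelope lies below the primitive of `d` at `l` and after `z`, the sum of `d - σ`
is nonpositive on the left of `n` and nonnegative on the right. -/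
lemma BlockSpeeds.tangent (h : BlockSpeeds A X d σ)
    (hX : ∀ s ∈ A, ∀ t ∈ A, s ≤ t → X s ≤ X t) {n l z : ℕ} (hn : Separates A X σ n)
    (hl : l ∈ A) (hz : z ∈ A) (hln : l < n) (hnz : n ≤ z) (hlz : X l = X z) :
    ∃ c, window A d c l n ≤ 0 ∧ 0 ≤ window A d c n (z + 1) := by
  have hblock : ∀ t ∈ A, l ≤ t → t ≤ z → X t = X l := fun t ht h1 h2 =>
    le_antisymm (hlz ▸ hX t ht z hz h2) (hX l hl t ht h1)
  have h0 := h.eq_zero (X l) n fun s hs t ht hsx htx hsn hnt =>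
    lt_of_le_of_ne (h.mono s hs t ht (by rw [hsx, htx]) (by omega)) fun he =>
      hn s hs t ht hsn hnt ⟨by rw [hsx, htx], he⟩
  have hL : ∑ t ∈ A with l ≤ t ∧ t < n, (d t - σ t) ≤ 0 := by
    have h1 := h.nonneg (X l) l
    have : ∑ t ∈ A with X t = X l ∧ t < n, (d t - σ t) = ∑ t ∈ A with X t = X l ∧ t < l, (d t - σ t)
        + ∑ t ∈ A with l ≤ t ∧ t < n, (d t - σ t) := by
      simp only [Finset.sum_filter, ← Finset.sum_add_distrib]
      refine Finset.sum_congr rfl fun t ht => ?_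
      by_cases h1 : t < l
      · have h2 : t < n := by omega
        simp [h1, h2, not_le.2 h1]
      · by_cases h2 : t < n
        · have := hblock t ht (by omega) (by omega)
          simp [this, h1, h2, not_lt.1 h1]
        · simp [h1, h2]
    linarith
  have hR : 0 ≤ ∑ t ∈ A with n ≤ t ∧ t < z + 1, (d t - σ t) := by
    have h1 := h.nonneg (X l) (z + 1)
    have : ∑ t ∈ A with X t = X l ∧ t < z + 1, (d t - σ t) =
        ∑ t ∈ A with X t = X l ∧ t < n, (d t - σ t)
        + ∑ t ∈ A with n ≤ t ∧ t < z + 1, (d t - σ t) := by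
      simp only [Finset.sum_filter, ← Finset.sum_add_distrib]
      refine Finset.sum_congr rfl fun t ht => ?_
      by_cases h1 : t < n
      · have h2 : t < z + 1 := by omega
        simp [h1, h2, not_le.2 h1]
      · by_cases h2 : t < z + 1
        · have := hblock t ht (by omega) (by omega)
          simp [this, h1, h2, not_lt.1 h1]
        · simp [h1, h2]
    linarith
  -- The slope `c` is the speed of the last wave before `n`: by monotonicity it is at least every
  -- speed on the left and at most every speed on the right.
  obtain ⟨m, hm, hmax⟩ := {t ∈ A | l ≤ t ∧ t < n}.exists_max_image id ⟨l, by simp [hl, hln]⟩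
  simp only [Finset.mem_filter, id] at hm hmax
  have hmx := hblock m hm.1 hm.2.1 (by omega)
  refine ⟨σ m, le_trans (Finset.sum_le_sum fun t ht => ?_) hL,
    le_trans hR (Finset.sum_le_sum fun t ht => ?_)⟩
  · have ht' := Finset.mem_filter.1 ht
    have := h.mono t ht'.1 m hm.1 (by rw [hmx, hblock t ht'.1 ht'.2.1 (by omega)]) (hmax t ht')
    linarith
  · have ht' := Finset.mem_filter.1 ht
    have := h.mono m hm.1 t ht'.1 (by rw [hmx, hblock t ht'.1 (by omega) (by omega)]) (by omega)
    linarith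

/-- At the initial time only waves with the same position have interacted. -/
lemma BlockSpeeds.tangency (h : BlockSpeeds A X d σ)
    (hX : ∀ s ∈ A, ∀ t ∈ A, s ≤ t → X s ≤ X t) : Tangency A X d σ (fun s t => X s = X t) := by
  rintro n hn l hl z hz hln hnz ⟨q, hq, hnq, hlq⟩ ⟨p, hp, hpn, hpz⟩
  refine h.tangent hX hn hl hz hln hnz ?_
  have e1 := hX l hl z hz (by omega)
  have e2 := hX p hp q hq (by omega)
  exact le_antisymm e1 (by rw [← hpz, hlq]; exact e2)

/-- Tangency is preserved if no wave is removed and all wavefronts are prolonged or merged. -/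
lemma Tangency.of_merge (hT : Tangency A X d σ I)
    (hfront : ∀ s ∈ A, ∀ t ∈ A, X s = X t → σ s = σ t → X' s = X' t)
    (hblock : ∀ s ∈ A, ∀ t ∈ A, X' s = X' t → σ' s = σ' t) :
    Tangency A X' d σ' (fun s t => I s t ∨ X' s = X' t) := by
  rintro n hn l hl z hz hln hnz ⟨q, hq, hnq, hlq⟩ ⟨p, hp, hpn, hpz⟩
  -- Two waves at the same new position form one front and cannot be separated by `n`, so across `n`
  -- only the old interactions count.
  have key : ∀ s ∈ A, ∀ t ∈ A, s < n → n ≤ t → (I s t ∨ X' s = X' t) → I s t :=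
    fun s hs t ht h1 h2 h => h.resolve_right fun he => hn s hs t ht h1 h2 ⟨he, hblock s hs t ht he⟩
  refine hT n (fun s hs t ht h1 h2 h => hn s hs t ht h1 h2 ?_) l hl z hz hln hnz
    ⟨q, hq, hnq, key l hl q hq hln hnq hlq⟩ ⟨p, hp, hpn, key p hp z hz hpn hnz hpz⟩
  exact ⟨hfront s hs t ht h.1 h.2, hblock s hs t ht (hfront s hs t ht h.1 h.2)⟩

/-- Tangency is preserved by a cancellation of consecutive waves of both signs, if no wavefronts
merge. -/
lemma Tangency.of_cancellation (h : BlockSpeeds A X d σ) (h' : BlockSpeeds A' X' d σ')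
    (hX : ∀ s ∈ A, ∀ t ∈ A, s ≤ t → X s ≤ X t) (hX' : ∀ s ∈ A', ∀ t ∈ A', s ≤ t → X' s ≤ X' t)
    (hI : IsInteraction A X S I) (hT : Tangency A X d σ I) (hsub : A' ⊆ A)
    (hfront : ∀ s ∈ A', ∀ t ∈ A', X' s = X' t ↔ X s = X t ∧ σ s = σ t)
    (hconv : ∀ u ∈ A', (∀ v ∈ A \ A', u < v) ∨ (∀ v ∈ A \ A', v < u))
    (hsign : ∃ v₁ ∈ A \ A', ∃ v₂ ∈ A \ A', S v₁ ≠ S v₂) :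
    Tangency A' X' d σ' (fun s t => I s t ∨ X' s = X' t) := by
  rintro n hn l hl z hz hln hnz ⟨q, hq, hnq, hlq⟩ ⟨p, hp, hpn, hpz⟩
  have key : ∀ s ∈ A', ∀ t ∈ A', (I s t ∨ X' s = X' t) → I s t := fun s hs t ht h =>
    h.elim id fun he => hI.of_eq s (hsub hs) t (hsub ht) ((hfront s hs t ht).1 he).1
  replace hlq := key l hl q hq hlq
  replace hpz := key p hp z hz hpz
  -- If one removed wave lay between two surviving waves that have interacted, all removed waves
  -- would. They would then all have the sign of `s`, but they have both signs.
  have hkeep : ∀ s ∈ A', ∀ t ∈ A', I s t → ∀ u, s ≤ u → u ≤ t → (u ∈ A ↔ u ∈ A') := by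
    intro s hs t ht hst u hsu hut
    refine ⟨fun hu => ?_, fun hu => hsub hu⟩
    by_contra hu'
    have huR : u ∈ A \ A' := Finset.mem_sdiff.2 ⟨hu, hu'⟩
    have e1 : ∀ v ∈ A \ A', s < v := (hconv s hs).resolve_right fun h => by
      have := h u huR
      omega
    have e2 : ∀ v ∈ A \ A', v < t := (hconv t ht).resolve_left fun h => by
      have := h u huR
      omega
    have e3 : ∀ v ∈ A \ A', S s = S v := fun v hv =>
      have hv' := (Finset.mem_sdiff.1 hv).1
      hI.sign s (hsub hs) v hv'
        (hI.between s (hsub hs) v hv' t (hsub ht) (e1 v hv).le (e2 v hv).le hst).1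
    obtain ⟨v₁, h₁, v₂, h₂, hne⟩ := hsign
    exact hne (by rw [← e3 v₁ h₁, e3 v₂ h₂])
  have hkl := hkeep l hl q hq hlq
  have hkz := hkeep p hp z hz hpz
  have hkeepAll : ∀ u, l ≤ u → u ≤ z → (u ∈ A ↔ u ∈ A') := by
    intro u h1 h2
    rcases le_or_gt u q with h3 | h3
    · exact hkl u h1 h3
    · exact hkz u (by omega) h2
  have hwin : ∀ c a b, l ≤ a → b ≤ z + 1 → window A' d c a b = window A d c a b :=
    fun c a b h1 h2 => (window_congr fun t h3 h4 => hkeepAll t (by omega) (by omega)).symm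
  by_cases hsep : Separates A X σ n
  · obtain ⟨c, h1, h2⟩ := hT n hsep l (hsub hl) z (hsub hz) hln hnz ⟨q, hsub hq, hnq, hlq⟩
      ⟨p, hsub hp, hpn, hpz⟩
    exact ⟨c, by rwa [hwin _ _ _ le_rfl (by omega)], by rwa [hwin _ _ _ hln.le le_rfl]⟩
  -- a wavefront has been split at `n`
  simp only [Separates, not_forall, not_not] at hsep
  obtain ⟨s₀, hs₀, t₀, ht₀, hs₀n, hnt₀, hx₀, hσ₀⟩ := hsep
  have hfr : ∀ u ∈ A, s₀ ≤ u → u ≤ t₀ → X u = X s₀ ∧ σ u = σ s₀ := by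
    intro u hu h1 h2
    have e1 := hX s₀ hs₀ u hu h1
    have e2 := hX u hu t₀ ht₀ h2
    have e : X u = X s₀ := le_antisymm (by rwa [hx₀]) e1
    refine ⟨e, le_antisymm ?_ (h.mono s₀ hs₀ u hu e.symm h1)⟩
    rw [hσ₀]
    exact h.mono u hu t₀ ht₀ (by rw [e, hx₀]) h2
  -- the front is convex
  have hfr2 : ∀ a ∈ A, ∀ b ∈ A, ∀ u ∈ A, a ≤ u → u ≤ b → X a = X s₀ ∧ σ a = σ s₀ →
      X b = X s₀ ∧ σ b = σ s₀ → X u = X s₀ ∧ σ u = σ s₀ := by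
    intro a ha b hb u hu h1 h2 h3 h4
    have e : X u = X s₀ := le_antisymm (h4.1 ▸ hX u hu b hb h2) (h3.1 ▸ hX a ha u hu h1)
    exact ⟨e, le_antisymm (h4.2 ▸ h.mono u hu b hb (by rw [e, h4.1]) h2)
      (h3.2 ▸ h.mono a ha u hu (by rw [e, h3.1]) h1)⟩
  have hs₁ : max s₀ l ∈ A ∧ X (max s₀ l) = X s₀ ∧ σ (max s₀ l) = σ s₀ := by
    rcases le_total s₀ l with h1 | h1
    · rw [max_eq_right h1]; exact ⟨hsub hl, hfr l (hsub hl) h1 (by omega)⟩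
    · rw [max_eq_left h1]; exact ⟨hs₀, rfl, rfl⟩
  have ht₁ : min t₀ z ∈ A ∧ X (min t₀ z) = X s₀ ∧ σ (min t₀ z) = σ s₀ := by
    rcases le_total t₀ z with h1 | h1
    · rw [min_eq_left h1]; exact ⟨ht₀, hx₀.symm, hσ₀.symm⟩
    · rw [min_eq_right h1]; exact ⟨hsub hz, hfr z (hsub hz) (by omega) h1⟩
  -- From `a` to `b` extends the part of the split front that lies between `l` and `z`. It survives
  -- entirely, and the new envelope supplies the slope `c` there.
  obtain ⟨a, ha, hamin⟩ := {t ∈ A | (l ≤ t ∧ t < n) ∧ X t = X s₀ ∧ σ t = σ s₀}.exists_min_image id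
    ⟨max s₀ l, by simp [hs₁, hs₀n, hln]⟩
  obtain ⟨b, hb, hbmax⟩ := {t ∈ A | (n ≤ t ∧ t ≤ z) ∧ X t = X s₀ ∧ σ t = σ s₀}.exists_max_image id
    ⟨min t₀ z, by simp [ht₁, hnt₀, hnz]⟩
  simp only [Finset.mem_filter, id] at ha hamin hb hbmax
  obtain ⟨haA, ⟨hla, han⟩, haF⟩ := ha
  obtain ⟨hbA, ⟨hnb, hbz⟩, hbF⟩ := hb
  have haA' := (hkeepAll a hla (by omega)).1 haA
  have hbA' := (hkeepAll b (by omega) hbz).1 hbA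
  obtain ⟨c, hc1, hc2⟩ := h'.tangent hX' hn haA' hbA' han hnb
    ((hfront a haA' b hbA').2 ⟨by rw [haF.1, hbF.1], by rw [haF.2, hbF.2]⟩)
  rw [hwin _ _ _ hla (by omega)] at hc1
  rw [hwin _ _ _ hln.le (by omega)] at hc2
  refine ⟨c, ?_, ?_⟩
  · rw [hwin _ _ _ le_rfl (by omega), window_add hla han.le]
    rcases hla.eq_or_lt with rfl | hlt
    · rw [show window A d c l l = 0 by
        unfold window; rw [Finset.filter_false_of_mem (by intros; omega)]; simp]
      linarith
    · have hsepa : Separates A X σ a := by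
        rintro s hs t ht hsa hat ⟨e1, e2⟩
        have ea := hX s hs a haA hsa.le
        have eb := hX a haA t ht hat
        have hxa : X s = X a := le_antisymm ea (by rw [e1]; exact eb)
        have hsF : X s = X s₀ ∧ σ s = σ s₀ := by
          refine ⟨by rw [hxa, haF.1], ?_⟩
          rw [← haF.2]
          exact le_antisymm (h.mono s hs a haA hxa hsa.le)
            (by rw [e2]; exact h.mono a haA t ht (by rw [← hxa, e1]) hat)
        rcases le_total l s with h1 | h1
        · have := hamin s ⟨hs, ⟨h1, by omega⟩, hsF⟩
          omega
        · have := hamin l ⟨hsub hl, ⟨le_rfl, hln⟩, hfr2 s hs a haA l (hsub hl) h1 hla hsF haF⟩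
          omega
      obtain ⟨w, hw, hwmax⟩ := {t ∈ A | a ≤ t ∧ t < n}.exists_max_image id
        ⟨a, by simp [haA, han]⟩
      simp only [Finset.mem_filter, id] at hw hwmax
      obtain ⟨c₁, h1, h2⟩ := hT a hsepa l (hsub hl) w hw.1 hlt hw.2.1
        ⟨q, hsub hq, by omega, hlq⟩ ⟨l, hsub hl, hlt,
          (hI.between l (hsub hl) w hw.1 q (hsub hq) (by omega) (by omega) hlq).1⟩
      have e : window A d c₁ a (w + 1) = window A d c₁ a n := by
        refine Finset.sum_congr (Finset.filter_congr fun t ht => ?_) fun _ _ => rfl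
        refine ⟨fun h => ⟨h.1, by omega⟩, fun h => ⟨h.1, ?_⟩⟩
        have := hwmax t ⟨ht, h⟩
        omega
      rw [e] at h2
      -- The old tangency at `a` gives a slope `c₁` at most the mean over `[a, n)`, which is at most
      -- `c`. Hence the bound on `[l, a)` for `c₁` holds also for `c`. The right side is symmetric.
      have := le_of_window haA le_rfl han h2 hc1
      linarith [window_anti (A := A) (d := d) (m := l) (n := a) this]
  · rw [hwin _ _ _ hln.le le_rfl, window_add (k := b + 1) (by omega) (by omega)]
    rcases hbz.eq_or_lt with rfl | hlt
    · rw [show window A d c (b + 1) (b + 1) = 0 by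
        unfold window; rw [Finset.filter_false_of_mem (by intros; omega)]; simp]
      linarith
    · have hsepb : Separates A X σ (b + 1) := by
        rintro s hs t ht hsb hbt ⟨e1, e2⟩
        have ea := hX s hs b hbA (by omega)
        have eb := hX b hbA t ht (by omega)
        have hxb : X b = X t := le_antisymm eb (by rw [← e1]; exact ea)
        have htF : X t = X s₀ ∧ σ t = σ s₀ := by
          refine ⟨by rw [← hxb, hbF.1], ?_⟩
          rw [← hbF.2]
          exact le_antisymm (by rw [← e2]; exact h.mono s hs b hbA (by rw [hxb, e1]) (by omega))
            (h.mono b hbA t ht hxb (by omega))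
        rcases le_total t z with h1 | h1
        · have := hbmax t ⟨ht, ⟨by omega, h1⟩, htF⟩
          omega
        · have := hbmax z ⟨hsub hz, ⟨hnz, le_rfl⟩,
            hfr2 b hbA t ht z (hsub hz) hbz h1 hbF htF⟩
          omega
      obtain ⟨w, hw, hwmin⟩ := {t ∈ A | n ≤ t ∧ t ≤ b}.exists_min_image id
        ⟨b, by simp [hbA, hnb]⟩
      simp only [Finset.mem_filter, id] at hw hwmin
      have hwz := (hI.between p (hsub hp) w hw.1 z (hsub hz) (by omega) (by omega) hpz).2
      obtain ⟨c₂, h1, h2⟩ := hT (b + 1) hsepb w hw.1 z (hsub hz) (by omega) (by omega)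
        ⟨z, hsub hz, by omega, hwz⟩ ⟨w, hw.1, by omega, hwz⟩
      have e : window A d c₂ w (b + 1) = window A d c₂ n (b + 1) := by
        refine Finset.sum_congr (Finset.filter_congr fun t ht => ?_) fun _ _ => rfl
        refine ⟨fun h => ⟨by omega, h.2⟩, fun h => ⟨?_, h.2⟩⟩
        exact hwmin t ⟨ht, by omega, by omega⟩
      rw [e] at h1
      have := le_of_window hbA hnb (by omega) hc2 h1
      linarith [window_anti (A := A) (d := d) (m := b + 1) (n := z + 1) this]

end Tangency

/-! ### Estimates at a collision -/

/-- Along waves of constant sign, `d` varies at most by `K` from a wave to the next one. -/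
def LipschitzAlong (A : Finset ℕ) (S : ℕ → ℤ) (d : ℕ → ℝ) (K : ℝ) : Prop :=
  ∀ s ∈ A, ∀ t ∈ A, s ≤ t → (∀ u ∈ A, s ≤ u → u ≤ t → S u = S s) →
    |d s - d t| ≤ K * ({u ∈ A | s < u ∧ u ≤ t}.card : ℝ)

lemma LipschitzAlong.abs_sub_le {A : Finset ℕ} {S : ℕ → ℤ} {d : ℕ → ℝ} {K : ℝ} (hK : 0 ≤ K)
    (h : LipschitzAlong A S d K) {C : Finset ℕ} (hC : C ⊆ A)
    (hconv : ∀ s ∈ C, ∀ t ∈ C, ∀ u ∈ A, s ≤ u → u ≤ t → u ∈ C)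
    (hS : ∀ s ∈ C, ∀ t ∈ C, S s = S t) {s t : ℕ} (hs : s ∈ C) (ht : t ∈ C) :
    |d s - d t| ≤ K * (C.card : ℝ) := by
  wlog hst : s ≤ t generalizing s t
  · rw [abs_sub_comm]; exact this ht hs (by omega)
  refine (h s (hC hs) t (hC ht) hst fun u hu h1 h2 => hS u (hconv s hs t ht u hu h1 h2) s hs).trans
    (mul_le_mul_of_nonneg_left (Nat.cast_le.2 (Finset.card_le_card fun u hu => ?_)) hK)
  simp only [Finset.mem_filter] at hu
  exact hconv s hs t ht u hu.1 hu.2.1.le hu.2.2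

lemma sum_sub_const_sub (P : Finset ℕ) (d : ℕ → ℝ) (a b : ℝ) :
    ∑ t ∈ P, (d t - a) - ∑ t ∈ P, (d t - b) = P.card * (b - a) := by
  rw [← Finset.sum_sub_distrib]
  simp
  ring

/-- Some wave of `L` has `d ≤ c`, so `d - c ≤ K |P|` on all of `P`. In the sum of `d - c` over `P`,
which is `|P| (σ - c)`, the part over `L` is nonpositive, and `|P|` cancels from the rest. -/
lemma sub_le_of_sum_nonpos {P L : Finset ℕ} {d : ℕ → ℝ} {σ c K : ℝ} (hL : L ⊆ P)
    (hne : L.Nonempty) (hP : ∑ t ∈ P, (d t - σ) = 0) (hc : ∑ t ∈ L, (d t - c) ≤ 0)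
    (hd : ∀ s ∈ P, ∀ t ∈ P, d s - d t ≤ K * (P.card : ℝ)) :
    σ - c ≤ K * ((P \ L).card : ℝ) := by
  obtain ⟨k, hk, hkc⟩ : ∃ k ∈ L, d k ≤ c := by
    by_contra hcon
    push Not at hcon
    have := Finset.sum_pos (fun t ht => sub_pos.2 (hcon t ht)) hne
    linarith
  have h1 := sum_sub_const_sub P d c σ
  rw [hP, sub_zero, ← Finset.sum_sdiff hL] at h1
  have h2 : ∑ t ∈ P \ L, (d t - c) ≤ (P \ L).card • (K * (P.card : ℝ)) :=
    Finset.sum_le_card_nsmul _ _ _ fun t ht => by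
      have := hd t (Finset.mem_sdiff.1 ht).1 k (hL hk)
      linarith
  rw [nsmul_eq_mul] at h2
  have hpos : (0 : ℝ) < P.card := by
    exact_mod_cast Finset.card_pos.2 (hne.mono hL)
  refine le_of_mul_le_mul_left ?_ hpos
  linarith

section Collision

variable {A : Finset ℕ} {X d σ : ℕ → ℝ} {S : ℕ → ℤ} {I : ℕ → ℕ → Prop} {P Q : Finset ℕ} {K : ℝ}

lemma IsFront.convex (hX : ∀ s ∈ A, ∀ t ∈ A, s ≤ t → X s ≤ X t) (h : BlockSpeeds A X d σ)
    (hP : IsFront A X σ P) : ∀ s ∈ P, ∀ t ∈ P, ∀ u ∈ A, s ≤ u → u ≤ t → u ∈ P := by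
  intro s hs t ht u hu h1 h2
  have hst := hP.eq hs ht
  have e : X u = X s := le_antisymm (hst.1 ▸ hX u hu t (hP.1 ht) h2) (hX s (hP.1 hs) u hu h1)
  exact (hP.2 s hs u hu).2 ⟨e, le_antisymm
    (hst.2 ▸ h.mono u hu t (hP.1 ht) (by rw [e, hst.1]) h2) (h.mono s (hP.1 hs) u hu e.symm h1)⟩

/-- The difference of the speeds of two colliding wavefronts of the same sign is controlled by the
number of the pairs of waves that have not interacted before. -/
lemma speed_sub_mul_le (hX : ∀ s ∈ A, ∀ t ∈ A, s ≤ t → X s ≤ X t) (h : BlockSpeeds A X d σ)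
    (hI : IsInteraction A X S I) (hT : Tangency A X d σ I) (hK : 0 ≤ K)
    (hd : LipschitzAlong A S d K) (hP : IsFront A X σ P) (hQ : IsFront A X σ Q)
    (hPQ : ∀ s ∈ P, ∀ t ∈ Q, s < t)
    (hconv : ∀ s ∈ P ∪ Q, ∀ t ∈ P ∪ Q, ∀ u ∈ A, s ≤ u → u ≤ t → u ∈ P ∪ Q)
    (hS : ∀ s ∈ P ∪ Q, ∀ t ∈ P ∪ Q, S s = S t) {p q : ℕ} (hp : p ∈ P) (hq : q ∈ Q)
    [DecidablePred fun x : ℕ × ℕ => ¬ I x.1 x.2] :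
    (σ p - σ q) * (P.card * Q.card) ≤
      2 * K * ({x ∈ P ×ˢ Q | ¬ I x.1 x.2}.card : ℝ) * (P.card + Q.card) := by
  classical
  have hPQA : P ∪ Q ⊆ A := Finset.union_subset hP.1 hQ.1
  have hPS : ∀ s ∈ P, ∀ t ∈ P, S s = S t := fun s hs t ht =>
    hS s (Finset.mem_union_left _ hs) t (Finset.mem_union_left _ ht)
  have hQS : ∀ s ∈ Q, ∀ t ∈ Q, S s = S t := fun s hs t ht =>
    hS s (Finset.mem_union_right _ hs) t (Finset.mem_union_right _ ht)
  have hPd : ∀ s ∈ P, ∀ t ∈ P, d s - d t ≤ K * (P.card : ℝ) := fun s hs t ht =>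
    (le_abs_self _).trans (hd.abs_sub_le hK hP.1 (hP.convex hX h) hPS hs ht)
  have hQd : ∀ s ∈ Q, ∀ t ∈ Q, d s - d t ≤ K * (Q.card : ℝ) := fun s hs t ht =>
    (le_abs_self _).trans (hd.abs_sub_le hK hQ.1 (hQ.convex hX h) hQS hs ht)
  have hPpos : (0 : ℝ) < P.card := by exact_mod_cast Finset.card_pos.2 ⟨p, hp⟩
  have hQpos : (0 : ℝ) < Q.card := by exact_mod_cast Finset.card_pos.2 ⟨q, hq⟩
  have hP0 := hP.sum_eq_zero h hp
  have hQ0 := hQ.sum_eq_zero h hq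
  set N : ℝ := ({x ∈ P ×ˢ Q | ¬ I x.1 x.2}.card : ℝ) with hN
  -- The waves of `P` that have met some wave of `Q`. A wave outside `L` has met none of them, so it
  -- accounts for `|Q|` new pairs; `R` plays the same role in `Q`.
  set L := {l ∈ P | ∃ t ∈ Q, I l t} with hL
  set R := {z ∈ Q | ∃ s ∈ P, I s z} with hR
  have hLP : L ⊆ P := Finset.filter_subset _ _
  have hRQ : R ⊆ Q := Finset.filter_subset _ _
  have hN1 : ((P \ L).card * Q.card : ℝ) ≤ N := by
    rw [hN, ← Nat.cast_mul, ← Finset.card_product]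
    refine Nat.cast_le.2 (Finset.card_le_card fun x hx => ?_)
    simp only [Finset.mem_product, Finset.mem_sdiff, hL, Finset.mem_filter, not_and, not_exists]
      at hx ⊢
    exact ⟨⟨hx.1.1, hx.2⟩, hx.1.2 hx.1.1 _ hx.2⟩
  have hN2 : (P.card * (Q \ R).card : ℝ) ≤ N := by
    rw [hN, ← Nat.cast_mul, ← Finset.card_product]
    refine Nat.cast_le.2 (Finset.card_le_card fun x hx => ?_)
    simp only [Finset.mem_product, Finset.mem_sdiff, hR, Finset.mem_filter, not_and, not_exists]
      at hx ⊢
    exact ⟨⟨hx.1, hx.2.1⟩, hx.2.2 hx.2.1 _ hx.1⟩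
  have hdiff : σ p - σ q ≤ K * ((P \ L).card : ℝ) + K * ((Q \ R).card : ℝ) := by
    -- If no pair has interacted there is no tangency to use. Then `σ p` and `σ q` are compared
    -- directly with values of `d`, which varies by at most `K (|P| + |Q|)` over both fronts.
    rcases L.eq_empty_or_nonempty with hL0 | hL0
    · have hR0 : R = ∅ := by
        rw [Finset.eq_empty_iff_forall_notMem] at hL0 ⊢
        intro z hz
        obtain ⟨hzQ, s, hs, hsz⟩ := Finset.mem_filter.1 hz
        exact hL0 s (Finset.mem_filter.2 ⟨hs, z, hzQ, hsz⟩)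
      rw [hL0, hR0, Finset.sdiff_empty, Finset.sdiff_empty]
      obtain ⟨i, hi, hi'⟩ : ∃ i ∈ P, σ p ≤ d i := by
        by_contra hcon
        push Not at hcon
        have := Finset.sum_neg (fun t ht => sub_neg.2 (hcon t ht)) ⟨p, hp⟩
        linarith
      obtain ⟨j, hj, hj'⟩ : ∃ j ∈ Q, d j ≤ σ q := by
        by_contra hcon
        push Not at hcon
        have := Finset.sum_pos (fun t ht => sub_pos.2 (hcon t ht)) ⟨q, hq⟩
        linarith
      have h1 := (le_abs_self _).trans (hd.abs_sub_le hK hPQA hconv hS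
        (Finset.mem_union_left Q hi) (Finset.mem_union_right P hj))
      have h2 : ((P ∪ Q).card : ℝ) ≤ P.card + Q.card := by
        exact_mod_cast Finset.card_union_le P Q
      have h3 := mul_le_mul_of_nonneg_left h2 hK
      linarith
    · obtain ⟨l₁, hl₁⟩ := hL0
      obtain ⟨hl₁P, z₁, hz₁, hlz₁⟩ := Finset.mem_filter.1 hl₁
      have hR0 : R.Nonempty := ⟨z₁, Finset.mem_filter.2 ⟨hz₁, l₁, hl₁P, hlz₁⟩⟩
      obtain ⟨l, hlL, hlmin⟩ := L.exists_min_image id ⟨l₁, hl₁⟩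
      obtain ⟨z, hzR, hzmax⟩ := R.exists_max_image id hR0
      -- Tangency is applied at the first wave of `Q`, where the two fronts are separated, with `l`
      -- the first wave of `L` and `z` the last wave of `R`. As interaction passes to the waves in
      -- between, the two windows are exactly `L` and `R`.
      obtain ⟨n, hn, hnmin⟩ := Q.exists_min_image id ⟨q, hq⟩
      simp only [id] at hlmin hzmax hnmin
      obtain ⟨hlP, z', hz', hlz'⟩ := Finset.mem_filter.1 hlL
      obtain ⟨hzQ, l', hl', hlz⟩ := Finset.mem_filter.1 hzR
      have hsep : Separates A X σ n := by
        rintro s hs t ht hsn hnt ⟨e1, e2⟩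
        have ea := hX s hs n (hQ.1 hn) hsn.le
        have eb := hX n (hQ.1 hn) t ht hnt
        have hx : X s = X n := le_antisymm ea (by rw [e1]; exact eb)
        have hsQ : s ∈ Q := (hQ.2 n hn s hs).2 ⟨hx, le_antisymm
          (h.mono s hs n (hQ.1 hn) hx hsn.le)
          (by rw [e2]; exact h.mono n (hQ.1 hn) t ht (by rw [← hx, e1]) hnt)⟩
        have := hnmin s hsQ
        omega
      obtain ⟨c, hc1, hc2⟩ := hT n hsep l (hP.1 hlP) z (hQ.1 hzQ) (hPQ l hlP n hn) (hnmin z hzQ)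
        ⟨z', hQ.1 hz', hnmin z' hz', hlz'⟩ ⟨l', hP.1 hl', hPQ l' hl' n hn, hlz⟩
      have hw1 : window A d c l n = ∑ t ∈ L, (d t - c) := by
        refine Finset.sum_congr ?_ fun _ _ => rfl
        ext t
        simp only [Finset.mem_filter]
        constructor
        · rintro ⟨htA, hlt, htn⟩
          have htPQ := hconv l (Finset.mem_union_left _ hlP) n (Finset.mem_union_right _ hn) t htA
            hlt htn.le
          have htP : t ∈ P := (Finset.mem_union.1 htPQ).resolve_right fun htQ => by
            have := hnmin t htQ
            omega
          exact Finset.mem_filter.2 ⟨htP, z', hz', (hI.between l (hP.1 hlP) t htA z' (hQ.1 hz') hlt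
            (hPQ t htP z' hz').le hlz').2⟩
        · intro ht
          have htP := hLP ht
          exact ⟨hP.1 htP, hlmin t ht, hPQ t htP n hn⟩
      have hw2 : window A d c n (z + 1) = ∑ t ∈ R, (d t - c) := by
        refine Finset.sum_congr ?_ fun _ _ => rfl
        ext t
        simp only [Finset.mem_filter]
        constructor
        · rintro ⟨htA, hnt, htz⟩
          have htQ := hQ.convex hX h n hn z hzQ t htA hnt (by omega)
          exact Finset.mem_filter.2 ⟨htQ, l', hl', (hI.between l' (hP.1 hl') t htA z (hQ.1 hzQ)
            (hPQ l' hl' t htQ).le (by omega) hlz).1⟩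
        · intro ht
          have := hzmax t ht
          exact ⟨hQ.1 (hRQ ht), hnmin t (hRQ ht), by omega⟩
      rw [hw1] at hc1
      rw [hw2] at hc2
      have e1 := sub_le_of_sum_nonpos hLP ⟨l, hlL⟩ hP0 hc1 hPd
      -- The mirror image of the estimate for `P`, obtained by changing the sign of `d` and of the
      -- speeds.
      have e2 := sub_le_of_sum_nonpos (d := fun t => -d t) (σ := -σ q) (c := -c) (K := K) hRQ hR0
        (by rw [← neg_eq_zero, ← Finset.sum_neg_distrib, ← hQ0]
            exact Finset.sum_congr rfl fun _ _ => by ring)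
        (by rw [← neg_nonneg, ← Finset.sum_neg_distrib]
            refine hc2.trans_eq (Finset.sum_congr rfl fun _ _ => by ring))
        fun s hs t ht => by have := hQd t ht s hs; linarith
      linarith
  have ha : (0 : ℝ) ≤ (P \ L).card := Nat.cast_nonneg _
  have hb : (0 : ℝ) ≤ (Q \ R).card := Nat.cast_nonneg _
  have hPle : (P.card : ℝ) ≤ P.card + Q.card := by linarith
  have hQle : (Q.card : ℝ) ≤ P.card + Q.card := by linarith
  calc (σ p - σ q) * (P.card * Q.card)
      ≤ (K * ((P \ L).card : ℝ) + K * ((Q \ R).card : ℝ)) * (P.card * Q.card) :=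
        mul_le_mul_of_nonneg_right hdiff (by positivity)
    _ = K * ((((P \ L).card : ℝ) * Q.card) * P.card + (P.card * (Q \ R).card : ℝ) * Q.card) := by
        ring
    _ ≤ K * (N * (P.card + Q.card) + N * (P.card + Q.card)) := by
        refine mul_le_mul_of_nonneg_left (add_le_add ?_ ?_) hK
        · exact mul_le_mul hN1 hPle hPpos.le (by positivity)
        · exact mul_le_mul hN2 hQle hQpos.le (by positivity)
    _ = _ := by ring

/-- The change of the speeds when two wavefronts of the same sign merge into a single one. -/
lemma sum_abs_speed_sub_of_merge {X' σ' : ℕ → ℝ} (h : BlockSpeeds A X d σ)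
    (h' : BlockSpeeds A X' d σ')
    (hP : IsFront A X σ P) (hQ : IsFront A X σ Q) (hPQ : ∀ s ∈ P, ∀ t ∈ Q, s < t)
    (hmeet : ∀ s ∈ A, ∀ t ∈ A, X' s = X' t ↔
      (X s = X t ∧ σ s = σ t) ∨ (s ∈ P ∪ Q ∧ t ∈ P ∪ Q))
    {p q : ℕ} (hp : p ∈ P) (hq : q ∈ Q) (hσ : σ q ≤ σ p) :
    (∀ s ∈ A, ∀ t ∈ A, X' s = X' t → σ' s = σ' t) ∧
    ∑ s ∈ A, |σ' s - σ s| = 2 * ((σ p - σ q) * (P.card * Q.card) / (P.card + Q.card)) := by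
  classical
  have hdisj : Disjoint P Q := Finset.disjoint_left.2 fun t h1 h2 => lt_irrefl _ (hPQ t h1 t h2)
  have hPpos : (0 : ℝ) < P.card := by exact_mod_cast Finset.card_pos.2 ⟨p, hp⟩
  have hQpos : (0 : ℝ) < Q.card := by exact_mod_cast Finset.card_pos.2 ⟨q, hq⟩
  have hpA := hP.1 hp
  have hP0 := hP.sum_eq_zero h hp
  have hQ0 := hQ.sum_eq_zero h hq
  have hPQA : P ∪ Q ⊆ A := Finset.union_subset hP.1 hQ.1
  -- The Rankine-Hugoniot speed of the merged front; it lies between `σ q` and `σ p`.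
  set c : ℝ := (P.card * σ p + Q.card * σ q) / (P.card + Q.card) with hc
  have hcP : σ p - c = (σ p - σ q) * Q.card / (P.card + Q.card) := by rw [hc]; field_simp; ring
  have hcQ : c - σ q = (σ p - σ q) * P.card / (P.card + Q.card) := by rw [hc]; field_simp; ring
  have hcP0 : 0 ≤ σ p - c := by
    rw [hcP]; exact div_nonneg (mul_nonneg (by linarith) hQpos.le) (by linarith)
  have hcQ0 : 0 ≤ c - σ q := by
    rw [hcQ]; exact div_nonneg (mul_nonneg (by linarith) hPpos.le) (by linarith)
  have hPfront : ∀ s ∈ P ∪ Q, ∀ t ∈ A, X s = X t ∧ σ s = σ t → t ∈ P ∪ Q := by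
    intro s hs t ht he
    rcases Finset.mem_union.1 hs with h1 | h1
    · exact Finset.mem_union_left _ ((hP.2 s h1 t ht).2 ⟨he.1.symm, he.2.symm⟩)
    · exact Finset.mem_union_right _ ((hQ.2 s h1 t ht).2 ⟨he.1.symm, he.2.symm⟩)
  have hblockPQ : ∀ (r : ℕ → Prop) [DecidablePred r],
      {t ∈ A | X' t = X' p ∧ r t} = {t ∈ P ∪ Q | r t} := by
    intro r _
    ext t
    simp only [Finset.mem_filter]
    constructor
    · rintro ⟨htA, hx, hr⟩
      refine ⟨?_, hr⟩
      rcases (hmeet t htA p hpA).1 hx with h1 | h1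
      · exact hPfront p (Finset.mem_union_left _ hp) t htA ⟨h1.1.symm, h1.2.symm⟩
      · exact h1.1
    · rintro ⟨ht, hr⟩
      exact ⟨hPQA ht, (hmeet t (hPQA ht) p hpA).2 (Or.inr ⟨ht, Finset.mem_union_left _ hp⟩), hr⟩
  have hnew : ∀ s ∈ P ∪ Q, σ' s = c := by
    have htot : ∑ t ∈ P ∪ Q, (d t - c) = 0 := by
      rw [Finset.sum_union hdisj]
      have e1 := sum_sub_const_sub P d c (σ p)
      have e2 := sum_sub_const_sub Q d c (σ q)
      have e3 : (P.card : ℝ) * (σ p - c) + Q.card * (σ q - c) = 0 := by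
        rw [hcP, show σ q - c = -(c - σ q) by ring, hcQ]; ring
      linarith
    intro s hs
    have hsx : X' s = X' p := (hmeet s (hPQA hs) p hpA).2 (Or.inr ⟨hs, Finset.mem_union_left _ hp⟩)
    refine h'.eq_of_shock (x := X' p) (fun n => ?_) ?_ (hPQA hs) hsx
    · rw [hblockPQ, Finset.filter_union, Finset.sum_union (Finset.disjoint_filter_filter hdisj)]
      -- A prefix within `P` has mean at least `σ p ≥ c`. A prefix that reaches into `Q` is the
      -- complement of a suffix of `Q`, whose mean is at most `σ q ≤ c`, while the total sum of `d -
      -- c` is zero.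
      by_cases hQn : ∃ t ∈ Q, t < n
      · obtain ⟨t₀, ht₀, ht₀n⟩ := hQn
        rw [Finset.filter_true_of_mem fun t ht => (hPQ t ht t₀ ht₀).trans ht₀n]
        rw [Finset.sum_union hdisj, ← Finset.sum_filter_add_sum_filter_not Q (· < n)] at htot
        simp only [not_lt] at htot
        have e1 := hQ.sum_suffix_nonpos h hq n
        have e2 := sum_sub_const_sub {t ∈ Q | n ≤ t} d c (σ q)
        have e3 : (({t ∈ Q | n ≤ t}.card : ℕ) : ℝ) * (σ q - c) ≤ 0 :=
          mul_nonpos_of_nonneg_of_nonpos (Nat.cast_nonneg _) (by linarith)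
        linarith
      · rw [Finset.filter_false_of_mem (s := Q) fun t ht h2 => hQn ⟨t, ht, h2⟩, Finset.sum_empty,
          add_zero]
        have e1 := hP.sum_prefix_nonneg h hp n
        have e2 := sum_sub_const_sub {t ∈ P | t < n} d c (σ p)
        have e3 : 0 ≤ (({t ∈ P | t < n}.card : ℕ) : ℝ) * (σ p - c) :=
          mul_nonneg (Nat.cast_nonneg _) hcP0
        linarith
    · have := hblockPQ (fun _ => True)
      simp only [and_true, Finset.filter_true] at this
      rw [this, htot]
  -- A front that does not collide becomes a whole block by itself, and its prefix inequalities make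
  -- it again a single shock of the same speed.
  have hold : ∀ s ∈ A, s ∉ P ∪ Q → σ' s = σ s := by
    intro s hs hsPQ
    have hF : IsFront A X σ {t ∈ A | X' t = X' s} := by
      refine ⟨Finset.filter_subset _ _, ?_⟩
      have e : ∀ t ∈ A, X' t = X' s ↔ X t = X s ∧ σ t = σ s := fun t ht => by
        rw [hmeet t ht s hs]
        exact or_iff_left fun h => hsPQ h.2
      intro a ha t ht
      simp only [Finset.mem_filter] at ha ⊢
      obtain ⟨ea, eb⟩ := (e a ha.1).1 ha.2
      rw [e t ht, ea, eb]
      simp [ht]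
    have hsF : s ∈ {t ∈ A | X' t = X' s} := by simp [hs]
    refine h'.eq_of_shock (x := X' s) (fun n => ?_) (hF.sum_eq_zero h hsF) hs rfl
    have := hF.sum_prefix_nonneg h hsF n
    rwa [Finset.filter_filter] at this
  refine ⟨?_, ?_⟩
  · intro s hs t ht he
    rcases (hmeet s hs t ht).1 he with h1 | h1
    · by_cases hsPQ : s ∈ P ∪ Q
      · rw [hnew s hsPQ, hnew t (hPfront s hsPQ t ht h1)]
      · rw [hold s hs hsPQ, hold t ht fun htPQ =>
          hsPQ (hPfront t htPQ s hs ⟨h1.1.symm, h1.2.symm⟩), h1.2]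
    · rw [hnew s h1.1, hnew t h1.2]
  · rw [← Finset.sum_sdiff hPQA, Finset.sum_eq_zero fun s hs => by
      rw [hold s (Finset.mem_sdiff.1 hs).1 (Finset.mem_sdiff.1 hs).2]; simp, zero_add,
      Finset.sum_union hdisj]
    have e1 : ∑ s ∈ P, |σ' s - σ s| = P.card * (σ p - c) := by
      rw [← nsmul_eq_mul, ← Finset.sum_const]
      refine Finset.sum_congr rfl fun s hs => ?_
      rw [hnew s (Finset.mem_union_left _ hs), (hP.eq hp hs).2, abs_sub_comm, abs_of_nonneg hcP0]
    have e2 : ∑ s ∈ Q, |σ' s - σ s| = Q.card * (c - σ q) := by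
      rw [← nsmul_eq_mul, ← Finset.sum_const]
      refine Finset.sum_congr rfl fun s hs => ?_
      rw [hnew s (Finset.mem_union_right _ hs), (hQ.eq hq hs).2, abs_of_nonneg hcQ0]
    rw [e1, e2, hcP, hcQ]
    ring

end Collision

/-! ### Change of the speeds at a cancellation -/

section Cancellation

variable {A A' : Finset ℕ} {X X' d σ σ' : ℕ → ℝ} {P : Finset ℕ} {K : ℝ}

/-- The change of the speeds of the waves of a wavefront that loses some of its first waves, or
some of its last waves. -/
lemma sum_abs_speed_sub_of_restrict (h : BlockSpeeds A X d σ) (h' : BlockSpeeds A' X' d σ')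
    (hP : IsFront A X σ P) {B : Finset ℕ} {x : ℝ} (hB : {t ∈ A' | X' t = x} = B) (hBP : B ⊆ P)
    (hside : (∀ u ∈ B, ∀ v ∈ P \ B, u < v) ∨ (∀ u ∈ B, ∀ v ∈ P \ B, v < u))
    (hd : ∀ s ∈ P, ∀ t ∈ P, d s - d t ≤ K * (P.card : ℝ)) {p : ℕ} (hp : p ∈ P) :
    ∑ s ∈ B, |σ' s - σ p| ≤ ((P \ B).card : ℝ) * (K * (P.card : ℝ)) := by
  have hP0 := hP.sum_eq_zero h hp
  have hB0 : ∑ t ∈ B, (d t - σ' t) = 0 := hB ▸ h'.sum_eq_zero x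
  have hmem : ∀ t ∈ B, t ∈ A' ∧ X' t = x := fun t ht => by
    rw [← hB] at ht; exact Finset.mem_filter.1 ht
  have hfil : ∀ (r : ℕ → Prop) [DecidablePred r],
      {t ∈ A' | X' t = x ∧ r t} = {t ∈ B | r t} := by
    intro r _; rw [← hB, Finset.filter_filter]
  have hsplit := Finset.sum_sdiff (f := fun t => d t - σ p) hBP
  rw [hP0] at hsplit
  rcases hside with hside | hside
  -- The last waves are lost. The prefixes of `B` are prefixes of `P`, so their means are at least
  -- `σ p` and the remaining waves can only accelerate.
  · have hlow : ∀ s ∈ B, σ p ≤ σ' s := by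
      intro s hs
      refine h'.le_of_prefix (x := x) (fun n => ?_) (hmem s hs).1 (hmem s hs).2
      rw [hfil]
      rcases (P \ B).eq_empty_or_nonempty with he | hne
      · rw [show B = P from hBP.antisymm (Finset.sdiff_eq_empty_iff_subset.1 he)]
        exact hP.sum_prefix_nonneg h hp n
      · obtain ⟨v, hv, hvmin⟩ := (P \ B).exists_min_image id hne
        have : {t ∈ B | t < n} = {t ∈ P | t < min n v} := by
          ext t
          simp only [Finset.mem_filter, lt_min_iff]
          constructor
          · rintro ⟨h1, h2⟩; exact ⟨hBP h1, h2, hside t h1 v hv⟩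
          · rintro ⟨h1, h2, h3⟩
            refine ⟨?_, h2⟩
            by_contra h4
            have := hvmin t (Finset.mem_sdiff.2 ⟨h1, h4⟩)
            simp only [id] at this
            omega
        rw [this]
        exact hP.sum_prefix_nonneg h hp _
    obtain ⟨i, hi, hi'⟩ : ∃ i ∈ P, σ p ≤ d i := by
      by_contra hcon
      push Not at hcon
      have := Finset.sum_neg (fun t ht => sub_neg.2 (hcon t ht)) ⟨p, hp⟩
      linarith
    -- All changes have one sign, so the absolute values can be summed. The second sum vanishes, and
    -- the first is minus the sum over the lost waves, each contributing at most `K |P|`.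
    have e1 : ∑ s ∈ B, |σ' s - σ p| = ∑ s ∈ B, (d s - σ p) - ∑ s ∈ B, (d s - σ' s) := by
      rw [← Finset.sum_sub_distrib]
      refine Finset.sum_congr rfl fun s hs => ?_
      rw [abs_of_nonneg (sub_nonneg.2 (hlow s hs))]; ring
    have e2 : ∑ t ∈ P \ B, -(d t - σ p) ≤ (P \ B).card • (K * (P.card : ℝ)) :=
      Finset.sum_le_card_nsmul _ _ _ fun t ht => by
        have := hd i hi t (Finset.mem_sdiff.1 ht).1
        linarith
    rw [Finset.sum_neg_distrib, nsmul_eq_mul] at e2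
    linarith
  · have hupp : ∀ s ∈ B, σ' s ≤ σ p := by
      intro s hs
      refine h'.le_of_suffix (x := x) (fun n => ?_) (hmem s hs).1 (hmem s hs).2
      rw [hfil]
      rcases (P \ B).eq_empty_or_nonempty with he | hne
      · rw [show B = P from hBP.antisymm (Finset.sdiff_eq_empty_iff_subset.1 he)]
        exact hP.sum_suffix_nonpos h hp n
      · obtain ⟨v, hv, hvmax⟩ := (P \ B).exists_max_image id hne
        have : {t ∈ B | n ≤ t} = {t ∈ P | max n (v + 1) ≤ t} := by
          ext t
          simp only [Finset.mem_filter, max_le_iff]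
          constructor
          · rintro ⟨h1, h2⟩; exact ⟨hBP h1, h2, hside t h1 v hv⟩
          · rintro ⟨h1, h2, h3⟩
            refine ⟨?_, h2⟩
            by_contra h4
            have := hvmax t (Finset.mem_sdiff.2 ⟨h1, h4⟩)
            simp only [id] at this
            omega
        rw [this]
        exact hP.sum_suffix_nonpos h hp _
    obtain ⟨i, hi, hi'⟩ : ∃ i ∈ P, d i ≤ σ p := by
      by_contra hcon
      push Not at hcon
      have := Finset.sum_pos (fun t ht => sub_pos.2 (hcon t ht)) ⟨p, hp⟩
      linarith
    have e1 : ∑ s ∈ B, |σ' s - σ p| = ∑ s ∈ B, (d s - σ' s) - ∑ s ∈ B, (d s - σ p) := by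
      rw [← Finset.sum_sub_distrib]
      refine Finset.sum_congr rfl fun s hs => ?_
      rw [abs_of_nonpos (sub_nonpos.2 (hupp s hs))]; ring
    have e2 : ∑ t ∈ P \ B, (d t - σ p) ≤ (P \ B).card • (K * (P.card : ℝ)) :=
      Finset.sum_le_card_nsmul _ _ _ fun t ht => by
        have := hd t (Finset.mem_sdiff.1 ht).1 i hi
        linarith
    rw [nsmul_eq_mul] at e2
    linarith

/-- The change of the speeds of all waves at a cancellation in which, among the wavefronts that
survive, only `P` loses some waves. -/
lemma sum_abs_speed_sub_of_cancellation (h : BlockSpeeds A X d σ) (h' : BlockSpeeds A' X' d σ')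
    (hsub : A' ⊆ A) (hfront : ∀ s ∈ A', ∀ t ∈ A', X' s = X' t ↔ X s = X t ∧ σ s = σ t)
    (hP : IsFront A X σ P)
    (hother : ∀ t ∈ A \ A', t ∉ P → ∀ s ∈ A', ¬ (X t = X s ∧ σ t = σ s))
    (hside : (∀ u ∈ P, u ∈ A' → ∀ v ∈ P, v ∉ A' → u < v) ∨
      (∀ u ∈ P, u ∈ A' → ∀ v ∈ P, v ∉ A' → v < u))
    (hK : 0 ≤ K) (hd : ∀ s ∈ P, ∀ t ∈ P, d s - d t ≤ K * (P.card : ℝ)) :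
    ∑ s ∈ A', |σ' s - σ s| ≤ K * A.card * ((A \ A').card : ℝ) := by
  classical
  set B := {t ∈ A' | t ∈ P} with hB
  have hBP : B ⊆ P := fun t ht => (Finset.mem_filter.1 ht).2
  have hBA : B ⊆ A' := Finset.filter_subset _ _
  have hPB : ∀ v, v ∈ P \ B ↔ v ∈ P ∧ v ∉ A' := by
    intro v
    simp only [hB, Finset.mem_sdiff, Finset.mem_filter]
    tauto
  have hold : ∀ s ∈ A', s ∉ P → σ' s = σ s := by
    intro s hs hsP
    have hF : IsFront A X σ {t ∈ A | X t = X s ∧ σ t = σ s} := by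
      refine ⟨Finset.filter_subset _ _, fun a ha t ht => ?_⟩
      simp only [Finset.mem_filter] at ha ⊢
      rw [ha.2.1, ha.2.2]
      simp [ht]
    have hsF : s ∈ {t ∈ A | X t = X s ∧ σ t = σ s} := by simp [hsub hs]
    have hFA : ∀ t ∈ A, X t = X s ∧ σ t = σ s → t ∈ A' := by
      intro t ht he
      by_contra htA'
      refine hother t (Finset.mem_sdiff.2 ⟨ht, htA'⟩) (fun htP => hsP ?_) s hs he
      exact (hP.2 t htP s (hsub hs)).2 ⟨he.1.symm, he.2.symm⟩
    have hblock : {t ∈ A' | X' t = X' s} = {t ∈ A | X t = X s ∧ σ t = σ s} := by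
      ext t
      simp only [Finset.mem_filter]
      constructor
      · rintro ⟨h1, h2⟩; exact ⟨hsub h1, (hfront t h1 s hs).1 h2⟩
      · rintro ⟨h1, h2⟩; exact ⟨hFA t h1 h2, (hfront t (hFA t h1 h2) s hs).2 h2⟩
    refine h'.eq_of_shock (x := X' s) (fun n => ?_) ?_ hs rfl
    · have := hF.sum_prefix_nonneg h hsF n
      rwa [← hblock, Finset.filter_filter] at this
    · rw [hblock]; exact hF.sum_eq_zero h hsF
  have hsum : ∑ s ∈ A', |σ' s - σ s| = ∑ s ∈ B, |σ' s - σ s| := by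
    rw [← Finset.sum_sdiff hBA, add_eq_right]
    refine Finset.sum_eq_zero fun s hs => ?_
    have hs' := Finset.mem_sdiff.1 hs
    rw [hold s hs'.1 fun hsP => hs'.2 (Finset.mem_filter.2 ⟨hs'.1, hsP⟩)]
    simp
  rw [hsum]
  rcases B.eq_empty_or_nonempty with he | ⟨p, hpB⟩
  · rw [he, Finset.sum_empty]; positivity
  have hp := hBP hpB
  have hpA' := hBA hpB
  have hBblock : {t ∈ A' | X' t = X' p} = B := by
    ext t
    simp only [Finset.mem_filter, hB]
    refine and_congr_right fun ht => ?_
    rw [hfront t ht p hpA', hP.2 p hp t (hsub ht)]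
  have key := sum_abs_speed_sub_of_restrict (K := K) h h' hP hBblock hBP (hside.imp
    (fun hs u hu v hv => hs u (hBP hu) (hBA hu) v ((hPB v).1 hv).1 ((hPB v).1 hv).2)
    (fun hs u hu v hv => hs u (hBP hu) (hBA hu) v ((hPB v).1 hv).1 ((hPB v).1 hv).2)) hd hp
  rw [Finset.sum_congr rfl fun s hs => by rw [(hP.eq hp (hBP hs)).2]]
  refine key.trans ?_
  have e1 : ((P \ B).card : ℝ) ≤ (A \ A').card := by
    refine Nat.cast_le.2 (Finset.card_le_card fun v hv => ?_)
    have := (hPB v).1 hv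
    exact Finset.mem_sdiff.2 ⟨hP.1 this.1, this.2⟩
  have e2 : (P.card : ℝ) ≤ A.card := Nat.cast_le.2 (Finset.card_le_card hP.1)
  calc ((P \ B).card : ℝ) * (K * (P.card : ℝ)) ≤ (A \ A').card * (K * A.card) := by gcongr
    _ = _ := by ring

end Cancellation

/-! ### Configurations of waves -/

/-- The waves in `A`, with positions `X`, signs `S` and right states `r` (in units of `ε`), are
enumerated from left to right, waves with the same position have the same sign, and the right states
are obtained by crossing the waves from left to right. -/
structure IsConfig (A : Finset ℕ) (X : ℕ → ℝ) (S r : ℕ → ℤ) : Prop where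
  mono : ∀ s ∈ A, ∀ t ∈ A, s ≤ t → X s ≤ X t
  sign : ∀ s ∈ A, S s = 1 ∨ S s = -1
  same : ∀ s ∈ A, ∀ t ∈ A, X s = X t → S s = S t
  right : ∀ s ∈ A, r s = ∑ t ∈ A with t ≤ s, S t

/-- The profile obtained by crossing the waves in `A`. -/
noncomputable def stepFun (ε : ℝ) (A : Finset ℕ) (X : ℕ → ℝ) (S : ℕ → ℤ) (x : ℝ) : ℝ :=
  ((∑ s ∈ A with X s ≤ x, S s : ℤ) : ℝ) * ε

/-- The speed given to the wave `s` by the Riemann problem at its position. -/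
noncomputable def configSpeed (f : ℝ → ℝ) (ε : ℝ) (A : Finset ℕ) (X : ℕ → ℝ) (S r : ℕ → ℤ)
    (s : ℕ) : ℝ :=
  riemannSpeed f ε (leftLim (stepFun ε A X S) (X s)) (stepFun ε A X S (X s)) (r s * ε)

/-- The slope of the interpolated flux on the cell of the wave `s`. -/
noncomputable def cellSlope (f : ℝ → ℝ) (ε : ℝ) (S r : ℕ → ℤ) (s : ℕ) : ℝ :=
  S s * (f (r s * ε) - f ((r s - S s) * ε)) / ε

lemma leftLim_eq_of_eventually {f : ℝ → ℝ} {x c : ℝ} (h : ∀ᶠ y in nhdsWithin x (Iio x), f y = c) :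
    leftLim f x = c :=
  leftLim_eq_of_tendsto (tendsto_const_nhds.congr' (h.mono fun _ hy => hy.symm))

lemma leftLim_stepFun (ε : ℝ) (A : Finset ℕ) (X : ℕ → ℝ) (S : ℕ → ℤ) (x : ℝ) :
    leftLim (stepFun ε A X S) x = ((∑ s ∈ A with X s < x, S s : ℤ) : ℝ) * ε := by
  refine leftLim_eq_of_eventually ?_
  have : ∀ᶠ y in nhdsWithin x (Iio x), ∀ s ∈ A, (X s ≤ y ↔ X s < x) := by
    rw [Filter.eventually_all_finset]
    intro s _
    by_cases h : X s < x
    · filter_upwards [Ioo_mem_nhdsLT h] with y hy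
      simp [h, hy.1.le]
    · filter_upwards [self_mem_nhdsWithin] with y hy
      have hy : y < x := hy
      simp only [h, iff_false, not_le]
      linarith
  filter_upwards [this] with y hy
  rw [stepFun, Finset.filter_congr hy]

/-- The rank enumerates `B` increasingly by `0, …, |B| - 1`. It translates between labels of waves,
which have gaps after removals, and consecutive elementary cells of a jump. -/
lemma sum_rank {M : Type*} [AddCommMonoid M] (φ : ℕ → M) (B : Finset ℕ) :
    ∑ t ∈ B, φ ({u ∈ B | u < t}.card) = ∑ i ∈ Finset.range B.card, φ i := by
  induction B using Finset.induction_on_max with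
  | empty => simp
  | insert a B hlt ih =>
    have ha : a ∉ B := fun h => lt_irrefl _ (hlt a h)
    rw [Finset.sum_insert ha, Finset.card_insert_of_notMem ha, Finset.sum_range_succ, add_comm,
      ← ih]
    congr 1
    · refine Finset.sum_congr rfl fun t ht => ?_
      rw [Finset.filter_insert, if_neg (not_lt.2 (hlt t ht).le)]
    · rw [Finset.filter_insert, if_neg (lt_irrefl a), Finset.filter_true_of_mem hlt]

lemma exists_rank {B : Finset ℕ} {i : ℕ} (hi : i < B.card) :
    ∃ t ∈ B, {u ∈ B | u < t}.card = i := by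
  by_contra hcon
  push Not at hcon
  have := sum_rank (fun j => if j = i then 1 else 0) B
  rw [Finset.sum_eq_zero fun t ht => if_neg (hcon t ht)] at this
  simp [hi] at this

lemma rank_lt {B : Finset ℕ} {t : ℕ} (ht : t ∈ B) : {u ∈ B | u < t}.card < B.card :=
  Finset.card_lt_card (Finset.filter_ssubset.2 ⟨t, ht, lt_irrefl t⟩)

lemma rank_mono (B : Finset ℕ) {s t : ℕ} (hst : s ≤ t) :
    {u ∈ B | u < s}.card ≤ {u ∈ B | u < t}.card :=
  Finset.card_le_card fun u hu => by
    simp only [Finset.mem_filter] at hu ⊢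
    exact ⟨hu.1, hu.2.trans_le hst⟩

lemma rank_strictMono {B : Finset ℕ} {s t : ℕ} (hs : s ∈ B) (hst : s < t) :
    {u ∈ B | u < s}.card < {u ∈ B | u < t}.card :=
  Finset.card_lt_card <| by
    rw [Finset.ssubset_iff_of_subset fun u hu => by
      simp only [Finset.mem_filter] at hu ⊢
      exact ⟨hu.1, hu.2.trans hst⟩]
    exact ⟨s, by simp [hs, hst], by simp⟩

section Config

variable {f : ℝ → ℝ} {ε : ℝ} {A : Finset ℕ} {X : ℕ → ℝ} {S r : ℕ → ℤ}

lemma IsConfig.sum_le (h : IsConfig A X S r) {s : ℕ} (hs : s ∈ A) :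
    ∑ t ∈ A with X t ≤ X s, S t =
      ∑ t ∈ A with X t < X s, S t + S s * ({t ∈ A | X t = X s}.card : ℤ) := by
  have : ∑ t ∈ A with X t = X s, S t = S s * ({t ∈ A | X t = X s}.card : ℤ) := by
    rw [Finset.sum_congr rfl fun t ht => h.same t (Finset.mem_filter.1 ht).1 s hs
      (Finset.mem_filter.1 ht).2, Finset.sum_const, nsmul_eq_mul, mul_comm]
  rw [← this]
  simp only [Finset.sum_filter, ← Finset.sum_add_distrib]
  refine Finset.sum_congr rfl fun t _ => ?_
  rcases lt_trichotomy (X t) (X s) with h1 | h1 | h1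
  · simp [h1, h1.le, h1.ne]
  · simp [h1]
  · simp [h1.not_ge, h1.not_gt, h1.ne']

/-- All waves at smaller positions come first in the enumeration, and those at the same position
share a sign. Ranks start from `0`, while the right state is reached after crossing the wave itself,
hence the `+ 1`. -/
lemma IsConfig.right_eq (h : IsConfig A X S r) {s t : ℕ} (hs : s ∈ A) (ht : t ∈ A)
    (hst : X t = X s) : r t = ∑ u ∈ A with X u < X s, S u +
      S s * (({u ∈ {u ∈ A | X u = X s} | u < t}.card + 1 : ℕ) : ℤ) := by
  have e : ({u ∈ {u ∈ A | X u = X s} | u < t}.card + 1 : ℕ) =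
      {u ∈ A | X u = X s ∧ u ≤ t}.card := by
    have : {u ∈ A | X u = X s ∧ u ≤ t} = insert t {u ∈ {u ∈ A | X u = X s} | u < t} := by
      ext u
      simp only [Finset.mem_filter, Finset.mem_insert]
      constructor
      · rintro ⟨h1, h2, h3⟩
        rcases h3.eq_or_lt with h4 | h4
        · exact Or.inl h4
        · exact Or.inr ⟨⟨h1, h2⟩, h4⟩
      · rintro (h1 | ⟨⟨h1, h2⟩, h3⟩)
        · subst h1; exact ⟨ht, hst, le_rfl⟩
        · exact ⟨h1, h2, h3.le⟩
    rw [this, Finset.card_insert_of_notMem (by simp)]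
  have e2 : ∑ u ∈ A with X u = X s ∧ u ≤ t, S u = S s * ({u ∈ A | X u = X s ∧ u ≤ t}.card : ℤ) := by
    rw [Finset.sum_congr rfl fun u hu => h.same u (Finset.mem_filter.1 hu).1 s hs
      (Finset.mem_filter.1 hu).2.1, Finset.sum_const, nsmul_eq_mul, mul_comm]
  rw [h.right t ht, e, ← e2]
  simp only [Finset.sum_filter, ← Finset.sum_add_distrib]
  refine Finset.sum_congr rfl fun u hu => ?_
  rcases lt_trichotomy (X u) (X s) with h1 | h1 | h1
  · have h2 : u ≤ t := by
      by_contra h2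
      have := h.mono t ht u hu (by omega)
      rw [hst] at this
      linarith
    simp [h1, h1.ne, h2]
  · simp [h1]
  · have h2 : ¬ u ≤ t := fun h2 => by
      have := h.mono u hu t ht h2
      rw [hst] at this
      linarith
    simp [h1.not_gt, h1.ne', h2]

lemma IsConfig.stepFun_position (h : IsConfig A X S r) {s : ℕ} (hs : s ∈ A) :
    stepFun ε A X S (X s) =
      ((∑ t ∈ A with X t < X s, S t + S s * ({t ∈ A | X t = X s}.card : ℤ) : ℤ) : ℝ) * ε := by
  rw [stepFun, h.sum_le hs]

/-- Along each set of waves with the same position, the speeds and the slopes of the flux are the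
increments of two functions, the first of which is the convex envelope of the second. -/
lemma IsConfig.block_structure (h : IsConfig A X S r) (hε : 0 < ε) {s : ℕ} (hs : s ∈ A) :
    ∃ E F : ℕ → ℝ,
      (∀ t ∈ A, X t = X s → configSpeed f ε A X S r t =
        (E ({u ∈ {u ∈ A | X u = X s} | u < t}.card + 1) -
          E ({u ∈ {u ∈ A | X u = X s} | u < t}.card)) / ε) ∧
      (∀ t ∈ A, X t = X s → cellSlope f ε S r t =
        (F ({u ∈ {u ∈ A | X u = X s} | u < t}.card + 1) -
          F ({u ∈ {u ∈ A | X u = X s} | u < t}.card)) / ε) ∧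
      (∀ i, i + 1 < {u ∈ A | X u = X s}.card → E (i + 1) - E i ≤ E (i + 2) - E (i + 1)) ∧
      (∀ i ≤ {u ∈ A | X u = X s}.card, E i ≤ F i) ∧ E 0 = F 0 ∧
      E {u ∈ A | X u = X s}.card = F {u ∈ A | X u = X s}.card ∧
      (∀ i, i + 1 < {u ∈ A | X u = X s}.card → E (i + 1) - E i < E (i + 2) - E (i + 1) →
        E (i + 1) = F (i + 1)) := by
  set B := {u ∈ A | X u = X s} with hB
  set a := ∑ t ∈ A with X t < X s, S t with ha
  have hm : 0 < B.card := Finset.card_pos.2 ⟨s, by simp [hB, hs]⟩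
  obtain ⟨E, hE1, hE2, hE3, hE4, hE5, hE6⟩ := riemannSpeed_structure f hε a (S s) (h.sign s hs) hm
  refine ⟨E, fun i => S s * f ((a + S s * i : ℤ) * ε), ?_, ?_, hE2, hE3, ?_, hE5, hE6⟩
  · intro t ht hts
    have hr := h.right_eq hs ht hts
    have htB : t ∈ B := by simp [hB, ht, hts]
    rw [configSpeed, hts, leftLim_stepFun, h.stepFun_position hs, hr]
    exact hE1 _ (rank_lt htB)
  · intro t ht hts
    rw [cellSlope, h.same t ht s hs hts, h.right_eq hs ht hts]
    rw [mul_sub]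
    congr 4
    simp only [ha, hB]
    push_cast
    ring
  · simpa using hE4

/-- The bridge from the Riemann solver to finite sums: the partial sums of `d - σ` telescope to the
gap between the flux and its envelope, divided by `ε`. -/
lemma IsConfig.blockSpeeds (h : IsConfig A X S r) (hε : 0 < ε) :
    BlockSpeeds A X (cellSlope f ε S r) (configSpeed f ε A X S r) := by
  have sums : ∀ s ∈ A, ∀ E F : ℕ → ℝ,
      (∀ t ∈ A, X t = X s → configSpeed f ε A X S r t =
        (E ({u ∈ {u ∈ A | X u = X s} | u < t}.card + 1) -
          E ({u ∈ {u ∈ A | X u = X s} | u < t}.card)) / ε) →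
      (∀ t ∈ A, X t = X s → cellSlope f ε S r t =
        (F ({u ∈ {u ∈ A | X u = X s} | u < t}.card + 1) -
          F ({u ∈ {u ∈ A | X u = X s} | u < t}.card)) / ε) → E 0 = F 0 → ∀ n,
      ∑ t ∈ A with X t = X s ∧ t < n, (cellSlope f ε S r t - configSpeed f ε A X S r t) =
        (F {u ∈ {u ∈ A | X u = X s} | u < n}.card - E {u ∈ {u ∈ A | X u = X s} | u < n}.card)
          / ε := by
    intro s hs E F hE hF h0 n
    set B := {u ∈ A | X u = X s} with hB
    have e1 : ∑ t ∈ A with X t = X s ∧ t < n, (cellSlope f ε S r t - configSpeed f ε A X S r t) =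
        ∑ t ∈ {u ∈ B | u < n}, (fun i => ((F (i + 1) - E (i + 1)) - (F i - E i)) / ε)
          {u ∈ {u ∈ B | u < n} | u < t}.card := by
      rw [← Finset.filter_filter]
      refine Finset.sum_congr rfl fun t ht => ?_
      have ht' := Finset.mem_filter.1 ht
      have ht'' := Finset.mem_filter.1 ht'.1
      have : {u ∈ {u ∈ B | u < n} | u < t} = {u ∈ B | u < t} := by
        ext u
        simp only [Finset.mem_filter]
        constructor
        · rintro ⟨⟨h1, _⟩, h2⟩; exact ⟨h1, h2⟩
        · rintro ⟨h1, h2⟩; exact ⟨⟨h1, h2.trans ht'.2⟩, h2⟩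
      rw [this, hE t ht''.1 ht''.2, hF t ht''.1 ht''.2]
      ring
    rw [e1, sum_rank (fun i => ((F (i + 1) - E (i + 1)) - (F i - E i)) / ε), ← Finset.sum_div,
      Finset.sum_range_sub (fun i => F i - E i), h0, sub_self, sub_zero]
  have hempty : ∀ x, (¬ ∃ s ∈ A, X s = x) → ∀ n,
      ∑ t ∈ A with X t = x ∧ t < n, (cellSlope f ε S r t - configSpeed f ε A X S r t) = 0 := by
    intro x hx n
    rw [Finset.filter_false_of_mem fun t ht h => hx ⟨t, ht, h.1⟩, Finset.sum_empty]
  refine ⟨?_, ?_, ?_⟩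
  · intro s hs t ht hst hle
    obtain ⟨E, F, hE, hF, hmono, -, -, -, -⟩ := h.block_structure (f := f) hε hs
    rw [hE s hs rfl, hE t ht hst.symm]
    refine div_le_div_of_nonneg_right ?_ hε.le
    set B := {u ∈ A | X u = X s} with hB
    have htB : t ∈ B := by simp [hB, ht, hst]
    have hrt := rank_lt htB
    generalize hj : {u ∈ B | u < t}.card = j at hrt ⊢
    have hij := rank_mono B hle
    rw [hj] at hij
    clear hj
    induction j, hij using Nat.le_induction with
    | base => rfl
    | succ j hj ih => exact (ih (by omega)).trans (hmono j hrt)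
  · intro x n
    by_cases hx : ∃ s ∈ A, X s = x
    · obtain ⟨s, hs, rfl⟩ := hx
      obtain ⟨E, F, hE, hF, hmono, hle, h0, -, -⟩ := h.block_structure (f := f) hε hs
      rw [sums s hs E F hE hF h0]
      exact div_nonneg (sub_nonneg.2 (hle _ (Finset.card_le_card (Finset.filter_subset _ _)))) hε.le
    · rw [hempty x hx]
  · intro x n hn
    by_cases hx : ∃ s ∈ A, X s = x
    · obtain ⟨s, hs, rfl⟩ := hx
      obtain ⟨E, F, hE, hF, hmono, hle, h0, hm, hkink⟩ := h.block_structure (f := f) hε hs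
      rw [sums s hs E F hE hF h0, div_eq_zero_iff, sub_eq_zero]
      left
      set B := {u ∈ A | X u = X s} with hB
      -- At both ends of the block the contact is automatic. Inside, the waves `t₁` and `t₂`
      -- adjacent to the cut have consecutive ranks, and the jump of speed between them is a strict
      -- kink of the envelope.
      rcases {u ∈ B | u < n}.eq_empty_or_nonempty with he | hne
      · rw [he, Finset.card_empty, h0]
      rcases {u ∈ B | n ≤ u}.eq_empty_or_nonempty with he' | hne'
      · rw [Finset.filter_true_of_mem fun u hu => ?_, hm]
        by_contra hun
        exact Finset.notMem_empty u (he' ▸ Finset.mem_filter.2 ⟨hu, by omega⟩)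
      obtain ⟨t₁, h1, hmax⟩ := {u ∈ B | u < n}.exists_max_image id hne
      obtain ⟨t₂, h2, hmin⟩ := {u ∈ B | n ≤ u}.exists_min_image id hne'
      simp only [Finset.mem_filter, id] at h1 h2 hmax hmin
      have r1 : {u ∈ B | u < n}.card = {u ∈ B | u < t₁}.card + 1 := by
        rw [← Finset.card_insert_of_notMem (s := {u ∈ B | u < t₁}) (a := t₁) (by simp)]
        congr 1
        ext u
        simp only [Finset.mem_filter, Finset.mem_insert]
        constructor
        · rintro ⟨ha, hb⟩
          have := hmax u ⟨ha, hb⟩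
          by_cases hu : u = t₁
          · exact Or.inl hu
          · exact Or.inr ⟨ha, by omega⟩
        · rintro (ha | ⟨ha, hb⟩)
          · subst ha; exact h1
          · exact ⟨ha, by omega⟩
      have r2 : {u ∈ B | u < t₂} = {u ∈ B | u < n} := by
        refine Finset.filter_congr fun u hu => ⟨fun hb => ?_, fun hb => by omega⟩
        by_contra hun
        have := hmin u ⟨hu, by omega⟩
        omega
      have h1' := Finset.mem_filter.1 h1.1
      have h2' := Finset.mem_filter.1 h2.1
      have hlt := hn t₁ h1'.1 t₂ h2'.1 h1'.2 h2'.2 h1.2 h2.2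
      rw [hE t₁ h1'.1 h1'.2, hE t₂ h2'.1 h2'.2, r2, r1, div_lt_div_iff_of_pos_right hε] at hlt
      have hcard := rank_lt h2.1
      rw [r2, r1] at hcard
      rw [r1]
      exact (hkink _ hcard hlt).symm
    · rw [hempty x hx]

/-! ### The evolution of a configuration -/

lemma IsConfig.jump (h : IsConfig A X S r) (hε : 0 < ε) {s : ℕ} (hs : s ∈ A) :
    stepFun ε A X S (X s) - leftLim (stepFun ε A X S) (X s) =
      S s * (({t ∈ A | X t = X s}.card : ℝ) * ε) ∧
    0 < ({t ∈ A | X t = X s}.card : ℝ) * ε := by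
  refine ⟨?_, ?_⟩
  · rw [leftLim_stepFun, h.stepFun_position hs]
    push_cast
    ring
  · have : 0 < {t ∈ A | X t = X s}.card := Finset.card_pos.2 ⟨s, by simp [hs]⟩
    positivity

lemma leftLim_stepFun_eq (ε : ℝ) (A : Finset ℕ) (X : ℕ → ℝ) (S : ℕ → ℤ) {x : ℝ}
    (hx : ¬ ∃ s ∈ A, X s = x) : leftLim (stepFun ε A X S) x = stepFun ε A X S x := by
  have : {s ∈ A | X s < x} = {s ∈ A | X s ≤ x} := Finset.filter_congr fun s hs =>
    ⟨fun h => h.le, fun h => lt_of_le_of_ne h fun he => hx ⟨s, hs, he⟩⟩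
  rw [leftLim_stepFun, stepFun, this]

lemma IsConfig.riemannStates_eq (h : IsConfig A X S r) (hε : 0 < ε) {s : ℕ} (hs : s ∈ A) :
    riemannStates ε (leftLim (stepFun ε A X S) (X s)) (stepFun ε A X S (X s)) =
      (fun t => (r t : ℝ) * ε) '' {t | t ∈ A ∧ X t = X s} := by
  rw [leftLim_stepFun, h.stepFun_position hs]
  set a := ∑ t ∈ A with X t < X s, S t with ha
  set B := {t ∈ A | X t = X s} with hB
  ext w
  simp only [riemannStates, mem_ofPred_eq, mem_image]
  constructor
  · rintro ⟨⟨k, rfl⟩, hk⟩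
    simp only [mul_lt_mul_iff_left₀ hε, mul_le_mul_iff_left₀ hε, Int.cast_lt, Int.cast_le] at hk
    obtain ⟨i, hi, hki⟩ : ∃ i < B.card, k = a + S s * ((i + 1 : ℕ) : ℤ) := by
      rcases h.sign s hs with h1 | h1
      · rw [h1] at hk ⊢
        refine ⟨(k - a - 1).toNat, by omega, by omega⟩
      · rw [h1] at hk ⊢
        refine ⟨(a - k - 1).toNat, by omega, by omega⟩
    obtain ⟨t, ht, hti⟩ := exists_rank hi
    have ht' := Finset.mem_filter.1 ht
    refine ⟨t, ht', ?_⟩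
    rw [h.right_eq hs ht'.1 ht'.2, hki, hti]
  · rintro ⟨t, ht, rfl⟩
    refine ⟨⟨r t, rfl⟩, ?_⟩
    simp only [mul_lt_mul_iff_left₀ hε, mul_le_mul_iff_left₀ hε, Int.cast_lt, Int.cast_le]
    have htB : t ∈ B := by simp [hB, ht]
    have hlt := rank_lt htB
    have := h.right_eq hs ht.1 ht.2
    rw [← hB, ← ha] at this
    rw [this]
    rcases h.sign s hs with h1 | h1
    · rw [h1]; left; omega
    · rw [h1]; right; omega

lemma IsConfig.right_injOn (h : IsConfig A X S r) {s : ℕ} (hs : s ∈ A) :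
    InjOn r {t | t ∈ A ∧ X t = X s} := by
  intro t ht u hu he
  rw [h.right_eq hs ht.1 ht.2, h.right_eq hs hu.1 hu.2] at he
  have hS0 : S s ≠ 0 := by rcases h.sign s hs with h1 | h1 <;> rw [h1] <;> decide
  have he' := mul_left_cancel₀ hS0 (add_left_cancel he)
  rw [Nat.cast_inj, add_left_inj] at he'
  rcases lt_trichotomy t u with h1 | h1 | h1
  · have := rank_strictMono (B := {u ∈ A | X u = X s}) (by simpa using ht) h1
    omega
  · exact h1
  · have := rank_strictMono (B := {u ∈ A | X u = X s}) (by simpa using hu) h1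
    omega

lemma IsConfig.riemannSolution_eq (h : IsConfig A X S r) (hε : 0 < ε) {s : ℕ} (hs : s ∈ A)
    (τ x : ℝ) :
    riemannSolution f ε (leftLim (stepFun ε A X S) (X s)) (stepFun ε A X S (X s)) τ (x - X s) -
      leftLim (stepFun ε A X S) (X s) =
    ((∑ t ∈ A with X t = X s ∧ X t + τ * configSpeed f ε A X S r t ≤ x, S t : ℤ) : ℝ) * ε := by
  obtain ⟨hj, hpos⟩ := h.jump hε hs
  have hsign : Real.sign (stepFun ε A X S (X s) - leftLim (stepFun ε A X S) (X s)) = S s := by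
    rw [hj]
    rcases h.sign s hs with h1 | h1
    · rw [h1, Real.sign_of_pos] <;> push_cast <;> linarith
    · rw [h1, Real.sign_of_neg] <;> push_cast <;> linarith
  have hset : {w ∈ riemannStates ε (leftLim (stepFun ε A X S) (X s)) (stepFun ε A X S (X s)) |
      τ * riemannSpeed f ε (leftLim (stepFun ε A X S) (X s)) (stepFun ε A X S (X s)) w ≤ x - X s} =
      (fun t => (r t : ℝ) * ε) ''
        ({t ∈ A | X t = X s ∧ X t + τ * configSpeed f ε A X S r t ≤ x} : Finset ℕ) := by
    rw [h.riemannStates_eq hε hs]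
    ext w
    simp only [mem_ofPred_eq, mem_image, Finset.coe_filter]
    constructor
    · rintro ⟨⟨t, ht, rfl⟩, hw⟩
      refine ⟨t, ⟨ht.1, ht.2, ?_⟩, rfl⟩
      rw [configSpeed, ht.2]
      linarith
    · rintro ⟨t, ⟨h1, h2, h3⟩, rfl⟩
      refine ⟨⟨t, ⟨h1, h2⟩, rfl⟩, ?_⟩
      rw [configSpeed, h2] at h3
      linarith
  rw [riemannSolution, hsign, hset, InjOn.ncard_image, ncard_coe_finset]
  · rw [Finset.sum_congr rfl fun t ht => h.same t (Finset.mem_filter.1 ht).1 s hs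
      (Finset.mem_filter.1 ht).2.1, Finset.sum_const, nsmul_eq_mul]
    push_cast
    ring
  · intro t ht u hu he
    simp only [Finset.coe_filter, mem_ofPred_eq] at ht hu
    refine h.right_injOn hs ⟨ht.1, ht.2.1⟩ ⟨hu.1, hu.2.1⟩ ?_
    exact_mod_cast mul_right_cancel₀ hε.ne' he

/-- Superposing the Riemann solutions amounts to moving every wave with its own speed. The identity
is algebraic, so it holds for every `τ`, and the order of the waves is not needed. -/
lemma IsConfig.evolve_stepFun (h : IsConfig A X S r) (hε : 0 < ε) (τ : ℝ) :
    evolve f ε (stepFun ε A X S) τ =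
      stepFun ε A (fun s => X s + τ * configSpeed f ε A X S r s) S := by
  funext x
  have hset : {y : ℝ | leftLim (stepFun ε A X S) y ≠ stepFun ε A X S y} = ↑(A.image X) := by
    ext y
    simp only [mem_ofPred_eq, Finset.coe_image, mem_image, Finset.mem_coe]
    constructor
    · intro hy
      by_contra hcon
      exact hy (leftLim_stepFun_eq ε A X S hcon)
    · rintro ⟨s, hs, rfl⟩ he
      obtain ⟨hj, hpos⟩ := h.jump hε hs
      rw [← he, sub_self] at hj
      rcases h.sign s hs with h1 | h1 <;> rw [h1] at hj <;> push_cast at hj <;> linarith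
  rw [evolve, hset, finsum_mem_coe_finset, stepFun]
  rw [Finset.sum_congr rfl (g := fun y =>
    ((∑ t ∈ A with X t = y ∧ X t + τ * configSpeed f ε A X S r t ≤ x, S t : ℤ) : ℝ) * ε)]
  · rw [← Finset.sum_mul, ← Int.cast_sum]
    congr 2
    rw [← Finset.sum_fiberwise_of_maps_to (g := X) (t := A.image X) (s := {s ∈ A |
      X s + τ * configSpeed f ε A X S r s ≤ x})
      fun s hs => Finset.mem_image_of_mem _ (Finset.mem_filter.1 hs).1]
    refine Finset.sum_congr rfl fun y _ => Finset.sum_congr ?_ fun _ _ => rfl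
    rw [Finset.filter_filter]
    exact Finset.filter_congr fun _ _ => and_comm
  · intro y hy
    obtain ⟨s, hs, rfl⟩ := Finset.mem_image.1 hy
    exact h.riemannSolution_eq hε hs τ x

lemma IsConfig.fronts_eq (h : IsConfig A X S r) (hε : 0 < ε) :
    fronts f ε (stepFun ε A X S) = (fun s => (X s, configSpeed f ε A X S r s)) '' ↑A := by
  ext ⟨y, c⟩
  simp only [fronts, mem_ofPred_eq, mem_image, Finset.mem_coe, Prod.mk.injEq]
  constructor
  · rintro ⟨w, hw, rfl⟩
    have hy : ∃ s ∈ A, X s = y := by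
      by_contra hcon
      rw [leftLim_stepFun_eq ε A X S hcon] at hw
      obtain ⟨-, hw⟩ := hw
      rcases hw with hw | hw <;> linarith [hw.1, hw.2]
    obtain ⟨s, hs, rfl⟩ := hy
    rw [h.riemannStates_eq hε hs] at hw
    obtain ⟨t, ht, rfl⟩ := hw
    exact ⟨t, ht.1, ht.2, by rw [configSpeed, ht.2]⟩
  · rintro ⟨s, hs, rfl, rfl⟩
    refine ⟨r s * ε, ?_, rfl⟩
    rw [h.riemannStates_eq hε hs]
    exact ⟨s, ⟨hs, rfl⟩, rfl⟩

end Config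

/-! ### Collisions -/

/-- The wavefronts `P` and `Q` collide when the waves have reached the positions `X'`, and no other
wavefronts do. -/
structure IsCollision (A : Finset ℕ) (X σ X' : ℕ → ℝ) (P Q : Finset ℕ) : Prop where
  left : IsFront A X σ P
  right : IsFront A X σ Q
  left_nonempty : P.Nonempty
  right_nonempty : Q.Nonempty
  position_lt : ∀ s ∈ P, ∀ t ∈ Q, X s < X t
  speed_lt : ∀ s ∈ P, ∀ t ∈ Q, σ t < σ s
  mono : ∀ s ∈ A, ∀ t ∈ A, s ≤ t → X' s ≤ X' t
  meet : ∀ s ∈ A, ∀ t ∈ A, X' s = X' t ↔ (X s = X t ∧ σ s = σ t) ∨ (s ∈ P ∪ Q ∧ t ∈ P ∪ Q)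

/-- The cell of the wave `s` is contained in the jump at the position of `s`. -/
def InJump (A : Finset ℕ) (X : ℕ → ℝ) (S r : ℕ → ℤ) (s : ℕ) : Prop :=
  S s * ∑ t ∈ A with X t < X s, S t ≤ S s * r s - 1 ∧
    S s * r s ≤ S s * ∑ t ∈ A with X t ≤ X s, S t

section MeetingTimes

variable {f : ℝ → ℝ} {ε : ℝ} {A : Finset ℕ} {X : ℕ → ℝ} {S r : ℕ → ℤ}

/-- There are finitely many fronts, and each pair determines at most one meeting time, so the
infimum is attained. -/
lemma IsConfig.firstMeeting_mem (h : IsConfig A X S r) (hε : 0 < ε)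
    (hne : (meetingTimes f ε (stepFun ε A X S)).Nonempty) :
    firstMeeting f ε (stepFun ε A X S) ∈ meetingTimes f ε (stepFun ε A X S) := by
  refine hne.csInf_mem ?_
  have hfin : (fronts f ε (stepFun ε A X S)).Finite := by
    rw [h.fronts_eq hε]
    exact A.finite_toSet.image _
  refine ((hfin.prod hfin).image fun w => (w.2.1 - w.1.1) / (w.1.2 - w.2.2)).subset ?_
  rintro τ ⟨hτ, p, hp, q, hq, hpq, he⟩
  refine ⟨(p, q), ⟨hp, hq⟩, ?_⟩
  have hne : p.2 - q.2 ≠ 0 := fun h0 => by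
    rw [sub_eq_zero] at h0
    rw [h0] at he
    linarith
  simp only
  rw [div_eq_iff hne]
  linarith

lemma IsConfig.isCollision (h : IsConfig A X S r) (hε : 0 < ε)
    (hne : (meetingTimes f ε (stepFun ε A X S)).Nonempty)
    (huniq : ∃! w : (ℝ × ℝ) × (ℝ × ℝ), w ∈ collidingPairs f ε (stepFun ε A X S)) :
    ∃ P Q : Finset ℕ, IsCollision A X (configSpeed f ε A X S r)
        (fun s => X s + firstMeeting f ε (stepFun ε A X S) * configSpeed f ε A X S r s) P Q ∧
      ∀ p ∈ P, ∀ q ∈ Q, collidingPairs f ε (stepFun ε A X S) =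
        {((X p, configSpeed f ε A X S r p), (X q, configSpeed f ε A X S r q))} := by
  classical
  have hmem := h.firstMeeting_mem hε hne
  have hmin : ∀ τ ∈ meetingTimes f ε (stepFun ε A X S),
      firstMeeting f ε (stepFun ε A X S) ≤ τ := fun τ hτ => csInf_le ⟨0, fun x hx => hx.1.le⟩ hτ
  have hb := h.blockSpeeds (f := f) hε
  have hfr : ∀ s ∈ A, (X s, configSpeed f ε A X S r s) ∈ fronts f ε (stepFun ε A X S) := by
    intro s hs
    rw [h.fronts_eq hε]
    exact ⟨s, hs, rfl⟩
  obtain ⟨w, hw, hwu⟩ := huniq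
  simp only at hwu
  set τ := firstMeeting f ε (stepFun ε A X S) with hτ
  set σ := configSpeed f ε A X S r with hσ
  have hτ0 : 0 < τ := hmem.1
  have hw' := hw
  obtain ⟨hw1, hw2, hwlt, hweq⟩ := hw'
  rw [h.fronts_eq hε] at hw1 hw2
  obtain ⟨p₀, hp₀, hp₀w⟩ := hw1
  obtain ⟨q₀, hq₀, hq₀w⟩ := hw2
  simp only [Finset.mem_coe] at hp₀ hq₀
  rw [← hp₀w, ← hq₀w] at hwlt hweq
  simp only [← hσ, ← hτ] at hwlt hweq
  have hwσ : σ q₀ < σ p₀ := by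
    by_contra hcon
    push Not at hcon
    have := mul_le_mul_of_nonneg_left hcon hτ0.le
    linarith
  have hPmem : ∀ {s}, s ∈ ({s ∈ A | X s = X p₀ ∧ σ s = σ p₀} : Finset ℕ) ↔
      s ∈ A ∧ X s = X p₀ ∧ σ s = σ p₀ := by simp
  have hQmem : ∀ {s}, s ∈ ({s ∈ A | X s = X q₀ ∧ σ s = σ q₀} : Finset ℕ) ↔
      s ∈ A ∧ X s = X q₀ ∧ σ s = σ q₀ := by simp
  -- Two waves that had already crossed would have met strictly before the first meeting time.
  have hsep : ∀ s ∈ A, ∀ t ∈ A, X s < X t → X s + τ * σ s ≤ X t + τ * σ t := by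
    intro s hs t ht hst
    by_contra hcon
    push Not at hcon
    have hσst : σ t < σ s := by
      by_contra hcon'
      push Not at hcon'
      have := mul_le_mul_of_nonneg_left hcon' hτ0.le
      linarith
    have hd : 0 < σ s - σ t := sub_pos.2 hσst
    have hmt : (X t - X s) / (σ s - σ t) ∈ meetingTimes f ε (stepFun ε A X S) := by
      refine ⟨div_pos (by linarith) hd, _, hfr s hs, _, hfr t ht, hst, ?_⟩
      simp only
      field_simp
      ring
    have := hmin _ hmt
    rw [le_div_iff₀ hd] at this
    linarith
  have hcoll : ∀ s ∈ A, ∀ t ∈ A, X s < X t → X s + τ * σ s = X t + τ * σ t →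
      (X s = X p₀ ∧ σ s = σ p₀) ∧ (X t = X q₀ ∧ σ t = σ q₀) := by
    intro s hs t ht hst he
    have := hwu ((X s, σ s), (X t, σ t)) ⟨hfr s hs, hfr t ht, hst, he⟩
    rw [← this] at hp₀w hq₀w
    simp only [Prod.mk.injEq] at hp₀w hq₀w
    exact ⟨⟨hp₀w.1.symm, hp₀w.2.symm⟩, ⟨hq₀w.1.symm, hq₀w.2.symm⟩⟩
  have hPQ : ∀ s ∈ ({s ∈ A | X s = X p₀ ∧ σ s = σ p₀} ∪ {s ∈ A | X s = X q₀ ∧ σ s = σ q₀} :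
      Finset ℕ), X s + τ * σ s = X p₀ + τ * σ p₀ := by
    intro s hs
    rcases Finset.mem_union.1 hs with h1 | h1
    · rw [(hPmem.1 h1).2.1, (hPmem.1 h1).2.2]
    · rw [(hQmem.1 h1).2.1, (hQmem.1 h1).2.2, hweq]
  refine ⟨{s ∈ A | X s = X p₀ ∧ σ s = σ p₀}, {s ∈ A | X s = X q₀ ∧ σ s = σ q₀},
    ⟨⟨Finset.filter_subset _ _, ?_⟩, ⟨Finset.filter_subset _ _, ?_⟩, ⟨p₀, by simp [hp₀]⟩,
      ⟨q₀, by simp [hq₀]⟩, ?_, ?_, ?_, ?_⟩, ?_⟩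
  · intro s hs t ht
    rw [hPmem, (hPmem.1 hs).2.1, (hPmem.1 hs).2.2]
    simp [ht]
  · intro s hs t ht
    rw [hQmem, (hQmem.1 hs).2.1, (hQmem.1 hs).2.2]
    simp [ht]
  · intro s hs t ht
    rw [(hPmem.1 hs).2.1, (hQmem.1 ht).2.1]
    exact hwlt
  · intro s hs t ht
    rw [(hPmem.1 hs).2.2, (hQmem.1 ht).2.2]
    exact hwσ
  · intro s hs t ht hst
    rcases (h.mono s hs t ht hst).lt_or_eq with h1 | h1
    · exact hsep s hs t ht h1
    · have := mul_le_mul_of_nonneg_left (hb.mono s hs t ht h1 hst) hτ0.le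
      rw [h1]
      linarith
  · intro s hs t ht
    constructor
    · intro he
      rcases lt_trichotomy (X s) (X t) with h1 | h1 | h1
      · obtain ⟨h2, h3⟩ := hcoll s hs t ht h1 he
        exact Or.inr ⟨Finset.mem_union_left _ (hPmem.2 ⟨hs, h2⟩),
          Finset.mem_union_right _ (hQmem.2 ⟨ht, h3⟩)⟩
      · refine Or.inl ⟨h1, ?_⟩
        rw [h1] at he
        exact mul_left_cancel₀ hτ0.ne' (add_left_cancel he)
      · obtain ⟨h2, h3⟩ := hcoll t ht s hs h1 he.symm
        exact Or.inr ⟨Finset.mem_union_right _ (hQmem.2 ⟨hs, h3⟩),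
          Finset.mem_union_left _ (hPmem.2 ⟨ht, h2⟩)⟩
    · rintro (h1 | h1)
      · rw [h1.1, h1.2]
      · rw [hPQ s h1.1, hPQ t h1.2]
  · intro p hp q hq
    rw [(hPmem.1 hp).2.1, (hPmem.1 hp).2.2, (hQmem.1 hq).2.1, (hQmem.1 hq).2.2]
    refine Set.eq_singleton_iff_unique_mem.2 ⟨?_, fun x hx => ?_⟩
    · exact ⟨hfr p₀ hp₀, hfr q₀ hq₀, hwlt, hweq⟩
    · rw [hwu x hx, hwu ((X p₀, σ p₀), (X q₀, σ q₀)) ⟨hfr p₀ hp₀, hfr q₀ hq₀, hwlt, hweq⟩]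

end MeetingTimes

/-! ### Which waves survive a collision -/

lemma sum_filter_le_of_const {P : Finset ℕ} {S : ℕ → ℤ} {s : ℕ} (hs : s ∈ P)
    (hS : ∀ t ∈ P, S t = S s) :
    ∑ t ∈ P with t ≤ s, S t = S s * (({t ∈ P | t < s}.card + 1 : ℕ) : ℤ) := by
  rw [Finset.sum_congr rfl fun t ht => hS t (Finset.mem_filter.1 ht).1, Finset.sum_const,
    nsmul_eq_mul, mul_comm]
  congr 2
  rw [← Finset.card_insert_of_notMem (s := {u ∈ P | u < s}) (a := s) (by simp)]
  congr 1
  ext u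
  simp only [Finset.mem_filter, Finset.mem_insert]
  constructor
  · rintro ⟨h1, h2⟩
    rcases h2.eq_or_lt with h3 | h3
    · exact Or.inl h3
    · exact Or.inr ⟨h1, h3⟩
  · rintro (h1 | ⟨h1, h2⟩)
    · subst h1; exact ⟨hs, le_rfl⟩
    · exact ⟨h1, h2.le⟩

lemma card_filter_rank (P : Finset ℕ) (p : ℕ → Prop) [DecidablePred p] :
    {s ∈ P | p {t ∈ P | t < s}.card}.card = {i ∈ Finset.range P.card | p i}.card := by
  rw [Finset.card_filter, Finset.card_filter]
  exact sum_rank (fun i => if p i then 1 else 0) P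

section Collision

variable {ε : ℝ} {A : Finset ℕ} {X σ X' : ℕ → ℝ} {S r : ℕ → ℤ} {P Q : Finset ℕ}

lemma IsCollision.lt (hc : IsCollision A X σ X' P Q) (h : IsConfig A X S r) :
    ∀ s ∈ P, ∀ t ∈ Q, s < t := by
  intro s hs t ht
  by_contra hcon
  push Not at hcon
  have := h.mono t (hc.right.1 ht) s (hc.left.1 hs) hcon
  exact absurd (hc.position_lt s hs t ht) (not_lt.2 this)

lemma IsCollision.disjoint (hc : IsCollision A X σ X' P Q) : Disjoint P Q :=
  Finset.disjoint_left.2 fun t h1 h2 => lt_irrefl _ (hc.position_lt t h1 t h2)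

lemma IsCollision.subset (hc : IsCollision A X σ X' P Q) : P ∪ Q ⊆ A :=
  Finset.union_subset hc.left.1 hc.right.1

lemma IsCollision.mem_iff (hc : IsCollision A X σ X' P Q) {s t : ℕ} (hs : s ∈ P ∪ Q) (ht : t ∈ A) :
    t ∈ P ∪ Q ↔ X' t = X' s := by
  rw [hc.meet t ht s (hc.subset hs)]
  refine ⟨fun h => Or.inr ⟨h, hs⟩, ?_⟩
  rintro (h | h)
  · rcases Finset.mem_union.1 hs with h1 | h1
    · exact Finset.mem_union_left _ ((hc.left.2 s h1 t ht).2 h)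
    · exact Finset.mem_union_right _ ((hc.right.2 s h1 t ht).2 h)
  · exact h.1

lemma IsCollision.convex (hc : IsCollision A X σ X' P Q) :
    ∀ s ∈ P ∪ Q, ∀ t ∈ P ∪ Q, ∀ u ∈ A, s ≤ u → u ≤ t → u ∈ P ∪ Q := by
  intro s hs t ht u hu h1 h2
  rw [hc.mem_iff hs hu]
  have e := (hc.mem_iff hs (hc.subset ht)).1 ht
  exact le_antisymm (e ▸ hc.mono u hu t (hc.subset ht) h2) (hc.mono s (hc.subset hs) u hu h1)

lemma IsCollision.sign_left (hc : IsCollision A X σ X' P Q) (h : IsConfig A X S r) :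
    ∀ s ∈ P, ∀ t ∈ P, S s = S t := fun s hs t ht =>
  h.same s (hc.left.1 hs) t (hc.left.1 ht) (hc.left.eq ht hs).1

lemma IsCollision.sign_right (hc : IsCollision A X σ X' P Q) (h : IsConfig A X S r) :
    ∀ s ∈ Q, ∀ t ∈ Q, S s = S t := fun s hs t ht =>
  h.same s (hc.right.1 hs) t (hc.right.1 ht) (hc.right.eq ht hs).1

lemma IsCollision.right_eq (hc : IsCollision A X σ X' P Q) (h : IsConfig A X S r) {s : ℕ}
    (hs : s ∈ P ∪ Q) :
    r s = ∑ t ∈ A with X' t < X' s, S t + ∑ t ∈ P ∪ Q with t ≤ s, S t := by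
  have hsA := hc.subset hs
  have e : {t ∈ P ∪ Q | t ≤ s} = {t ∈ A | X' t = X' s ∧ t ≤ s} := by
    ext t
    simp only [Finset.mem_filter]
    constructor
    · rintro ⟨h1, h2⟩; exact ⟨hc.subset h1, (hc.mem_iff hs (hc.subset h1)).1 h1, h2⟩
    · rintro ⟨h1, h2, h3⟩; exact ⟨(hc.mem_iff hs h1).2 h2, h3⟩
  rw [h.right s hsA, e]
  simp only [Finset.sum_filter, ← Finset.sum_add_distrib]
  refine Finset.sum_congr rfl fun t ht => ?_
  rcases lt_trichotomy (X' t) (X' s) with h1 | h1 | h1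
  · have h2 : t ≤ s := by
      by_contra h2
      have := hc.mono s hsA t ht (by omega)
      linarith
    simp [h1, h1.ne, h2]
  · simp [h1]
  · have h2 : ¬ t ≤ s := fun h2 => by
      have := hc.mono t ht s hsA h2
      linarith
    simp [h1.not_gt, h1.ne', h2]

lemma IsCollision.sum_le (hc : IsCollision A X σ X' P Q) {s : ℕ} (hs : s ∈ P ∪ Q) :
    ∑ t ∈ A with X' t ≤ X' s, S t =
      ∑ t ∈ A with X' t < X' s, S t + (∑ t ∈ P, S t + ∑ t ∈ Q, S t) := by
  have e : P ∪ Q = {t ∈ A | X' t = X' s} := by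
    ext t
    simp only [Finset.mem_filter]
    exact ⟨fun h1 => ⟨hc.subset h1, (hc.mem_iff hs (hc.subset h1)).1 h1⟩,
      fun h1 => (hc.mem_iff hs h1.1).2 h1.2⟩
  rw [← Finset.sum_union hc.disjoint, e]
  simp only [Finset.sum_filter, ← Finset.sum_add_distrib]
  refine Finset.sum_congr rfl fun t _ => ?_
  rcases lt_trichotomy (X' t) (X' s) with h1 | h1 | h1
  · simp [h1, h1.le, h1.ne]
  · simp [h1]
  · simp [h1.not_ge, h1.not_gt, h1.ne']

lemma sum_const_sign {S : ℕ → ℤ} (hS : ∀ s ∈ P, ∀ t ∈ P, S s = S t) {p : ℕ} (hp : p ∈ P) :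
    ∑ t ∈ P, S t = S p * (P.card : ℤ) := by
  rw [Finset.sum_congr rfl fun t ht => hS t ht p hp, Finset.sum_const, nsmul_eq_mul, mul_comm]

/-- Measured from the left state in the direction of `s`, the cell of `s` ends at rank plus one, and
the jump left by the collision has size `|P| ± |Q|`, with the sign `S s * S q`. The left end of the
cell imposes no condition on a wave of `P`. -/
lemma IsCollision.inJump_left (hc : IsCollision A X σ X' P Q) (h : IsConfig A X S r) {s q : ℕ}
    (hs : s ∈ P) (hq : q ∈ Q) : InJump A X' S r s ↔
      (({t ∈ P | t < s}.card + 1 : ℕ) : ℤ) ≤ P.card + S s * S q * Q.card := by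
  have hsu := Finset.mem_union_left Q hs
  have hsum : ∑ t ∈ P ∪ Q with t ≤ s, S t = S s * (({t ∈ P | t < s}.card + 1 : ℕ) : ℤ) := by
    rw [Finset.filter_union, Finset.filter_false_of_mem (s := Q), Finset.union_empty]
    · exact sum_filter_le_of_const hs fun t ht => hc.sign_left h t ht s hs
    · intro t ht
      exact not_le.2 (hc.lt h s hs t ht)
  have hSS : S s * S s = 1 := by rcases h.sign s (hc.left.1 hs) with h1 | h1 <;> rw [h1] <;> rfl
  rw [InJump, hc.sum_le hsu, hc.right_eq h hsu, hsum, sum_const_sign (hc.sign_left h) hs,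
    sum_const_sign (hc.sign_right h) hq]
  set L := ∑ t ∈ A with X' t < X' s, S t
  have e1 : S s * (L + S s * (({t ∈ P | t < s}.card + 1 : ℕ) : ℤ)) =
      S s * L + (({t ∈ P | t < s}.card + 1 : ℕ) : ℤ) := by
    rw [mul_add, ← mul_assoc, hSS, one_mul]
  have e2 : S s * (L + (S s * (P.card : ℤ) + S q * (Q.card : ℤ))) =
      S s * L + (P.card + S s * S q * Q.card) := by
    linear_combination (P.card : ℤ) * hSS
  rw [e1, e2]
  push_cast
  constructor
  · rintro ⟨-, h2⟩; linarith
  · intro h2; exact ⟨by omega, by linarith⟩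

lemma IsCollision.inJump_right (hc : IsCollision A X σ X' P Q) (h : IsConfig A X S r) {s p : ℕ}
    (hs : s ∈ Q) (hp : p ∈ P) : InJump A X' S r s ↔
      0 ≤ S s * S p * P.card + ({t ∈ Q | t < s}.card : ℤ) := by
  have hsu := Finset.mem_union_right P hs
  have hsum : ∑ t ∈ P ∪ Q with t ≤ s, S t =
      S p * (P.card : ℤ) + S s * (({t ∈ Q | t < s}.card + 1 : ℕ) : ℤ) := by
    rw [Finset.filter_union, Finset.sum_union (Finset.disjoint_filter_filter hc.disjoint),
      Finset.filter_true_of_mem (s := P), sum_const_sign (hc.sign_left h) hp,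
      sum_filter_le_of_const hs fun t ht => hc.sign_right h t ht s hs]
    intro t ht
    exact (hc.lt h t ht s hs).le
  have hSS : S s * S s = 1 := by rcases h.sign s (hc.right.1 hs) with h1 | h1 <;> rw [h1] <;> rfl
  rw [InJump, hc.sum_le hsu, hc.right_eq h hsu, hsum, sum_const_sign (hc.sign_left h) hp,
    sum_const_sign (hc.sign_right h) hs]
  set L := ∑ t ∈ A with X' t < X' s, S t
  have hlt := rank_lt hs
  have e1 : S s * (L + (S p * (P.card : ℤ) + S s * (({t ∈ Q | t < s}.card + 1 : ℕ) : ℤ))) =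
      S s * L + S s * S p * P.card + (({t ∈ Q | t < s}.card + 1 : ℕ) : ℤ) := by
    linear_combination (({t ∈ Q | t < s}.card + 1 : ℕ) : ℤ) * hSS
  have e2 : S s * (L + (S p * (P.card : ℤ) + S s * (Q.card : ℤ))) =
      S s * L + S s * S p * P.card + Q.card := by
    linear_combination (Q.card : ℤ) * hSS
  rw [e1, e2]
  push_cast
  constructor
  · rintro ⟨h2, -⟩; linarith
  · intro h2; exact ⟨by linarith, by omega⟩

/-- If the colliding wavefronts have the same sign, no wave is removed. -/
lemma IsCollision.inJump_of_sign_eq (hc : IsCollision A X σ X' P Q) (h : IsConfig A X S r)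
    {p q : ℕ} (hp : p ∈ P) (hq : q ∈ Q) (hpq : S p = S q) : ∀ s ∈ P ∪ Q, InJump A X' S r s := by
  intro s hs
  have hSS : S p * S p = 1 := by rcases h.sign p (hc.left.1 hp) with h1 | h1 <;> rw [h1] <;> rfl
  rcases Finset.mem_union.1 hs with hs' | hs'
  · rw [hc.inJump_left h hs' hq, hc.sign_left h s hs' p hp, ← hpq, hSS]
    have := rank_lt hs'
    omega
  · rw [hc.inJump_right h hs' hp, hc.sign_right h s hs' q hq, ← hpq, hSS]
    omega

lemma IsCollision.config_of_sign_eq (hc : IsCollision A X σ X' P Q) (h : IsConfig A X S r)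
    {p q : ℕ} (hp : p ∈ P) (hq : q ∈ Q) (hpq : S p = S q) : IsConfig A X' S r := by
  have hPQ : ∀ s ∈ P ∪ Q, S s = S p := by
    intro s hs
    rcases Finset.mem_union.1 hs with h1 | h1
    · exact hc.sign_left h s h1 p hp
    · rw [hpq]; exact hc.sign_right h s h1 q hq
  refine ⟨hc.mono, h.sign, fun s hs t ht he => ?_, h.right⟩
  rcases (hc.meet s hs t ht).1 he with h1 | h1
  · exact h.same s hs t ht h1.1
  · rw [hPQ s h1.1, hPQ t h1.2]

/-- The outcome of a cancellation: `A'` are the waves that survive. -/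
structure IsCancellation (ε : ℝ) (A : Finset ℕ) (X σ X' : ℕ → ℝ) (S r : ℕ → ℤ) (A' : Finset ℕ) :
    Prop where
  subset : A' ⊆ A
  config : IsConfig A' X' S r
  stepFun_eq : stepFun ε A X' S = stepFun ε A' X' S
  front : ∀ s ∈ A', ∀ t ∈ A', X' s = X' t ↔ X s = X t ∧ σ s = σ t
  side : ∀ u ∈ A', (∀ v ∈ A \ A', u < v) ∨ (∀ v ∈ A \ A', v < u)
  sign : ∃ v₁ ∈ A \ A', ∃ v₂ ∈ A \ A', S v₁ ≠ S v₂
  survivor : ∃ F, IsFront A X σ F ∧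
    (∀ t ∈ A \ A', t ∉ F → ∀ s ∈ A', ¬ (X t = X s ∧ σ t = σ s)) ∧
    ((∀ u ∈ F, u ∈ A' → ∀ v ∈ F, v ∉ A' → u < v) ∨ (∀ u ∈ F, u ∈ A' → ∀ v ∈ F, v ∉ A' → v < u))

lemma IsCollision.isCancellation (hc : IsCollision A X σ X' P Q) (h : IsConfig A X S r)
    {p q : ℕ} (hp : p ∈ P) (hq : q ∈ Q) (hpq : S p ≠ S q) {A' : Finset ℕ}
    (hA' : ∀ s, s ∈ A' ↔ s ∈ A ∧ (s ∈ P ∪ Q → InJump A X' S r s)) :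
    IsCancellation ε A X σ X' S r A' := by
  have hSpq : S q = - S p := by
    rcases h.sign p (hc.left.1 hp) with h1 | h1 <;> rcases h.sign q (hc.right.1 hq) with h2 | h2 <;>
      rw [h1, h2] at hpq ⊢ <;> first | rfl | exact absurd rfl hpq
  have hSS : S p * S p = 1 := by rcases h.sign p (hc.left.1 hp) with h1 | h1 <;> rw [h1] <;> rfl
  have hPpos : 0 < P.card := Finset.card_pos.2 ⟨p, hp⟩
  have hQpos : 0 < Q.card := Finset.card_pos.2 ⟨q, hq⟩
  have hsub : A' ⊆ A := fun s hs => ((hA' s).1 hs).1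
  have hR : ∀ s, s ∈ A \ A' ↔ s ∈ P ∪ Q ∧ ¬ InJump A X' S r s := by
    intro s
    rw [Finset.mem_sdiff, hA']
    constructor
    · rintro ⟨h1, h2⟩
      push Not at h2
      exact h2 h1
    · rintro ⟨h1, h2⟩
      exact ⟨hc.subset h1, fun h3 => h2 (h3.2 h1)⟩
  -- With opposite signs, the last `|Q|` waves of `P` and the first `|P|` waves of `Q` disappear.
  -- Truncated subtraction covers the case in which `P` vanishes entirely.
  have hJP : ∀ s ∈ P, InJump A X' S r s ↔ {t ∈ P | t < s}.card < P.card - Q.card := by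
    intro s hs
    rw [hc.inJump_left h hs hq, hc.sign_left h s hs p hp, hSpq, mul_neg, hSS]
    omega
  have hJQ : ∀ s ∈ Q, InJump A X' S r s ↔ P.card ≤ {t ∈ Q | t < s}.card := by
    intro s hs
    rw [hc.inJump_right h hs hp, hc.sign_right h s hs q hq, hSpq, neg_mul, hSS]
    omega
  have hAP : ∀ s ∈ P, s ∈ A' ↔ {t ∈ P | t < s}.card < P.card - Q.card := by
    intro s hs
    rw [hA', ← hJP s hs]
    exact ⟨fun h1 => h1.2 (Finset.mem_union_left _ hs), fun h1 => ⟨hc.left.1 hs, fun _ => h1⟩⟩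
  have hAQ : ∀ s ∈ Q, s ∈ A' ↔ P.card ≤ {t ∈ Q | t < s}.card := by
    intro s hs
    rw [hA', ← hJQ s hs]
    exact ⟨fun h1 => h1.2 (Finset.mem_union_right _ hs), fun h1 => ⟨hc.right.1 hs, fun _ => h1⟩⟩
  have hPside : ∀ u ∈ P, u ∈ A' → ∀ v ∈ P, v ∉ A' → u < v := by
    intro u hu huA v hv hvA
    rw [hAP u hu] at huA
    rw [hAP v hv] at hvA
    by_contra hcon
    have := rank_mono P (not_lt.1 hcon)
    omega
  have hQside : ∀ u ∈ Q, u ∈ A' → ∀ v ∈ Q, v ∉ A' → v < u := by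
    intro u hu huA v hv hvA
    rw [hAQ u hu] at huA
    rw [hAQ v hv] at hvA
    by_contra hcon
    have := rank_mono Q (not_lt.1 hcon)
    omega
  have hRsub : ∀ v ∈ A \ A', v ∈ P ∪ Q := fun v hv => ((hR v).1 hv).1
  have hside : ∀ u ∈ A', (∀ v ∈ A \ A', u < v) ∨ (∀ v ∈ A \ A', v < u) := by
    intro u hu
    have huA := hsub hu
    by_cases huC : u ∈ P ∪ Q
    · rcases Finset.mem_union.1 huC with h1 | h1
      · left
        intro v hv
        rcases Finset.mem_union.1 (hRsub v hv) with h2 | h2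
        · exact hPside u h1 hu v h2 (Finset.mem_sdiff.1 hv).2
        · exact hc.lt h u h1 v h2
      · right
        intro v hv
        rcases Finset.mem_union.1 (hRsub v hv) with h2 | h2
        · exact hc.lt h v h2 u h1
        · exact hQside u h1 hu v h2 (Finset.mem_sdiff.1 hv).2
    · by_cases hup : u < p
      · left
        intro v hv
        by_contra hcon
        exact huC (hc.convex v (hRsub v hv) p (Finset.mem_union_left _ hp) u huA (by omega) hup.le)
      · right
        intro v hv
        by_contra hcon
        exact huC (hc.convex p (Finset.mem_union_left _ hp) v (hRsub v hv) u huA (by omega)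
          (by omega))
  -- Each front loses `min |P| |Q|` waves and the signs are opposite. Hence removing these waves
  -- changes neither the profile nor the right states of the survivors.
  have hsum0 : ∑ t ∈ A \ A', S t = 0 := by
    have hset : A \ A' = {s ∈ P | ¬ {t ∈ P | t < s}.card < P.card - Q.card} ∪
        {s ∈ Q | ¬ P.card ≤ {t ∈ Q | t < s}.card} := by
      ext s
      simp only [Finset.mem_union, Finset.mem_filter]
      constructor
      · intro hs
        have hsA := (Finset.mem_sdiff.1 hs).2
        rcases Finset.mem_union.1 (hRsub s hs) with h2 | h2
        · exact Or.inl ⟨h2, by rwa [← hAP s h2]⟩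
        · exact Or.inr ⟨h2, by rwa [← hAQ s h2]⟩
      · rintro (⟨h1, h2⟩ | ⟨h1, h2⟩)
        · exact Finset.mem_sdiff.2 ⟨hc.left.1 h1, by rwa [hAP s h1]⟩
        · exact Finset.mem_sdiff.2 ⟨hc.right.1 h1, by rwa [hAQ s h1]⟩
    have c1 : {s ∈ P | ¬ {t ∈ P | t < s}.card < P.card - Q.card}.card = min P.card Q.card := by
      rw [card_filter_rank P (fun i => ¬ i < P.card - Q.card)]
      have : {i ∈ Finset.range P.card | ¬ i < P.card - Q.card} =
          Finset.Ico (P.card - Q.card) P.card := by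
        ext i
        simp only [Finset.mem_filter, Finset.mem_range, Finset.mem_Ico]
        omega
      rw [this, Nat.card_Ico]
      omega
    have c2 : {s ∈ Q | ¬ P.card ≤ {t ∈ Q | t < s}.card}.card = min P.card Q.card := by
      rw [card_filter_rank Q (fun i => ¬ P.card ≤ i)]
      have : {i ∈ Finset.range Q.card | ¬ P.card ≤ i} = Finset.range (min P.card Q.card) := by
        ext i
        simp only [Finset.mem_filter, Finset.mem_range]
        omega
      rw [this, Finset.card_range]
    rw [hset, Finset.sum_union (Finset.disjoint_filter_filter hc.disjoint),
      Finset.sum_congr rfl fun t ht => hc.sign_left h t (Finset.mem_filter.1 ht).1 p hp,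
      Finset.sum_congr (s₁ := {s ∈ Q | ¬ P.card ≤ {t ∈ Q | t < s}.card}) rfl
        fun t ht => hc.sign_right h t (Finset.mem_filter.1 ht).1 q hq,
      Finset.sum_const, Finset.sum_const, c1, c2, hSpq]
    simp
  have hfront : ∀ s ∈ A', ∀ t ∈ A', X' s = X' t ↔ X s = X t ∧ σ s = σ t := by
    intro s hs t ht
    rw [hc.meet s (hsub hs) t (hsub ht)]
    refine ⟨fun h1 => h1.elim id fun h2 => ?_, Or.inl⟩
    rcases Finset.mem_union.1 h2.1 with a1 | a1 <;> rcases Finset.mem_union.1 h2.2 with a2 | a2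
    · exact hc.left.eq a2 a1
    · have e1 := (hAP s a1).1 hs
      have e2 := (hAQ t a2).1 ht
      have := rank_lt a2
      omega
    · have e1 := (hAQ s a1).1 hs
      have e2 := (hAP t a2).1 ht
      have := rank_lt a1
      omega
    · exact hc.right.eq a2 a1
  obtain ⟨pm, hpm, hpmax⟩ := P.exists_max_image id ⟨p, hp⟩
  obtain ⟨qm, hqm, hqmin⟩ := Q.exists_min_image id ⟨q, hq⟩
  simp only [id] at hpmax hqmin
  refine ⟨hsub, ⟨fun s hs t ht => hc.mono s (hsub hs) t (hsub ht), fun s hs => h.sign s (hsub hs),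
    fun s hs t ht he => h.same s (hsub hs) t (hsub ht) ((hfront s hs t ht).1 he).1, ?_⟩, ?_,
    hfront, hside, ⟨pm, ?_, qm, ?_, ?_⟩, ?_⟩
  · intro s hs
    rw [h.right s (hsub hs), ← Finset.sdiff_union_of_subset hsub, Finset.filter_union,
      Finset.sum_union (Finset.disjoint_filter_filter Finset.sdiff_disjoint), add_eq_right]
    rcases hside s hs with h1 | h1
    · rw [Finset.filter_false_of_mem fun t ht => not_le.2 (h1 t ht), Finset.sum_empty]
    · rw [Finset.filter_true_of_mem fun t ht => (h1 t ht).le, hsum0]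
  · funext x
    rw [stepFun, stepFun]
    congr 2
    rw [← Finset.sdiff_union_of_subset hsub, Finset.filter_union,
      Finset.sum_union (Finset.disjoint_filter_filter Finset.sdiff_disjoint), add_eq_right]
    have hpos : ∀ v ∈ A \ A', X' v = X' p := fun v hv =>
      (hc.mem_iff (Finset.mem_union_left _ hp) (Finset.mem_sdiff.1 hv).1).1 (hRsub v hv)
    by_cases hx : X' p ≤ x
    · rw [Finset.filter_true_of_mem fun t ht => by rw [hpos t ht]; exact hx, hsum0]
    · rw [Finset.filter_false_of_mem fun t ht => by rw [hpos t ht]; exact hx, Finset.sum_empty]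
  · refine Finset.mem_sdiff.2 ⟨hc.left.1 hpm, ?_⟩
    rw [hAP pm hpm]
    have : {t ∈ P | t < pm} = P.erase pm := by
      ext t
      simp only [Finset.mem_filter, Finset.mem_erase]
      constructor
      · rintro ⟨h1, h2⟩; exact ⟨h2.ne, h1⟩
      · rintro ⟨h1, h2⟩; exact ⟨h2, lt_of_le_of_ne (hpmax t h2) h1⟩
    rw [this, Finset.card_erase_of_mem hpm]
    omega
  · refine Finset.mem_sdiff.2 ⟨hc.right.1 hqm, ?_⟩
    rw [hAQ qm hqm, Finset.filter_false_of_mem fun t ht => not_lt.2 (hqmin t ht),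
      Finset.card_empty]
    omega
  · rwa [hc.sign_left h pm hpm p hp, hc.sign_right h qm hqm q hq]
  -- The front that is not longer than the other one vanishes, so only the other can have survivors.
  · rcases le_total P.card Q.card with hle | hle
    · refine ⟨Q, hc.right, ?_, Or.inr hQside⟩
      intro t ht htQ s hs he
      have htP := (Finset.mem_union.1 (hRsub t ht)).resolve_right htQ
      have hsP := (hc.left.2 t htP s (hsub hs)).2 ⟨he.1.symm, he.2.symm⟩
      have := (hAP s hsP).1 hs
      omega
    · refine ⟨P, hc.left, ?_, Or.inl hPside⟩
      intro t ht htP s hs he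
      have htQ := (Finset.mem_union.1 (hRsub t ht)).resolve_left htP
      have hsQ := (hc.right.2 t htQ s (hsub hs)).2 ⟨he.1.symm, he.2.symm⟩
      have e1 := (hAQ s hsQ).1 hs
      have := rank_lt hsQ
      omega

end Collision

/-! ### The initial configuration -/

section GridValued

variable {ε : ℝ} {v : ℝ → ℝ}

/-- Each sum in the definition of the variation is a natural multiple of `ε`. The multiples are
bounded, so the supremum is one of them. -/
lemma exists_nat_eVariationOn (hε : 0 < ε) (hgrid : ∀ x, ∃ k : ℤ, v x = k * ε) {s : Set ℝ}
    (hs : s.Nonempty) (hbv : BoundedVariationOn v s) :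
    ∃ k : ℕ, eVariationOn v s = ENNReal.ofReal (k * ε) := by
  have hsum : ∀ p : ℕ × {u : ℕ → ℝ // Monotone u ∧ ∀ i, u i ∈ s}, ∃ k : ℕ,
      ∑ i ∈ Finset.range p.1, edist (v ((p.2 : ℕ → ℝ) (i + 1))) (v ((p.2 : ℕ → ℝ) i)) =
        ENNReal.ofReal (k * ε) := by
    intro p
    choose k hk using hgrid
    refine ⟨∑ i ∈ Finset.range p.1,
      (k ((p.2 : ℕ → ℝ) (i + 1)) - k ((p.2 : ℕ → ℝ) i)).natAbs, ?_⟩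
    push_cast
    rw [Finset.sum_mul, ENNReal.ofReal_sum_of_nonneg fun i _ => by positivity]
    refine Finset.sum_congr rfl fun i _ => ?_
    rw [edist_dist, Real.dist_eq, hk ((p.2 : ℕ → ℝ) (i + 1)), hk ((p.2 : ℕ → ℝ) i), ← sub_mul,
      abs_mul, abs_of_pos hε, Nat.cast_natAbs]
    push_cast
    rfl
  set K : Set ℕ := {k | ∃ p : ℕ × {u : ℕ → ℝ // Monotone u ∧ ∀ i, u i ∈ s},
    ∑ i ∈ Finset.range p.1, edist (v ((p.2 : ℕ → ℝ) (i + 1))) (v ((p.2 : ℕ → ℝ) i)) =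
      ENNReal.ofReal (k * ε)} with hK
  have hKne : K.Nonempty := by
    obtain ⟨x, hx⟩ := hs
    obtain ⟨k, hk⟩ := hsum (0, ⟨fun _ => x, monotone_const, fun _ => hx⟩)
    exact ⟨k, _, hk⟩
  have hKb : BddAbove K := by
    refine ⟨⌊(eVariationOn v s).toReal / ε⌋₊, ?_⟩
    rintro k ⟨p, hp⟩
    refine Nat.le_floor ?_
    rw [le_div_iff₀ hε, ← ENNReal.ofReal_le_iff_le_toReal hbv, ← hp]
    exact le_iSup (fun p : ℕ × {u : ℕ → ℝ // Monotone u ∧ ∀ i, u i ∈ s} =>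
      ∑ i ∈ Finset.range p.1, edist (v ((p.2 : ℕ → ℝ) (i + 1))) (v ((p.2 : ℕ → ℝ) i))) p
  refine ⟨sSup K, le_antisymm (iSup_le fun p => ?_) ?_⟩
  · obtain ⟨k, hk⟩ := hsum p
    rw [hk]
    refine ENNReal.ofReal_le_ofReal (mul_le_mul_of_nonneg_right ?_ hε.le)
    exact_mod_cast le_csSup hKb ⟨p, hk⟩
  · obtain ⟨p, hp⟩ := Nat.sSup_mem hKne hKb
    rw [← hp]
    exact le_iSup (fun p : ℕ × {u : ℕ → ℝ // Monotone u ∧ ∀ i, u i ∈ s} =>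
      ∑ i ∈ Finset.range p.1, edist (v ((p.2 : ℕ → ℝ) (i + 1))) (v ((p.2 : ℕ → ℝ) i))) p

lemma exists_variationFunction_eq (hε : 0 < ε) (hgrid : ∀ x, ∃ k : ℤ, v x = k * ε)
    (hbv : BoundedVariationOn v univ) : ∃ N : ℝ → ℕ, ∀ x, variationFunction v x = N x * ε := by
  have : ∀ x, ∃ k : ℕ, variationFunction v x = k * ε := by
    intro x
    obtain ⟨k, hk⟩ := exists_nat_eVariationOn hε hgrid (nonempty_Iic (a := x))
      (hbv.mono (subset_univ _))
    exact ⟨k, by rw [variationFunction, hk, ENNReal.toReal_ofReal (by positivity)]⟩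
  choose N hN using this
  exact ⟨N, hN⟩

lemma variationFunction_add (hbv : BoundedVariationOn v univ) {x y : ℝ} (hxy : x ≤ y) :
    variationFunction v y = variationFunction v x + (eVariationOn v (Icc x y)).toReal := by
  rw [variationFunction, variationFunction, ← ENNReal.toReal_add (hbv.mono (subset_univ _))
    (hbv.mono (subset_univ _)), ← eVariationOn.union v isGreatest_Iic (isLeast_Icc hxy),
    Iic_union_Icc_eq_Iic hxy]

lemma variationFunction_mono (hbv : BoundedVariationOn v univ) : Monotone (variationFunction v) :=
  fun x y hxy => by
    rw [variationFunction_add hbv hxy]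
    exact le_add_of_nonneg_right ENNReal.toReal_nonneg

lemma abs_sub_le_variationFunction (hbv : BoundedVariationOn v univ) {x y : ℝ} (hxy : x ≤ y) :
    |v y - v x| ≤ variationFunction v y - variationFunction v x := by
  rw [variationFunction_add hbv hxy, add_sub_cancel_left, ← Real.dist_eq]
  exact (hbv.mono (subset_univ _)).dist_le (right_mem_Icc.2 hxy) (left_mem_Icc.2 hxy)

/-- Values closer than `ε` on the grid coincide, so right continuity makes `v` locally constant to
the right. -/
lemma exists_right_constant (hε : 0 < ε) (hgrid : ∀ x, ∃ k : ℤ, v x = k * ε)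
    (hright : ∀ x, ContinuousWithinAt v (Ici x) x) (hbv : BoundedVariationOn v univ) (y : ℝ) :
    ∃ y' > y, ∀ x ∈ Ico y y', variationFunction v x = variationFunction v y := by
  have hev : ∀ᶠ x in nhdsWithin y (Ici y), v x = v y := by
    filter_upwards [(Metric.tendsto_nhds.1 (hright y)) ε hε] with x hx
    obtain ⟨k, hk⟩ := hgrid x
    obtain ⟨l, hl⟩ := hgrid y
    rw [Real.dist_eq, hk, hl, ← sub_mul, abs_mul, abs_of_pos hε] at hx
    have h1 : |(k : ℝ) - l| < 1 := by
      rw [← mul_lt_mul_iff_left₀ hε]; linarith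
    have h2 : |k - l| < 1 := by exact_mod_cast h1
    rw [Int.abs_lt_one_iff, sub_eq_zero] at h2
    rw [hk, hl, h2]
  rw [Filter.Eventually, mem_nhdsGE_iff_exists_Ico_subset] at hev
  obtain ⟨y', hy', hsub⟩ := hev
  refine ⟨y', hy', fun x hx => ?_⟩
  rw [variationFunction_add hbv hx.1, eVariationOn.constant_on, ENNReal.toReal_zero, add_zero]
  rintro _ ⟨a, ha, rfl⟩ _ ⟨b, hb, rfl⟩
  have e1 : v a = v y := hsub ⟨ha.1, ha.2.trans_lt hx.2⟩
  have e2 : v b = v y := hsub ⟨hb.1, hb.2.trans_lt hx.2⟩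
  rw [e1, e2]

/-- The integers `N x`, `x < y`, are bounded by `N y` and attain their maximum at some `y₀`. There
is no variation between `y₀` and `y`, so only a jump at `y` remains. -/
lemma exists_left_constant (hε : 0 < ε) (hbv : BoundedVariationOn v univ) {N : ℝ → ℕ}
    (hN : ∀ x, variationFunction v x = N x * ε) (y : ℝ) :
    ∃ y₀ < y, (∀ x ∈ Ico y₀ y, N x = N y₀ ∧ v x = v y₀) ∧
      |v y - v y₀| = ((N y : ℝ) - N y₀) * ε := by
  have hmono : Monotone N := fun a b hab => by
    have := variationFunction_mono hbv hab
    rw [hN, hN] at this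
    exact_mod_cast le_of_mul_le_mul_right this hε
  have hKb : BddAbove (N '' Iio y) := ⟨N y, by rintro _ ⟨x, hx, rfl⟩; exact hmono (le_of_lt hx)⟩
  obtain ⟨y₀, hy₀, hmax⟩ := Nat.sSup_mem (nonempty_Iio.image N) hKb
  have hconst : ∀ x ∈ Ico y₀ y, N x = N y₀ ∧ v x = v y₀ := by
    intro x hx
    have e1 : N x = N y₀ := le_antisymm (by
      rw [hmax]; exact le_csSup hKb ⟨x, hx.2, rfl⟩) (hmono hx.1)
    refine ⟨e1, ?_⟩
    have := abs_sub_le_variationFunction hbv hx.1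
    rw [hN, hN, e1, sub_self] at this
    exact sub_eq_zero.1 (abs_nonpos_iff.1 this)
  refine ⟨y₀, hy₀, hconst, ?_⟩
  have hy₀y : y₀ ≤ y := le_of_lt hy₀
  -- On `[y₀, y]` the function is constant up to its last point, hence monotone or antitone.
  have hvar : eVariationOn v (Icc y₀ y) ≤ edist (v y₀) (v y) := by
    have key : ∀ w : ℝ → ℝ, MonotoneOn w (Icc y₀ y) →
        eVariationOn w (Icc y₀ y) ≤ ENNReal.ofReal (w y - w y₀) := fun w hw => by
      have := hw.eVariationOn_eq (left_mem_Icc.2 hy₀y) (right_mem_Icc.2 hy₀y)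
      rw [inter_self] at this
      exact this.le
    have hval : ∀ a ∈ Icc y₀ y, a < y → v a = v y₀ := fun a ha hay => (hconst a ⟨ha.1, hay⟩).2
    rcases le_total (v y₀) (v y) with hle | hle
    · refine (key v fun a ha b hb hab => ?_).trans_eq ?_
      · rcases hb.2.lt_or_eq with h1 | h1
        · rw [hval b hb h1, hval a ha (hab.trans_lt h1)]
        · rcases ha.2.lt_or_eq with h2 | h2
          · rw [hval a ha h2, h1]; exact hle
          · rw [h1, h2]
      · rw [edist_comm, edist_dist, Real.dist_eq, abs_of_nonneg (sub_nonneg.2 hle)]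
    · have hneg : eVariationOn v (Icc y₀ y) = eVariationOn (fun x => -v x) (Icc y₀ y) := by
        simp only [eVariationOn, edist_neg_neg]
      rw [hneg]
      refine (key (fun x => -v x) fun a ha b hb hab => ?_).trans_eq ?_
      · simp only [neg_le_neg_iff]
        rcases hb.2.lt_or_eq with h1 | h1
        · rw [hval b hb h1, hval a ha (hab.trans_lt h1)]
        · rcases ha.2.lt_or_eq with h2 | h2
          · rw [hval a ha h2, h1]; exact hle
          · rw [h1, h2]
      · rw [edist_dist, Real.dist_eq, abs_of_nonneg (sub_nonneg.2 hle)]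
        congr 1; ring
  have hle : variationFunction v y - variationFunction v y₀ ≤ |v y - v y₀| := by
    rw [variationFunction_add hbv hy₀y, add_sub_cancel_left]
    refine (ENNReal.toReal_mono (edist_ne_top _ _) hvar).trans_eq ?_
    rw [edist_dist, ENNReal.toReal_ofReal dist_nonneg, dist_comm, Real.dist_eq]
  have hge := abs_sub_le_variationFunction hbv hy₀y
  rw [hN, hN] at hle hge
  linarith

lemma leftLim_eq_of_Ico {w : ℝ → ℝ} {y₀ y c : ℝ} (hy : y₀ < y) (h : ∀ x ∈ Ico y₀ y, w x = c) :
    leftLim w y = c :=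
  leftLim_eq_of_eventually <| by
    filter_upwards [Ioo_mem_nhdsLT hy] with x hx
    exact h x ⟨hx.1.le, hx.2⟩

lemma exists_support_bounds (hsupp : HasCompactSupport v) :
    ∃ a b : ℝ, (∀ x ≤ a, v x = 0) ∧ ∀ x, b ≤ x → v x = 0 := by
  obtain ⟨R, hR⟩ := hsupp.isCompact.isBounded.subset_closedBall (0 : ℝ)
  have hout : ∀ x, R < |x| → v x = 0 := by
    intro x hx
    refine image_eq_zero_of_notMem_tsupport fun h => ?_
    have := hR h
    rw [Metric.mem_closedBall, dist_zero_right, Real.norm_eq_abs] at this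
    linarith
  refine ⟨-(|R| + 1), |R| + 1, fun x hx => hout x ?_, fun x hx => hout x ?_⟩
  · have := neg_abs_le x
    have := le_abs_self R
    linarith
  · have := le_abs_self x
    have := le_abs_self R
    linarith

lemma sign_mul_abs_self (x : ℝ) : Real.sign x * |x| = x := by
  rcases lt_trichotomy x 0 with h | h | h
  · rw [Real.sign_of_neg h, abs_of_neg h]; ring
  · simp [h]
  · rw [Real.sign_of_pos h, abs_of_pos h, one_mul]

/-- The waves of the initial datum form a configuration whose profile is the initial datum. -/
theorem exists_initial_config (hε : 0 < ε) (hgrid : ∀ x, ∃ k : ℤ, v x = k * ε)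
    (hright : ∀ x, ContinuousWithinAt v (Ici x) x) (hsupp : HasCompactSupport v)
    (hbv : BoundedVariationOn v univ) :
    ∃ S r : ℕ → ℤ, IsConfig (waveSet ε v) (initialPosition ε v) S r ∧
      v = stepFun ε (waveSet ε v) (initialPosition ε v) S ∧
      ∀ s ∈ waveSet ε v, waveSign ε v s = S s ∧ rightState ε v s = r s * ε := by
  obtain ⟨N, hN⟩ := exists_variationFunction_eq hε hgrid hbv
  obtain ⟨a, b, ha, hb⟩ := exists_support_bounds hsupp
  have hmono : Monotone N := fun x y hxy => by
    have := variationFunction_mono hbv hxy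
    rw [hN, hN] at this
    exact_mod_cast le_of_mul_le_mul_right this hε
  have hNa : N a = 0 := by
    have : variationFunction v a = 0 := by
      rw [variationFunction, eVariationOn.constant_on, ENNReal.toReal_zero]
      rintro _ ⟨x, hx, rfl⟩ _ ⟨y, hy, rfl⟩
      rw [ha x hx, ha y hy]
    rw [hN] at this
    exact_mod_cast (mul_eq_zero.1 this).resolve_right hε.ne'
  have hNb : (eVariationOn v univ).toReal = N b * ε := by
    rw [← hN, variationFunction, ← Iic_union_Ici (a := b),
      eVariationOn.union v isGreatest_Iic isLeast_Ici,
      eVariationOn.constant_on (s := Ici b), add_zero]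
    rintro _ ⟨x, hx, rfl⟩ _ ⟨y, hy, rfl⟩
    rw [hb x hx, hb y hy]
  have hset : waveSet ε v = Finset.Icc 1 (N b) := by
    rw [waveSet, hNb, mul_div_cancel_right₀ _ hε.ne', Nat.floor_natCast]
  have hNle : ∀ x, N x ≤ N b := by
    intro x
    have : variationFunction v x ≤ N b * ε := by
      rw [← hNb]
      exact ENNReal.toReal_mono hbv (eVariationOn.mono v (subset_univ _))
    rw [hN] at this
    exact_mod_cast le_of_mul_le_mul_right this hε
  have hpos : ∀ s, initialPosition ε v s = sInf {x | s ≤ N x} := by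
    intro s
    rw [initialPosition]
    congr 1
    ext x
    rw [mem_ofPred_eq, mem_ofPred_eq, hN, mul_comm, mul_le_mul_iff_left₀ hε, Nat.cast_le]
  -- The infimum is attained because `N` is constant on a right neighbourhood. This equivalence
  -- replaces the definition of the initial positions from here on.
  have hX : ∀ s ∈ Finset.Icc 1 (N b), ∀ x, initialPosition ε v s ≤ x ↔ s ≤ N x := by
    intro s hs x
    rw [Finset.mem_Icc] at hs
    have hne : {x | s ≤ N x}.Nonempty := ⟨b, hs.2⟩
    have hbdd : BddBelow {x | s ≤ N x} := by
      refine ⟨a, fun y hy => ?_⟩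
      by_contra hcon
      have h1 := hmono (not_le.1 hcon).le
      have h2 : s ≤ N y := hy
      omega
    rw [hpos]
    constructor
    · intro h
      refine le_trans ?_ (hmono h)
      obtain ⟨y', hy', hc⟩ := exists_right_constant hε hgrid hright hbv (sInf {x | s ≤ N x})
      obtain ⟨z, hz, hzy⟩ := exists_lt_of_csInf_lt hne hy'
      have := hc z ⟨csInf_le hbdd hz, hzy⟩
      rw [hN, hN] at this
      have e : N z = N (sInf {x | s ≤ N x}) := by exact_mod_cast mul_right_cancel₀ hε.ne' this
      rw [← e]
      exact hz
    · intro h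
      exact csInf_le hbdd h
  -- the structure of a jump
  have hjump : ∀ s ∈ Finset.Icc 1 (N b), ∃ m : ℕ, m < s ∧ s ≤ N (initialPosition ε v s) ∧
      leftLim (variationFunction v) (initialPosition ε v s) = m * ε ∧
      (∃ y₀, N y₀ = m ∧ v y₀ = leftLim v (initialPosition ε v s)) ∧
      |v (initialPosition ε v s) - leftLim v (initialPosition ε v s)| =
        ((N (initialPosition ε v s) : ℝ) - m) * ε ∧
      ∀ t ∈ Finset.Icc 1 (N b), initialPosition ε v t = initialPosition ε v s ↔
        m < t ∧ t ≤ N (initialPosition ε v s) := by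
    intro s hs
    obtain ⟨y₀, hy₀, hc, habs⟩ := exists_left_constant hε hbv hN (initialPosition ε v s)
    have hl1 : leftLim v (initialPosition ε v s) = v y₀ :=
      leftLim_eq_of_Ico hy₀ fun x hx => (hc x hx).2
    have hl2 : leftLim (variationFunction v) (initialPosition ε v s) = N y₀ * ε :=
      leftLim_eq_of_Ico hy₀ fun x hx => by rw [hN, (hc x hx).1]
    refine ⟨N y₀, ?_, (hX s hs _).1 le_rfl, hl2, ⟨y₀, rfl, hl1.symm⟩, by rw [hl1, habs], ?_⟩
    · by_contra hcon
      have := (hX s hs y₀).2 (by omega)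
      linarith
    · intro t ht
      constructor
      · intro he
        refine ⟨?_, (hX t ht _).1 he.le⟩
        by_contra hcon
        have := (hX t ht y₀).2 (by omega)
        linarith
      · rintro ⟨h1, h2⟩
        refine le_antisymm ((hX t ht _).2 h2) ?_
        by_contra hcon
        push Not at hcon
        rcases le_total y₀ (initialPosition ε v t) with h3 | h3
        · have e1 := (hc _ ⟨h3, hcon⟩).1
          have e2 := (hX t ht _).1 le_rfl
          omega
        · have := (hX t ht y₀).1 h3
          omega
  have hsign : ∀ s ∈ Finset.Icc 1 (N b), waveSign ε v s = 1 ∨ waveSign ε v s = -1 := by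
    intro s hs
    obtain ⟨m, hm, hsN, -, -, habs, -⟩ := hjump s hs
    have h0 : v (initialPosition ε v s) - leftLim v (initialPosition ε v s) ≠ 0 := by
      rw [← abs_pos, habs]
      have : (m : ℝ) < N (initialPosition ε v s) := by exact_mod_cast hm.trans_le hsN
      exact mul_pos (sub_pos.2 this) hε
    rcases h0.lt_or_gt with h1 | h1
    · exact Or.inr (Real.sign_of_neg h1)
    · exact Or.inl (Real.sign_of_pos h1)
  -- On the wave set the sign is `1` or `-1`; elsewhere the default value `-1` plays no role.
  set S : ℕ → ℤ := fun s => if waveSign ε v s = 1 then 1 else -1 with hS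
  have hSeq : ∀ s ∈ Finset.Icc 1 (N b), waveSign ε v s = S s := by
    intro s hs
    simp only [hS]
    rcases hsign s hs with h1 | h1
    · rw [h1]; norm_num
    · rw [h1]; norm_num
  have hSame : ∀ s t, initialPosition ε v s = initialPosition ε v t → S s = S t := by
    intro s t he
    have : waveSign ε v s = waveSign ε v t := by simp only [waveSign, he]
    simp only [hS, this]
  -- Induction over jumps rather than waves: from the value `m` of `N` one goes back to the value
  -- `m₀` before the jump that carries wave `m`. All waves in `(m₀, m]` lie at that jump and share
  -- its sign.
  have hval : ∀ m x, N x = m → v x = ((∑ t ∈ Finset.Icc 1 m, S t : ℤ) : ℝ) * ε := by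
    intro m
    induction m using Nat.strong_induction_on with
    | _ m ih =>
      intro x hx
      rcases Nat.eq_zero_or_pos m with h0 | h0
      · subst h0
        have hmin : v (min a x) = 0 := ha _ (min_le_left _ _)
        have := abs_sub_le_variationFunction hbv (min_le_right a x)
        rw [hN, hN, hx, hmin] at this
        have h3 : N (min a x) = 0 := by
          have := hmono (min_le_left a x)
          omega
        rw [h3] at this
        simp only [Nat.cast_zero, zero_mul, sub_zero] at this
        rw [abs_nonpos_iff.1 this]
        simp
      · have hs : m ∈ Finset.Icc 1 (N b) := Finset.mem_Icc.2 ⟨h0, hx ▸ hNle x⟩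
        obtain ⟨m₀, hm₀, hsN, -, ⟨y₀, hy₀, hvy₀⟩, habs, hblock⟩ := hjump m hs
        have hle : initialPosition ε v m ≤ x := (hX m hs x).2 hx.ge
        have hNm : N (initialPosition ε v m) = m := le_antisymm ((hmono hle).trans hx.le) hsN
        have hvx : v x = v (initialPosition ε v m) := by
          have := abs_sub_le_variationFunction hbv hle
          rw [hN, hN, hx, hNm, sub_self] at this
          exact sub_eq_zero.1 (abs_nonpos_iff.1 this)
        have hjmp : v (initialPosition ε v m) - leftLim v (initialPosition ε v m) =
            S m * (((m : ℝ) - m₀) * ε) := by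
          rw [hNm] at habs
          rw [← hSeq m hs, ← habs, waveSign, sign_mul_abs_self]
        have hsplit : ∑ t ∈ Finset.Icc 1 m, S t =
            ∑ t ∈ Finset.Icc 1 m₀, S t + S m * ((m : ℤ) - m₀) := by
          have e : Finset.Icc 1 m = Finset.Icc 1 m₀ ∪ Finset.Ioc m₀ m := by
            ext t; simp only [Finset.mem_Icc, Finset.mem_union, Finset.mem_Ioc]; omega
          rw [e, Finset.sum_union]
          · congr 1
            rw [Finset.sum_congr rfl fun t ht => hSame t m ?_, Finset.sum_const, Nat.card_Ioc,
              nsmul_eq_mul, mul_comm]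
            · rw [Nat.cast_sub hm₀.le]
            · rw [Finset.mem_Ioc] at ht
              rw [Finset.mem_Icc] at hs
              exact (hblock t (Finset.mem_Icc.2 ⟨by omega, by omega⟩)).2 (by omega)
          · rw [Finset.disjoint_left]
            intro t ht ht'
            rw [Finset.mem_Icc] at ht
            rw [Finset.mem_Ioc] at ht'
            omega
        rw [hvx, hsplit]
        have := ih m₀ hm₀ y₀ hy₀
        rw [hvy₀] at this
        push_cast at this ⊢
        linarith
  rw [hset]
  have hfilter : ∀ x, {s ∈ Finset.Icc 1 (N b) | initialPosition ε v s ≤ x} =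
      Finset.Icc 1 (N x) := by
    intro x
    ext s
    rw [Finset.mem_filter]
    constructor
    · rintro ⟨h1, h2⟩
      exact Finset.mem_Icc.2 ⟨(Finset.mem_Icc.1 h1).1, (hX s h1 x).1 h2⟩
    · intro h1
      rw [Finset.mem_Icc] at h1
      have h2 : s ∈ Finset.Icc 1 (N b) := Finset.mem_Icc.2 ⟨h1.1, h1.2.trans (hNle x)⟩
      exact ⟨h2, (hX s h2 x).2 h1.2⟩
  refine ⟨S, fun s => ∑ t ∈ Finset.Icc 1 (N b) with t ≤ s, S t, ⟨?_, ?_, ?_, fun s _ => rfl⟩, ?_,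
    ?_⟩
  · intro s hs t ht hst
    exact (hX s hs _).2 (hst.trans ((hX t ht _).1 le_rfl))
  · intro s _
    simp only [hS]
    split_ifs <;> simp
  · intro s _ t _ he
    exact hSame s t he
  · funext x
    rw [stepFun, hfilter]
    exact hval _ x rfl
  · intro s hs
    refine ⟨hSeq s hs, ?_⟩
    obtain ⟨m, hm, hsN, hU, ⟨y₀, hy₀, hvy₀⟩, habs, hblock⟩ := hjump s hs
    have hsplit : ∑ t ∈ Finset.Icc 1 (N b) with t ≤ s, S t =
        ∑ t ∈ Finset.Icc 1 m, S t + S s * ((s : ℤ) - m) := by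
      rw [Finset.mem_Icc] at hs
      have e : {t ∈ Finset.Icc 1 (N b) | t ≤ s} = Finset.Icc 1 m ∪ Finset.Ioc m s := by
        ext t
        simp only [Finset.mem_filter, Finset.mem_Icc, Finset.mem_union, Finset.mem_Ioc]
        omega
      rw [e, Finset.sum_union]
      · congr 1
        rw [Finset.sum_congr rfl fun t ht => hSame t s ?_, Finset.sum_const, Nat.card_Ioc,
          nsmul_eq_mul, mul_comm]
        · rw [Nat.cast_sub hm.le]
        · rw [Finset.mem_Ioc] at ht
          exact (hblock t (Finset.mem_Icc.2 ⟨by omega, by omega⟩)).2 (by omega)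
      · rw [Finset.disjoint_left]
        intro t ht ht'
        rw [Finset.mem_Icc] at ht
        rw [Finset.mem_Ioc] at ht'
        omega
    simp only
    rw [rightState, hU, ← hvy₀, hval m y₀ hy₀, hsplit, hSeq s hs]
    push_cast
    ring

end GridValued

/-! ### The functionals that decrease at a collision -/

open Classical in
/-- The number of the pairs of waves in `A` that have not interacted. -/
noncomputable def nonInteracted (A : Finset ℕ) (I : ℕ → ℕ → Prop) : ℕ :=
  {x ∈ A ×ˢ A | x.1 < x.2 ∧ ¬ I x.1 x.2}.card

open Classical in
/-- The number of the pairs of waves in `A` that belong to different wavefronts. -/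
noncomputable def separatedPairs (A : Finset ℕ) (X σ : ℕ → ℝ) : ℕ :=
  {x ∈ A ×ˢ A | ¬ (X x.1 = X x.2 ∧ σ x.1 = σ x.2)}.card

/-- Only ordered pairs are counted, and swapping the entries gives equally many pairs in the other
order. -/
lemma two_mul_nonInteracted_le (A : Finset ℕ) (I : ℕ → ℕ → Prop) :
    2 * nonInteracted A I ≤ A.card ^ 2 := by
  classical
  have h1 : nonInteracted A I ≤ {x ∈ A ×ˢ A | x.1 < x.2}.card :=
    Finset.card_le_card fun x hx => by
      simp only [Finset.mem_filter] at hx ⊢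
      exact ⟨hx.1, hx.2.1⟩
  have h2 : {x ∈ A ×ˢ A | x.1 < x.2}.card = {x ∈ A ×ˢ A | x.2 < x.1}.card := by
    refine Finset.card_bij (fun x _ => x.swap) ?_ ?_ ?_
    · intro x hx
      simp only [Finset.mem_filter, Finset.mem_product, Prod.fst_swap, Prod.snd_swap] at hx ⊢
      exact ⟨⟨hx.1.2, hx.1.1⟩, hx.2⟩
    · intro x _ y _ he
      exact Prod.swap_injective he
    · intro x hx
      simp only [Finset.mem_filter, Finset.mem_product] at hx
      exact ⟨x.swap, by simp [hx], by simp⟩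
  have h3 : {x ∈ A ×ˢ A | x.1 < x.2}.card + {x ∈ A ×ˢ A | x.2 < x.1}.card ≤ A.card ^ 2 := by
    rw [← Finset.card_union_of_disjoint, sq, ← Finset.card_product]
    · exact Finset.card_le_card (Finset.union_subset (Finset.filter_subset _ _)
        (Finset.filter_subset _ _))
    · rw [Finset.disjoint_left]
      intro x hx hx'
      have e1 := (Finset.mem_filter.1 hx).2
      have e2 := (Finset.mem_filter.1 hx').2
      omega
  omega

lemma separatedPairs_le (A : Finset ℕ) (X σ : ℕ → ℝ) : separatedPairs A X σ ≤ A.card ^ 2 := by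
  rw [sq, ← Finset.card_product]
  exact Finset.card_le_card (Finset.filter_subset _ _)

section Step

variable {ε : ℝ} {A A' : Finset ℕ} {X X' d σ σ' : ℕ → ℝ} {S r : ℕ → ℤ} {I : ℕ → ℕ → Prop}
  {P Q : Finset ℕ} {K : ℝ}

lemma nonInteracted_mono {I' : ℕ → ℕ → Prop} (hsub : A' ⊆ A) (hI : ∀ s t, I s t → I' s t) :
    nonInteracted A' I' ≤ nonInteracted A I :=
  Finset.card_le_card fun x hx => by
    simp only [Finset.mem_filter, Finset.mem_product] at hx ⊢
    exact ⟨⟨hsub hx.1.1, hsub hx.1.2⟩, hx.2.1, fun h => hx.2.2 (hI _ _ h)⟩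

lemma IsInteraction.next (hI : IsInteraction A X S I) (hsub : A' ⊆ A) (h' : IsConfig A' X' S r) :
    IsInteraction A' X' S (fun s t => I s t ∨ X' s = X' t) := by
  refine ⟨fun s _ t _ he => Or.inr he, ?_, ?_⟩
  · rintro s hs u hu t ht hsu hut (h | h)
    · have := hI.between s (hsub hs) u (hsub hu) t (hsub ht) hsu hut h
      exact ⟨Or.inl this.1, Or.inl this.2⟩
    · have e1 := h'.mono s hs u hu hsu
      have e2 := h'.mono u hu t ht hut
      exact ⟨Or.inr (by linarith), Or.inr (by linarith)⟩
  · rintro s hs t ht (h | h)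
    · exact hI.sign s (hsub hs) t (hsub ht) h
    · exact h'.same s hs t ht h

/-- The effect of a collision of two wavefronts of the same sign. -/
lemma IsCollision.merge_step (hc : IsCollision A X σ X' P Q) (h : IsConfig A X S r)
    (hb : BlockSpeeds A X d σ) (hb' : BlockSpeeds A X' d σ') (hI : IsInteraction A X S I)
    (hT : Tangency A X d σ I) (hK : 0 ≤ K) (hd : LipschitzAlong A S d K) {p q : ℕ} (hp : p ∈ P)
    (hq : q ∈ Q) (hpq : S p = S q) :
    Tangency A X' d σ' (fun s t => I s t ∨ X' s = X' t) ∧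
    (σ p - σ q) * (P.card * Q.card) / (P.card + Q.card) ≤
      2 * K * (nonInteracted A I - nonInteracted A (fun s t => I s t ∨ X' s = X' t)) ∧
    ∑ s ∈ A, |σ' s - σ s| ≤
      4 * K * (nonInteracted A I - nonInteracted A (fun s t => I s t ∨ X' s = X' t)) ∧
    separatedPairs A X' σ' < separatedPairs A X σ := by
  classical
  have hlt := hc.lt h
  have hPQ : ∀ s ∈ P ∪ Q, S s = S p := by
    intro s hs
    rcases Finset.mem_union.1 hs with h1 | h1
    · exact hc.sign_left h s h1 p hp
    · rw [hpq]; exact hc.sign_right h s h1 q hq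
  obtain ⟨hblock, hsum⟩ := sum_abs_speed_sub_of_merge hb hb' hc.left hc.right hlt hc.meet hp hq
    (hc.speed_lt p hp q hq).le
  have hfront : ∀ s ∈ A, ∀ t ∈ A, X s = X t → σ s = σ t → X' s = X' t := fun s hs t ht h1 h2 =>
    (hc.meet s hs t ht).2 (Or.inl ⟨h1, h2⟩)
  have hpos : (0 : ℝ) < P.card + Q.card := by
    have : 0 < P.card := Finset.card_pos.2 ⟨p, hp⟩
    positivity
  -- After the merge every pair in `P × Q` shares a position, so those that had not interacted leave
  -- the count.
  have hN : ({x ∈ P ×ˢ Q | ¬ I x.1 x.2}.card : ℝ) ≤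
      nonInteracted A I - nonInteracted A (fun s t => I s t ∨ X' s = X' t) := by
    rw [le_sub_iff_add_le]
    rw [nonInteracted, nonInteracted, ← Nat.cast_add, ← Finset.card_union_of_disjoint]
    · refine Nat.cast_le.2 (Finset.card_le_card fun x hx => ?_)
      simp only [Finset.mem_union, Finset.mem_filter, Finset.mem_product] at hx ⊢
      rcases hx with hx | hx
      · exact ⟨⟨hc.left.1 hx.1.1, hc.right.1 hx.1.2⟩, hlt _ hx.1.1 _ hx.1.2, hx.2⟩
      · exact ⟨hx.1, hx.2.1, fun h => hx.2.2 (Or.inl h)⟩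
    · rw [Finset.disjoint_left]
      intro x hx hx'
      simp only [Finset.mem_filter, Finset.mem_product] at hx hx'
      refine hx'.2.2 (Or.inr ?_)
      exact (hc.meet _ hx'.1.1 _ hx'.1.2).2 (Or.inr
        ⟨Finset.mem_union_left _ hx.1.1, Finset.mem_union_right _ hx.1.2⟩)
  have key := speed_sub_mul_le h.mono hb hI hT hK hd hc.left hc.right hlt hc.convex
    (fun s hs t ht => by rw [hPQ s hs, hPQ t ht]) hp hq
  have key2 : (σ p - σ q) * (P.card * Q.card) / (P.card + Q.card) ≤
      2 * K * (nonInteracted A I - nonInteracted A (fun s t => I s t ∨ X' s = X' t)) := by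
    rw [div_le_iff₀ hpos]
    refine key.trans (mul_le_mul_of_nonneg_right (mul_le_mul_of_nonneg_left ?_ (by positivity))
      hpos.le)
    convert hN
  refine ⟨hT.of_merge hfront hblock, key2, ?_, ?_⟩
  · rw [hsum]
    linarith
  -- Fronts persist, and the pair `(p, q)` is no longer separated.
  · refine Finset.card_lt_card ?_
    rw [Finset.ssubset_iff_of_subset]
    · refine ⟨(p, q), ?_, ?_⟩
      · simp only [Finset.mem_filter, Finset.mem_product]
        exact ⟨⟨hc.left.1 hp, hc.right.1 hq⟩, fun h => (hc.position_lt p hp q hq).ne h.1⟩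
      · simp only [Finset.mem_filter, Finset.mem_product, not_and]
        intro _
        have := (hc.meet p (hc.left.1 hp) q (hc.right.1 hq)).2 (Or.inr
          ⟨Finset.mem_union_left _ hp, Finset.mem_union_right _ hq⟩)
        exact fun h => h this (hblock p (hc.left.1 hp) q (hc.right.1 hq) this)
    · intro x hx
      simp only [Finset.mem_filter, Finset.mem_product] at hx ⊢
      refine ⟨hx.1, fun h => hx.2 ?_⟩
      have := hfront _ hx.1.1 _ hx.1.2 h.1 h.2
      exact ⟨this, hblock _ hx.1.1 _ hx.1.2 this⟩

/-- The effect of a cancellation. -/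
lemma IsCancellation.cancel_step (hc : IsCancellation ε A X σ X' S r A') (h : IsConfig A X S r)
    (hb : BlockSpeeds A X d σ) (hb' : BlockSpeeds A' X' d σ') (hI : IsInteraction A X S I)
    (hT : Tangency A X d σ I) (hK : 0 ≤ K) (hd : LipschitzAlong A S d K) :
    Tangency A' X' d σ' (fun s t => I s t ∨ X' s = X' t) ∧
    ∑ s ∈ A', |σ' s - σ s| ≤ K * A.card * (A.card - A'.card) ∧ A'.card < A.card := by
  obtain ⟨F, hF, hother, hside⟩ := hc.survivor
  have hFS : ∀ s ∈ F, ∀ t ∈ F, S s = S t := fun s hs t ht =>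
    h.same s (hF.1 hs) t (hF.1 ht) (hF.eq ht hs).1
  refine ⟨hT.of_cancellation hb hb' h.mono hc.config.mono hI hc.subset hc.front hc.side hc.sign,
    ?_, ?_⟩
  · have := sum_abs_speed_sub_of_cancellation hb hb' hc.subset hc.front hF hother hside hK
      fun s hs t ht => (le_abs_self _).trans
        (hd.abs_sub_le hK hF.1 (hF.convex h.mono hb) hFS hs ht)
    rwa [Finset.card_sdiff_of_subset hc.subset,
      Nat.cast_sub (Finset.card_le_card hc.subset)] at this
  · obtain ⟨v, hv, -⟩ := hc.sign
    exact Finset.card_lt_card ((Finset.ssubset_iff_of_subset hc.subset).2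
      ⟨v, (Finset.mem_sdiff.1 hv).1, (Finset.mem_sdiff.1 hv).2⟩)

end Step

/-! ### The slopes of the flux on the cells -/

/-- The mean value inequality is used twice: for `deriv f` over a step `ε`, then for `z ↦ f (z + ε)
- f z`. -/
lemma abs_second_difference_le {f : ℝ → ℝ} (hf : ContDiff ℝ 2 f) {L : ℝ}
    (hL : ∀ u, |deriv (deriv f) u| ≤ L) (ε x y : ℝ) :
    |(f (y + ε) - f y) - (f (x + ε) - f x)| ≤ L * |ε| * |y - x| := by
  have hf1 : Differentiable ℝ f := hf.differentiable (by norm_num)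
  have hf2 : Differentiable ℝ (deriv f) := by
    have : ContDiff ℝ 1 (deriv f) := hf.deriv'
    exact this.differentiable (by norm_num)
  have h1 : ∀ a b, |deriv f b - deriv f a| ≤ L * |b - a| := fun a b => by
    have := convex_univ.norm_image_sub_le_of_norm_deriv_le (f := deriv f) (C := L)
      (fun z _ => hf2 z) (fun z _ => hL z) (mem_univ a) (mem_univ b)
    simpa [Real.norm_eq_abs] using this
  have h2 : ∀ z, HasDerivAt (fun z => f (z + ε) - f z) (deriv f (z + ε) - deriv f z) z := fun z =>
    ((hf1 (z + ε)).hasDerivAt.comp_add_const z ε).sub (hf1 z).hasDerivAt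
  have := convex_univ.norm_image_sub_le_of_norm_deriv_le (f := fun z => f (z + ε) - f z)
    (C := L * |ε|) (fun z _ => (h2 z).differentiableAt) (fun z _ => by
      rw [(h2 z).deriv, Real.norm_eq_abs]
      simpa using h1 z (z + ε)) (mem_univ x) (mem_univ y)
  simpa [Real.norm_eq_abs] using this

lemma IsConfig.lipschitzAlong {f : ℝ → ℝ} (hf : ContDiff ℝ 2 f) {L : ℝ}
    (hL : ∀ u, |deriv (deriv f) u| ≤ L) {ε : ℝ} (hε : 0 < ε) {A : Finset ℕ} {X : ℕ → ℝ}
    {S r : ℕ → ℤ} (h : IsConfig A X S r) :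
    LipschitzAlong A S (cellSlope f ε S r) (L * ε) := by
  intro s hs t ht hst hS
  have hL0 : 0 ≤ L := (abs_nonneg _).trans (hL 0)
  have hr : r t - r s = S s * ({u ∈ A | s < u ∧ u ≤ t}.card : ℤ) := by
    have : ∑ u ∈ A with s < u ∧ u ≤ t, S u = S s * ({u ∈ A | s < u ∧ u ≤ t}.card : ℤ) := by
      rw [Finset.sum_congr rfl fun u hu => hS u (Finset.mem_filter.1 hu).1
        (Finset.mem_filter.1 hu).2.1.le (Finset.mem_filter.1 hu).2.2, Finset.sum_const,
        nsmul_eq_mul, mul_comm]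
    rw [← this, h.right t ht, h.right s hs, sub_eq_iff_eq_add']
    simp only [Finset.sum_filter, ← Finset.sum_add_distrib]
    refine Finset.sum_congr rfl fun u _ => ?_
    by_cases h1 : u ≤ s
    · have : u ≤ t := h1.trans hst
      simp [h1, this, not_lt.2 h1]
    · simp [h1, not_le.1 h1]
  have hSt := hS t ht hst le_rfl
  set m : ℕ := {u ∈ A | s < u ∧ u ≤ t}.card with hm
  -- The left state is the right state minus `e`, with `e = ε` for positive waves and `e = -ε` for
  -- negative ones.
  have key : ∀ e : ℝ, |e| = ε →
      |(f (r t * ε) - f (r t * ε - e)) - (f (r s * ε) - f (r s * ε - e))| ≤ L * ε * (ε * m) := by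
    intro e he
    have h1 := abs_second_difference_le hf hL (-e) (r s * ε) (r t * ε)
    rw [abs_neg, he, ← sub_mul, abs_mul, abs_of_pos hε] at h1
    have h2 : |(r t : ℝ) - r s| = m := by
      have : (r t : ℝ) - r s = S s * m := by exact_mod_cast hr
      rw [this, abs_mul]
      rcases h.sign s hs with h3 | h3 <;> rw [h3] <;> simp
    rw [h2] at h1
    simp only [← sub_eq_add_neg] at h1
    refine le_trans (le_of_eq ?_) (h1.trans_eq (by ring))
    rw [← abs_neg]
    congr 1
    ring
  have hε' : L * ε * (m : ℝ) = L * ε * (ε * m) / ε := by field_simp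
  rw [hε']
  rcases h.sign s hs with h3 | h3
  · rw [cellSlope, cellSlope, hSt, h3, div_sub_div_same, abs_div, abs_of_pos hε]
    refine div_le_div_of_nonneg_right ?_ hε.le
    rw [abs_sub_comm]
    have := key ε (abs_of_pos hε)
    push_cast
    simpa [sub_mul] using this
  · rw [cellSlope, cellSlope, hSt, h3, div_sub_div_same, abs_div, abs_of_pos hε]
    refine div_le_div_of_nonneg_right ?_ hε.le
    have := key (-ε) (by rw [abs_neg, abs_of_pos hε])
    push_cast
    simp only [sub_neg_eq_add, add_mul, neg_mul, one_mul]
    refine le_trans (le_of_eq (congrArg _ ?_)) this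
    rw [sub_neg_eq_add, sub_neg_eq_add]
    ring

/-! ### The waves at the interaction-cancellation times -/

section Stage

open Classical in
/-- The waves that have not been removed at the time `t_j`. -/
noncomputable def aliveSet (f : ℝ → ℝ) (ε : ℝ) (v₀ : ℝ → ℝ) (j : ℕ) : Finset ℕ :=
  {s ∈ waveSet ε v₀ | collisionPosition f ε v₀ j s ≠ ⊤}

/-- The position of the wave `s` with right state `r s` at the time `t_j`, ignoring removals. -/
noncomputable def flow (f : ℝ → ℝ) (ε : ℝ) (v₀ : ℝ → ℝ) (r : ℕ → ℤ) : ℕ → ℕ → ℝ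
  | 0 => initialPosition ε v₀
  | j + 1 => fun s => flow f ε v₀ r j s + firstMeeting f ε (profile f ε v₀ j) *
      riemannSpeed f ε (leftLim (profile f ε v₀ j) (flow f ε v₀ r j s))
        (profile f ε v₀ j (flow f ε v₀ r j s)) (r s * ε)

/-- The waves `s` and `t` have been at the same position at one of the times `t_0, …, t_j`. -/
def Interacted (f : ℝ → ℝ) (ε : ℝ) (v₀ : ℝ → ℝ) (r : ℕ → ℤ) : ℕ → ℕ → ℕ → Prop
  | 0 => fun s t => flow f ε v₀ r 0 s = flow f ε v₀ r 0 t
  | j + 1 => fun s t =>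
      Interacted f ε v₀ r j s t ∨ flow f ε v₀ r (j + 1) s = flow f ε v₀ r (j + 1) t

/-- The speed of the wave `s` at the time `t_j`. -/
noncomputable def flowSpeed (f : ℝ → ℝ) (ε : ℝ) (v₀ : ℝ → ℝ) (S r : ℕ → ℤ) (j : ℕ) : ℕ → ℝ :=
  configSpeed f ε (aliveSet f ε v₀ j) (flow f ε v₀ r j) S r

/-- The signs `S` and the right states `r` describe the waves of the initial datum `v₀`. -/
structure IsEnumeration (ε : ℝ) (v₀ : ℝ → ℝ) (S r : ℕ → ℤ) : Prop where
  config : IsConfig (waveSet ε v₀) (initialPosition ε v₀) S r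
  eq_stepFun : v₀ = stepFun ε (waveSet ε v₀) (initialPosition ε v₀) S
  sign : ∀ s ∈ waveSet ε v₀, waveSign ε v₀ s = S s
  right : ∀ s ∈ waveSet ε v₀, rightState ε v₀ s = r s * ε

/-- The properties of the waves at the time `t_j`. -/
structure IsStage (f : ℝ → ℝ) (ε : ℝ) (v₀ : ℝ → ℝ) (S r : ℕ → ℤ) (j : ℕ) : Prop where
  config : IsConfig (aliveSet f ε v₀ j) (flow f ε v₀ r j) S r
  profile_eq : profile f ε v₀ j = stepFun ε (aliveSet f ε v₀ j) (flow f ε v₀ r j) S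
  interaction : IsInteraction (aliveSet f ε v₀ j) (flow f ε v₀ r j) S (Interacted f ε v₀ r j)
  tangency : Tangency (aliveSet f ε v₀ j) (flow f ε v₀ r j) (cellSlope f ε S r)
    (flowSpeed f ε v₀ S r j) (Interacted f ε v₀ r j)
  position : ∀ s ∈ aliveSet f ε v₀ j, collisionPosition f ε v₀ j s = (flow f ε v₀ r j s : ℝ)

variable {f : ℝ → ℝ} {ε : ℝ} {v₀ : ℝ → ℝ} {S r : ℕ → ℤ} {j : ℕ} {P Q : Finset ℕ}

lemma mem_aliveSet {s : ℕ} :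
    s ∈ aliveSet f ε v₀ j ↔ s ∈ waveSet ε v₀ ∧ collisionPosition f ε v₀ j s ≠ ⊤ := by
  simp [aliveSet]

lemma aliveSet_zero : aliveSet f ε v₀ 0 = waveSet ε v₀ := by
  ext s
  simp [mem_aliveSet, collisionPosition]

lemma aliveSet_subset_waveSet : aliveSet f ε v₀ j ⊆ waveSet ε v₀ := fun _ hs =>
  (mem_aliveSet.1 hs).1

lemma aliveSet_succ_subset : aliveSet f ε v₀ (j + 1) ⊆ aliveSet f ε v₀ j := by
  intro s hs
  rw [mem_aliveSet] at hs ⊢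
  refine ⟨hs.1, fun h => hs.2 ?_⟩
  rw [collisionPosition, if_pos h]

lemma IsEnumeration.isStage_zero (hE : IsEnumeration ε v₀ S r) (hε : 0 < ε) :
    IsStage f ε v₀ S r 0 := by
  have h0 : flow f ε v₀ r 0 = initialPosition ε v₀ := rfl
  have hI : Interacted f ε v₀ r 0 = fun s t => initialPosition ε v₀ s = initialPosition ε v₀ t :=
    rfl
  refine ⟨?_, ?_, ?_, ?_, ?_⟩
  · rw [aliveSet_zero, h0]; exact hE.config
  · rw [aliveSet_zero, h0]; exact hE.eq_stepFun
  · rw [aliveSet_zero, h0, hI]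
    refine ⟨fun s _ t _ h => h, fun s hs u hu t ht h1 h2 he => ?_, hE.config.same⟩
    have e1 := hE.config.mono s hs u hu h1
    have e2 := hE.config.mono u hu t ht h2
    exact ⟨by linarith, by linarith⟩
  · rw [flowSpeed, aliveSet_zero, h0, hI]
    exact (hE.config.blockSpeeds hε).tangency hE.config.mono
  · intro s _
    rfl

lemma IsStage.blockSpeeds (h : IsStage f ε v₀ S r j) (hε : 0 < ε) :
    BlockSpeeds (aliveSet f ε v₀ j) (flow f ε v₀ r j) (cellSlope f ε S r)
      (flowSpeed f ε v₀ S r j) :=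
  h.config.blockSpeeds hε

lemma IsStage.collisionSpeed_eq (h : IsStage f ε v₀ S r j) (hE : IsEnumeration ε v₀ S r) {s : ℕ}
    (hs : s ∈ aliveSet f ε v₀ j) : collisionSpeed f ε v₀ j s = flowSpeed f ε v₀ S r j s := by
  simp only [collisionSpeed]
  rw [h.position s hs, h.profile_eq, hE.right s (aliveSet_subset_waveSet hs)]
  rfl

lemma IsStage.flow_succ (h : IsStage f ε v₀ S r j) (s : ℕ) :
    flow f ε v₀ r (j + 1) s = flow f ε v₀ r j s +
      firstMeeting f ε (profile f ε v₀ j) * flowSpeed f ε v₀ S r j s := by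
  rw [flow, flowSpeed, configSpeed, ← h.profile_eq]

lemma IsStage.profile_succ (h : IsStage f ε v₀ S r j) (hε : 0 < ε) :
    profile f ε v₀ (j + 1) = stepFun ε (aliveSet f ε v₀ j) (flow f ε v₀ r (j + 1)) S := by
  have : flow f ε v₀ r (j + 1) = fun s => flow f ε v₀ r j s +
      firstMeeting f ε (profile f ε v₀ j) * flowSpeed f ε v₀ S r j s := funext h.flow_succ
  rw [profile, this]
  conv_lhs => rw [h.profile_eq]
  rw [h.config.evolve_stepFun hε, ← h.profile_eq]
  rfl

lemma IsStage.exists_collision (h : IsStage f ε v₀ S r j) (hε : 0 < ε)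
    (hnext : HasNextCollision f ε v₀ j)
    (huniq : ∃! w : (ℝ × ℝ) × (ℝ × ℝ), w ∈ collidingPairs f ε (profile f ε v₀ j)) :
    ∃ P Q : Finset ℕ, IsCollision (aliveSet f ε v₀ j) (flow f ε v₀ r j) (flowSpeed f ε v₀ S r j)
        (flow f ε v₀ r (j + 1)) P Q ∧
      ∀ p ∈ P, ∀ q ∈ Q, collidingPairs f ε (profile f ε v₀ j) =
        {((flow f ε v₀ r j p, flowSpeed f ε v₀ S r j p),
          (flow f ε v₀ r j q, flowSpeed f ε v₀ S r j q))} := by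
  have e : flow f ε v₀ r (j + 1) = fun s => flow f ε v₀ r j s +
      firstMeeting f ε (profile f ε v₀ j) * flowSpeed f ε v₀ S r j s := funext h.flow_succ
  rw [HasNextCollision] at hnext
  rw [h.profile_eq] at hnext huniq e ⊢
  rw [e]
  exact h.config.isCollision hε hnext huniq

lemma IsStage.isCollisionPoint_iff (h : IsStage f ε v₀ S r j)
    (hc : IsCollision (aliveSet f ε v₀ j) (flow f ε v₀ r j) (flowSpeed f ε v₀ S r j)
      (flow f ε v₀ r (j + 1)) P Q)
    (hpairs : ∀ p ∈ P, ∀ q ∈ Q, collidingPairs f ε (profile f ε v₀ j) =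
        {((flow f ε v₀ r j p, flowSpeed f ε v₀ S r j p),
          (flow f ε v₀ r j q, flowSpeed f ε v₀ S r j q))})
    {s : ℕ} (hs : s ∈ aliveSet f ε v₀ j) :
    IsCollisionPoint f ε (profile f ε v₀ j) (flow f ε v₀ r (j + 1) s) ↔ s ∈ P ∪ Q := by
  obtain ⟨p, hp⟩ := hc.left_nonempty
  obtain ⟨q, hq⟩ := hc.right_nonempty
  rw [hc.mem_iff (Finset.mem_union_left _ hp) hs, IsCollisionPoint, hpairs p hp q hq]
  simp only [mem_singleton_iff, exists_eq_left]
  rw [← h.flow_succ, eq_comm]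

lemma IsStage.inJump_iff (h : IsStage f ε v₀ S r j) (hε : 0 < ε) (hE : IsEnumeration ε v₀ S r)
    {s : ℕ} (hs : s ∈ aliveSet f ε v₀ j) :
    (waveSign ε v₀ s * leftLim (profile f ε v₀ (j + 1)) (flow f ε v₀ r (j + 1) s) ≤
          waveSign ε v₀ s * rightState ε v₀ s - ε ∧
        waveSign ε v₀ s * rightState ε v₀ s ≤
          waveSign ε v₀ s * profile f ε v₀ (j + 1) (flow f ε v₀ r (j + 1) s)) ↔
      InJump (aliveSet f ε v₀ j) (flow f ε v₀ r (j + 1)) S r s := by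
  have hs' := aliveSet_subset_waveSet hs
  rw [h.profile_succ hε, leftLim_stepFun, stepFun, hE.sign s hs', hE.right s hs', InJump]
  have e1 : ∀ a b : ℤ, ((a : ℝ) * (b * ε) = ((a * b : ℤ) : ℝ) * ε) := fun a b => by
    push_cast; ring
  have e2 : ∀ a : ℤ, (a : ℝ) * ε - ε = ((a - 1 : ℤ) : ℝ) * ε := fun a => by push_cast; ring
  rw [e1, e1, e1, e2, mul_le_mul_iff_left₀ hε, mul_le_mul_iff_left₀ hε, Int.cast_le, Int.cast_le]

open Classical in
lemma IsStage.collisionPosition_succ (h : IsStage f ε v₀ S r j) (hε : 0 < ε)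
    (hE : IsEnumeration ε v₀ S r)
    (hc : IsCollision (aliveSet f ε v₀ j) (flow f ε v₀ r j) (flowSpeed f ε v₀ S r j)
      (flow f ε v₀ r (j + 1)) P Q)
    (hpairs : ∀ p ∈ P, ∀ q ∈ Q, collidingPairs f ε (profile f ε v₀ j) =
        {((flow f ε v₀ r j p, flowSpeed f ε v₀ S r j p),
          (flow f ε v₀ r j q, flowSpeed f ε v₀ S r j q))})
    {s : ℕ} (hs : s ∈ aliveSet f ε v₀ j) :
    collisionPosition f ε v₀ (j + 1) s =
      if s ∈ P ∪ Q ∧ ¬ InJump (aliveSet f ε v₀ j) (flow f ε v₀ r (j + 1)) S r s then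
        (⊤ : WithTop ℝ)
      else (flow f ε v₀ r (j + 1) s : ℝ) := by
  have hx : (collisionPosition f ε v₀ j s).untopD 0 = flow f ε v₀ r j s := by
    rw [h.position s hs, WithTop.untopD_coe]
  have hx' : flow f ε v₀ r j s + riemannSpeed f ε (leftLim (profile f ε v₀ j) (flow f ε v₀ r j s))
      (profile f ε v₀ j (flow f ε v₀ r j s)) (rightState ε v₀ s) *
        firstMeeting f ε (profile f ε v₀ j) = flow f ε v₀ r (j + 1) s := by
    rw [flow, hE.right s (aliveSet_subset_waveSet hs), mul_comm]
  rw [collisionPosition, if_neg (mem_aliveSet.1 hs).2]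
  simp only [hx, hx', h.isCollisionPoint_iff hc hpairs hs, h.inJump_iff hε hE hs]

lemma IsStage.mem_aliveSet_succ (h : IsStage f ε v₀ S r j) (hε : 0 < ε)
    (hE : IsEnumeration ε v₀ S r)
    (hc : IsCollision (aliveSet f ε v₀ j) (flow f ε v₀ r j) (flowSpeed f ε v₀ S r j)
      (flow f ε v₀ r (j + 1)) P Q)
    (hpairs : ∀ p ∈ P, ∀ q ∈ Q, collidingPairs f ε (profile f ε v₀ j) =
        {((flow f ε v₀ r j p, flowSpeed f ε v₀ S r j p),
          (flow f ε v₀ r j q, flowSpeed f ε v₀ S r j q))}) (s : ℕ) :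
    s ∈ aliveSet f ε v₀ (j + 1) ↔ s ∈ aliveSet f ε v₀ j ∧
      (s ∈ P ∪ Q → InJump (aliveSet f ε v₀ j) (flow f ε v₀ r (j + 1)) S r s) := by
  by_cases hs : s ∈ aliveSet f ε v₀ j
  · rw [mem_aliveSet, h.collisionPosition_succ hε hE hc hpairs hs]
    simp only [hs, aliveSet_subset_waveSet hs, true_and]
    split_ifs with h1
    · simpa using h1
    · simpa using h1
  · simp only [hs, false_and, iff_false]
    exact fun h => hs (aliveSet_succ_subset h)

lemma IsStage.frontStrength_eq (h : IsStage f ε v₀ S r j) (hE : IsEnumeration ε v₀ S r)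
    (hP : IsFront (aliveSet f ε v₀ j) (flow f ε v₀ r j) (flowSpeed f ε v₀ S r j) P) {p : ℕ}
    (hp : p ∈ P) :
    frontStrength f ε v₀ j (flow f ε v₀ r j p, flowSpeed f ε v₀ S r j p) = ε * P.card := by
  rw [frontStrength]
  congr 3
  ext s
  simp only [Finset.mem_filter]
  constructor
  · rintro ⟨hs, h1, h2⟩
    have hsA : s ∈ aliveSet f ε v₀ j := mem_aliveSet.2 ⟨hs, by rw [h1]; exact WithTop.coe_ne_top⟩
    rw [h.position s hsA, WithTop.coe_eq_coe] at h1
    rw [h.collisionSpeed_eq hE hsA] at h2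
    exact (hP.2 p hp s hsA).2 ⟨h1, h2⟩
  · intro hs
    have hsA := hP.1 hs
    obtain ⟨h1, h2⟩ := hP.eq hp hs
    exact ⟨aliveSet_subset_waveSet hsA, by rw [h.position s hsA, h1],
      by rw [h.collisionSpeed_eq hE hsA, h2]⟩

lemma IsStage.jump_mul_pos_iff (h : IsStage f ε v₀ S r j) (hε : 0 < ε) {p q : ℕ}
    (hp : p ∈ aliveSet f ε v₀ j) (hq : q ∈ aliveSet f ε v₀ j) :
    0 < (profile f ε v₀ j (flow f ε v₀ r j p) - leftLim (profile f ε v₀ j) (flow f ε v₀ r j p)) *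
        (profile f ε v₀ j (flow f ε v₀ r j q) - leftLim (profile f ε v₀ j) (flow f ε v₀ r j q)) ↔
      S p = S q := by
  rw [h.profile_eq]
  obtain ⟨e1, h1⟩ := h.config.jump hε hp
  obtain ⟨e2, h2⟩ := h.config.jump hε hq
  rw [e1, e2]
  generalize ({t ∈ aliveSet f ε v₀ j | flow f ε v₀ r j t = flow f ε v₀ r j p}.card : ℝ) * ε = a
    at h1
  generalize ({t ∈ aliveSet f ε v₀ j | flow f ε v₀ r j t = flow f ε v₀ r j q}.card : ℝ) * ε = b
    at h2
  have := mul_pos h1 h2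
  rcases h.config.sign p hp with e1 | e1 <;> rcases h.config.sign q hq with e2 | e2 <;>
    rw [e1, e2] <;> norm_num <;> linarith

lemma IsStage.interactionAmount_of_sign_eq (h : IsStage f ε v₀ S r j) (hε : 0 < ε)
    (hE : IsEnumeration ε v₀ S r)
    (hc : IsCollision (aliveSet f ε v₀ j) (flow f ε v₀ r j) (flowSpeed f ε v₀ S r j)
      (flow f ε v₀ r (j + 1)) P Q) {p q : ℕ} (hp : p ∈ P) (hq : q ∈ Q)
    (hpairs : collidingPairs f ε (profile f ε v₀ j) =
        {((flow f ε v₀ r j p, flowSpeed f ε v₀ S r j p),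
          (flow f ε v₀ r j q, flowSpeed f ε v₀ S r j q))}) (hpq : S p = S q) :
    interactionAmount f ε v₀ j = ε * ((flowSpeed f ε v₀ S r j p - flowSpeed f ε v₀ S r j q) *
      (P.card * Q.card) / (P.card + Q.card)) := by
  have e : interactingPairs f ε (profile f ε v₀ j) =
      {((flow f ε v₀ r j p, flowSpeed f ε v₀ S r j p),
          (flow f ε v₀ r j q, flowSpeed f ε v₀ S r j q))} := by
    rw [interactingPairs, hpairs]
    ext w
    simp only [mem_singleton_iff, mem_ofPred_eq, and_iff_left_iff_imp]
    rintro rfl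
    exact (h.jump_mul_pos_iff hε (hc.left.1 hp) (hc.right.1 hq)).2 hpq
  rw [interactionAmount, e, finsum_mem_singleton, h.frontStrength_eq hE hc.left hp,
    h.frontStrength_eq hE hc.right hq, abs_of_pos (sub_pos.2 (hc.speed_lt p hp q hq))]
  have h1 : 0 < (P.card : ℝ) := Nat.cast_pos.2 (Finset.card_pos.2 ⟨p, hp⟩)
  have h2 : 0 < (Q.card : ℝ) := Nat.cast_pos.2 (Finset.card_pos.2 ⟨q, hq⟩)
  field_simp

lemma IsStage.interactionAmount_of_sign_ne (h : IsStage f ε v₀ S r j) (hε : 0 < ε)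
    (hc : IsCollision (aliveSet f ε v₀ j) (flow f ε v₀ r j) (flowSpeed f ε v₀ S r j)
      (flow f ε v₀ r (j + 1)) P Q) {p q : ℕ} (hp : p ∈ P) (hq : q ∈ Q)
    (hpairs : collidingPairs f ε (profile f ε v₀ j) =
        {((flow f ε v₀ r j p, flowSpeed f ε v₀ S r j p),
          (flow f ε v₀ r j q, flowSpeed f ε v₀ S r j q))}) (hpq : S p ≠ S q) :
    interactionAmount f ε v₀ j = 0 := by
  have e : interactingPairs f ε (profile f ε v₀ j) = ∅ := by
    rw [interactingPairs, hpairs, eq_empty_iff_forall_notMem]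
    rintro w ⟨hw, hw'⟩
    rw [mem_singleton_iff.1 hw] at hw'
    exact hpq ((h.jump_mul_pos_iff hε (hc.left.1 hp) (hc.right.1 hq)).1 hw')
  rw [interactionAmount, e, finsum_mem_empty]

variable {L : ℝ}

/-- The passage from an interaction-cancellation time to the next one. -/
theorem IsStage.step (h : IsStage f ε v₀ S r j) (hε : 0 < ε) (hE : IsEnumeration ε v₀ S r)
    (hf : ContDiff ℝ 2 f) (hL : ∀ u, |deriv (deriv f) u| ≤ L) (hnext : HasNextCollision f ε v₀ j)
    (huniq : ∃! w : (ℝ × ℝ) × (ℝ × ℝ), w ∈ collidingPairs f ε (profile f ε v₀ j)) :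
    IsStage f ε v₀ S r (j + 1) ∧
    interactionAmount f ε v₀ j ≤ ε * (2 * (L * ε) *
      (nonInteracted (aliveSet f ε v₀ j) (Interacted f ε v₀ r j) -
        nonInteracted (aliveSet f ε v₀ (j + 1)) (Interacted f ε v₀ r (j + 1)))) ∧
    ∑ s ∈ aliveSet f ε v₀ (j + 1), |collisionSpeed f ε v₀ (j + 1) s - collisionSpeed f ε v₀ j s| ≤
      4 * (L * ε) * (nonInteracted (aliveSet f ε v₀ j) (Interacted f ε v₀ r j) -
        nonInteracted (aliveSet f ε v₀ (j + 1)) (Interacted f ε v₀ r (j + 1))) +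
      L * ε * (waveSet ε v₀).card *
        ((aliveSet f ε v₀ j).card - (aliveSet f ε v₀ (j + 1)).card) ∧
    ((aliveSet f ε v₀ (j + 1)).card < (aliveSet f ε v₀ j).card ∨
      (aliveSet f ε v₀ (j + 1)).card = (aliveSet f ε v₀ j).card ∧
      separatedPairs (aliveSet f ε v₀ (j + 1)) (flow f ε v₀ r (j + 1))
        (flowSpeed f ε v₀ S r (j + 1)) <
      separatedPairs (aliveSet f ε v₀ j) (flow f ε v₀ r j) (flowSpeed f ε v₀ S r j)) := by
  obtain ⟨P, Q, hc, hpairs⟩ := h.exists_collision hε hnext huniq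
  obtain ⟨p, hp⟩ := hc.left_nonempty
  obtain ⟨q, hq⟩ := hc.right_nonempty
  have hL0 : 0 ≤ L := (abs_nonneg _).trans (hL 0)
  have hK : 0 ≤ L * ε := mul_nonneg hL0 hε.le
  have hmem := h.mem_aliveSet_succ hε hE hc hpairs
  have hpos : ∀ s ∈ aliveSet f ε v₀ (j + 1),
      collisionPosition f ε v₀ (j + 1) s = (flow f ε v₀ r (j + 1) s : ℝ) := by
    intro s hs
    have := (hmem s).1 hs
    rw [h.collisionPosition_succ hε hE hc hpairs this.1, if_neg]
    exact fun h' => h'.2 (this.2 h'.1)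
  have hlip := h.config.lipschitzAlong hf hL hε
  have hIdef : (fun s t => Interacted f ε v₀ r j s t ∨
      flow f ε v₀ r (j + 1) s = flow f ε v₀ r (j + 1) t) = Interacted f ε v₀ r (j + 1) := rfl
  have hspeed : ∀ h' : IsStage f ε v₀ S r (j + 1), ∑ s ∈ aliveSet f ε v₀ (j + 1),
      |collisionSpeed f ε v₀ (j + 1) s - collisionSpeed f ε v₀ j s| =
      ∑ s ∈ aliveSet f ε v₀ (j + 1),
        |flowSpeed f ε v₀ S r (j + 1) s - flowSpeed f ε v₀ S r j s| := fun h' =>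
    Finset.sum_congr rfl fun s hs => by
      rw [h'.collisionSpeed_eq hE hs, h.collisionSpeed_eq hE (aliveSet_succ_subset hs)]
  by_cases hpq : S p = S q
  · have hA : aliveSet f ε v₀ (j + 1) = aliveSet f ε v₀ j := by
      ext s
      rw [hmem]
      exact ⟨fun hs => hs.1, fun hs => ⟨hs, hc.inJump_of_sign_eq h.config hp hq hpq s⟩⟩
    have hcfg : IsConfig (aliveSet f ε v₀ (j + 1)) (flow f ε v₀ r (j + 1)) S r := by
      rw [hA]; exact hc.config_of_sign_eq h.config hp hq hpq
    have hb' : BlockSpeeds (aliveSet f ε v₀ j) (flow f ε v₀ r (j + 1)) (cellSlope f ε S r)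
        (flowSpeed f ε v₀ S r (j + 1)) := hA ▸ hcfg.blockSpeeds hε
    obtain ⟨hT, h1, h2, h3⟩ := hc.merge_step h.config (h.blockSpeeds hε) hb' h.interaction
      h.tangency hK hlip hp hq hpq
    rw [hIdef, ← hA] at hT
    rw [hIdef] at h1 h2
    have h' : IsStage f ε v₀ S r (j + 1) := by
      refine ⟨hcfg, ?_, ?_, hT, hpos⟩
      · rw [h.profile_succ hε, hA]
      · exact h.interaction.next aliveSet_succ_subset hcfg
    refine ⟨h', ?_, ?_, Or.inr ⟨by rw [hA], by rw [hA]; exact h3⟩⟩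
    · rw [h.interactionAmount_of_sign_eq hε hE hc hp hq (hpairs p hp q hq) hpq, hA]
      exact mul_le_mul_of_nonneg_left h1 hε.le
    · rw [hspeed h', hA, sub_self, mul_zero, add_zero]
      exact h2
  · have hcan := hc.isCancellation (ε := ε) h.config hp hq hpq hmem
    have hb' := hcan.config.blockSpeeds (f := f) hε
    obtain ⟨hT, h2, h3⟩ := hcan.cancel_step h.config (h.blockSpeeds hε) hb' h.interaction
      h.tangency hK hlip
    have h' : IsStage f ε v₀ S r (j + 1) :=
      ⟨hcan.config, by rw [h.profile_succ hε, hcan.stepFun_eq],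
        h.interaction.next aliveSet_succ_subset hcan.config, hT, hpos⟩
    -- A cancellation is paid by the removed waves alone; the functional of pairs only has to be
    -- nonincreasing.
    have hN : (0 : ℝ) ≤ nonInteracted (aliveSet f ε v₀ j) (Interacted f ε v₀ r j) -
        nonInteracted (aliveSet f ε v₀ (j + 1)) (Interacted f ε v₀ r (j + 1)) :=
      sub_nonneg.2 (Nat.cast_le.2 (nonInteracted_mono aliveSet_succ_subset fun _ _ => Or.inl))
    refine ⟨h', ?_, ?_, Or.inl h3⟩
    · rw [h.interactionAmount_of_sign_ne hε hc hp hq (hpairs p hp q hq) hpq]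
      positivity
    · rw [hspeed h']
      have hn : ((aliveSet f ε v₀ j).card : ℝ) ≤ (waveSet ε v₀).card :=
        Nat.cast_le.2 (Finset.card_le_card aliveSet_subset_waveSet)
      have hd : (0 : ℝ) ≤ (aliveSet f ε v₀ j).card - (aliveSet f ε v₀ (j + 1)).card :=
        sub_nonneg.2 (Nat.cast_le.2 h3.le)
      refine (h2.trans ?_).trans (le_add_of_nonneg_left (by positivity))
      gcongr

end Stage

/-- The essential bound holds almost everywhere, hence on a dense set, and by continuity everywhere.
Boundedness makes the norm finite, so that `toReal` loses nothing. -/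
lemma abs_le_toReal_eLpNorm_top {g : ℝ → ℝ} (hg : Continuous g) (hM : ∃ M : ℝ, ∀ u, |g u| ≤ M)
    (u : ℝ) : |g u| ≤ (eLpNorm g ⊤ volume).toReal := by
  obtain ⟨M, hM⟩ := hM
  rw [eLpNorm_exponent_top]
  have hfin : eLpNormEssSup g volume < ⊤ :=
    eLpNormEssSup_lt_top_of_ae_bound (C := M) (Filter.Eventually.of_forall hM)
  have hae : ∀ᵐ y ∂(volume : Measure ℝ), |g y| ≤ (eLpNormEssSup g volume).toReal := by
    filter_upwards [enorm_ae_le_eLpNormEssSup g volume] with y hy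
    have := ENNReal.toReal_mono hfin.ne hy
    simpa using this
  have hd := Measure.dense_of_ae hae
  have hcl : IsClosed {y | |g y| ≤ (eLpNormEssSup g volume).toReal} :=
    isClosed_le hg.abs continuous_const
  have : u ∈ closure {y | |g y| ≤ (eLpNormEssSup g volume).toReal} := hd u
  rwa [hcl.closure_eq] at this

/-! ### Finiteness of the collisions -/

section Global

variable {f : ℝ → ℝ} {ε : ℝ} {v₀ : ℝ → ℝ} {S r : ℕ → ℤ} {j J : ℕ} {L : ℝ}

lemma firstMeeting_nonneg (v : ℝ → ℝ) : 0 ≤ firstMeeting f ε v :=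
  Real.sInf_nonneg fun _ hx => hx.1.le

lemma IsStage.profile_succ_of_not_hasNextCollision (h : IsStage f ε v₀ S r j) (hε : 0 < ε)
    (hnext : ¬ HasNextCollision f ε v₀ j) : profile f ε v₀ (j + 1) = profile f ε v₀ j := by
  have h0 : firstMeeting f ε (profile f ε v₀ j) = 0 := by
    rw [firstMeeting, not_nonempty_iff_eq_empty.1 hnext, Real.sInf_empty]
  have hflow : flow f ε v₀ r (j + 1) = flow f ε v₀ r j := funext fun s => by
    rw [h.flow_succ, h0, zero_mul, add_zero]
  rw [h.profile_succ hε, hflow, h.profile_eq]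

/-- There are finitely many interaction-cancellation times. -/
theorem IsEnumeration.exists_last (hE : IsEnumeration ε v₀ S r) (hε : 0 < ε)
    (hf : ContDiff ℝ 2 f) (hL : ∀ u, |deriv (deriv f) u| ≤ L)
    (hbinary : ∀ j : ℕ, HasNextCollision f ε v₀ j →
      ∃! w : (ℝ × ℝ) × (ℝ × ℝ), w ∈ collidingPairs f ε (profile f ε v₀ j)) :
    ∃ J : ℕ, (∀ j, HasNextCollision f ε v₀ j ↔ j < J) ∧ ∀ j ≤ J, IsStage f ε v₀ S r j := by
  classical
  have hst : ∀ j, (∀ i < j, HasNextCollision f ε v₀ i) → IsStage f ε v₀ S r j := by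
    intro j
    induction j with
    | zero => exact fun _ => hE.isStage_zero hε
    | succ j ih =>
      intro hj
      have hn := hj j (Nat.lt_succ_self j)
      exact ((ih fun i hi => hj i (hi.trans (Nat.lt_succ_self j))).step hε hE hf hL hn
        (hbinary j hn)).1
  have hex : ∃ j, ¬ HasNextCollision f ε v₀ j := by
    by_contra hcon
    push Not at hcon
    set n := (waveSet ε v₀).card
    -- A lexicographic order in one number: the second term never exceeds `n ^ 2`, so losing one
    -- wave outweighs any increase of it.
    set Φ : ℕ → ℕ := fun j => (aliveSet f ε v₀ j).card * (n ^ 2 + 1) +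
      separatedPairs (aliveSet f ε v₀ j) (flow f ε v₀ r j) (flowSpeed f ε v₀ S r j) with hΦ
    have hdec : ∀ j, Φ (j + 1) < Φ j := by
      intro j
      have := ((hst j fun i _ => hcon i).step hε hE hf hL (hcon j) (hbinary j (hcon j))).2.2.2
      simp only [hΦ]
      rcases this with h1 | ⟨h1, h2⟩
      · have h3 := separatedPairs_le (aliveSet f ε v₀ (j + 1)) (flow f ε v₀ r (j + 1))
          (flowSpeed f ε v₀ S r (j + 1))
        have h4 : (aliveSet f ε v₀ (j + 1)).card ^ 2 ≤ n ^ 2 :=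
          Nat.pow_le_pow_left (Finset.card_le_card aliveSet_subset_waveSet) 2
        have h5 := Nat.mul_le_mul_right (n ^ 2 + 1) (Nat.succ_le_of_lt h1)
        rw [Nat.succ_mul] at h5
        omega
      · rw [h1]
        omega
    have hle : ∀ j, Φ j + j ≤ Φ 0 := by
      intro j
      induction j with
      | zero => simp
      | succ j ih => have := hdec j; omega
    have := hle (Φ 0 + 1)
    omega
  have hJ := Nat.find_spec hex
  have hlt : ∀ i < Nat.find hex, HasNextCollision f ε v₀ i := fun i hi =>
    not_not.1 (Nat.find_min hex hi)
  refine ⟨Nat.find hex, fun j => ⟨fun hj => ?_, hlt j⟩, fun j hj => hst j fun i hi =>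
    hlt i (hi.trans_le hj)⟩
  by_contra hcon
  obtain ⟨k, rfl⟩ := Nat.exists_eq_add_of_le (not_lt.1 hcon)
  -- Without a further collision `firstMeeting` is the infimum of the empty set, which is `0`, and
  -- the profile becomes stationary. Therefore no collision can reappear at a later index.
  have hprof : ∀ k, profile f ε v₀ (Nat.find hex + k) = profile f ε v₀ (Nat.find hex) := by
    intro k
    induction k with
    | zero => rfl
    | succ k ih =>
      rw [← add_assoc, profile, ih, ← profile,
        (hst _ hlt).profile_succ_of_not_hasNextCollision hε hJ]
  rw [HasNextCollision, hprof] at hj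
  exact hJ hj

/-- The collision times increase strictly up to `t_J`, so the speeds and waves at time `t_j` are
those of stage `j`. -/
lemma stage_collisionTime (hJ : ∀ j, HasNextCollision f ε v₀ j ↔ j < J)
    (hst : ∀ j ≤ J, IsStage f ε v₀ S r j) (hε : 0 < ε) (hj : j ≤ J) :
    stage f ε v₀ (collisionTime f ε v₀ j) = j := by
  have hmono : Monotone (collisionTime f ε v₀) := monotone_nat_of_le_succ fun i => by
    rw [collisionTime, collisionTime, Finset.sum_range_succ]
    exact le_add_of_nonneg_right (firstMeeting_nonneg _)
  have hmem : j ∈ {i | collisionTime f ε v₀ j < collisionTime f ε v₀ (i + 1) ∨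
      ¬ HasNextCollision f ε v₀ i} := by
    by_cases h : HasNextCollision f ε v₀ j
    · left
      rw [collisionTime, collisionTime, Finset.sum_range_succ]
      have h1 := hst j hj
      have := h1.config.firstMeeting_mem (f := f) hε (by rw [← h1.profile_eq]; exact h)
      rw [← h1.profile_eq] at this
      exact lt_add_of_pos_right _ this.1
    · exact Or.inr h
  refine le_antisymm (Nat.sInf_le hmem) (le_csInf ⟨j, hmem⟩ fun i hi => ?_)
  by_contra hcon
  push Not at hcon
  rcases hi with hi | hi
  · exact absurd (hmono (Nat.succ_le_of_lt hcon)) (not_le.2 hi)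
  · exact hi ((hJ i).2 (hcon.trans_le hj))

lemma realWaves_eq_aliveSet {t : ℝ} (ht : stage f ε v₀ t = j) :
    realWaves f ε v₀ t = aliveSet f ε v₀ j := by
  ext s
  simp only [realWaves, wavePosition, ht, mem_aliveSet, Finset.mem_filter, ne_eq,
    WithTop.map_eq_top_iff]

end Global

end WavefrontTracking

/-! ### The quadratic estimates -/

open WavefrontTracking in
theorem theorem2
    (f : ℝ → ℝ) (hf : ContDiff ℝ 2 f) (hf'' : ∃ M : ℝ, ∀ u : ℝ, |deriv (deriv f) u| ≤ M)
    (ε : ℝ) (hε : 0 < ε)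
    -- the initial datum and its approximation
    (ubar : ℝ → ℝ) (hubar : BoundedVariationOn ubar univ)
    (v₀ : ℝ → ℝ) (hgrid : ∀ x : ℝ, ∃ k : ℤ, v₀ x = k * ε)
    (hright : ∀ x : ℝ, ContinuousWithinAt v₀ (Ici x) x)
    (hsupp : HasCompactSupport v₀)
    (htv : eVariationOn v₀ univ ≤ eVariationOn ubar univ)
    -- at each interaction-cancellation time exactly two wavefronts meet
    (hbinary : ∀ j : ℕ, HasNextCollision f ε v₀ j →
      ∃! w : (ℝ × ℝ) × (ℝ × ℝ), w ∈ collidingPairs f ε (profile f ε v₀ j)) :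
    ∃ J : ℕ, (∀ j : ℕ, HasNextCollision f ε v₀ j ↔ j < J) ∧
      ∑ j ∈ Finset.Icc 1 J, ∑ s ∈ realWaves f ε v₀ (collisionTime f ε v₀ j),
          |waveSpeed f ε v₀ (collisionTime f ε v₀ j) s -
            waveSpeed f ε v₀ (collisionTime f ε v₀ (j - 1)) s| * ε
        ≤ (3 + 2 * Real.log 2) * (eLpNorm (deriv (deriv f)) ⊤ volume).toReal *
          (eVariationOn ubar univ).toReal ^ 2 ∧
      ∑ j ∈ Finset.range J, interactionAmount f ε v₀ j
        ≤ (3 + 2 * Real.log 2) / 2 * (eLpNorm (deriv (deriv f)) ⊤ volume).toReal *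
          (eVariationOn ubar univ).toReal ^ 2 := by
  have hbv : BoundedVariationOn v₀ univ := ne_top_of_le_ne_top hubar htv
  obtain ⟨S, r, h1, h2, h3⟩ := exists_initial_config hε hgrid hright hsupp hbv
  have hE : IsEnumeration ε v₀ S r := ⟨h1, h2, fun s hs => (h3 s hs).1, fun s hs => (h3 s hs).2⟩
  have hcont : Continuous (deriv (deriv f)) := by
    have h : ContDiff ℝ 1 (deriv f) := hf.deriv'
    exact h.continuous_deriv le_rfl
  have hL := abs_le_toReal_eLpNorm_top hcont hf''
  set L := (eLpNorm (deriv (deriv f)) ⊤ volume).toReal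
  set V := (eVariationOn ubar univ).toReal
  have hL0 : 0 ≤ L := ENNReal.toReal_nonneg
  obtain ⟨J, hJ, hst⟩ := hE.exists_last hε hf hL hbinary
  have hstage : ∀ j ≤ J, stage f ε v₀ (collisionTime f ε v₀ j) = j := fun j hj =>
    stage_collisionTime hJ hst hε hj
  set n : ℝ := ((waveSet ε v₀).card : ℝ) with hn
  set N : ℕ → ℝ := fun j => (nonInteracted (aliveSet f ε v₀ j) (Interacted f ε v₀ r j) : ℝ) with hN
  set a : ℕ → ℝ := fun j => ((aliveSet f ε v₀ j).card : ℝ) with ha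
  have hn0 : 0 ≤ n := Nat.cast_nonneg _
  have hnV : n * ε ≤ V := by
    have e1 : (eVariationOn v₀ univ).toReal ≤ V := ENNReal.toReal_mono hubar htv
    have e2 : n ≤ (eVariationOn v₀ univ).toReal / ε := by
      rw [hn, waveSet, Nat.card_Icc, Nat.add_sub_cancel]
      exact Nat.floor_le (div_nonneg ENNReal.toReal_nonneg hε.le)
    exact ((le_div_iff₀ hε).1 e2).trans e1
  have hsq : (n * ε) ^ 2 ≤ V ^ 2 := pow_le_pow_left₀ (mul_nonneg hn0 hε.le) hnV 2
  have hN0 : 2 * (N 0 - N J) ≤ n ^ 2 := by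
    have e1 := two_mul_nonInteracted_le (aliveSet f ε v₀ 0) (Interacted f ε v₀ r 0)
    rw [aliveSet_zero] at e1
    have e2 : 2 * N 0 ≤ n ^ 2 := by
      simp only [hN, hn, aliveSet_zero]
      exact_mod_cast e1
    have e3 : 0 ≤ N J := Nat.cast_nonneg _
    linarith
  have ha0 : a 0 - a J ≤ n := by
    have e3 : 0 ≤ a J := Nat.cast_nonneg _
    have e1 : a 0 = n := by simp only [ha, hn, aliveSet_zero]
    linarith
  have hstep := fun j (hj : j < J) =>
    (hst j hj.le).step hε hE hf hL ((hJ j).2 hj) (hbinary j ((hJ j).2 hj))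
  -- The telescoping sums give the constants `3` and `1`; the nonnegative terms with `log 2` are
  -- slack.
  have hlog : 0 ≤ Real.log 2 := Real.log_nonneg (by norm_num)
  have hLV : 0 ≤ L * V ^ 2 := by positivity
  have hLsq : L * (n * ε) ^ 2 ≤ L * V ^ 2 := mul_le_mul_of_nonneg_left hsq hL0
  have hLN : L * ε ^ 2 * (2 * (N 0 - N J)) ≤ L * (n * ε) ^ 2 :=
    (mul_le_mul_of_nonneg_left hN0 (by positivity)).trans_eq (by ring)
  refine ⟨J, hJ, ?_, ?_⟩
  · have hIcc : Finset.Icc 1 J = Finset.Ico 1 (J + 1) := by ext; simp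
    rw [hIcc, Finset.sum_Ico_eq_sum_range]
    -- After the shift of the index, each collision is bounded by the decrease of two quantities:
    -- the pairs that have not interacted, worth `2 L (n ε) ^ 2` in total, and the surviving waves,
    -- worth `L (n ε) ^ 2`.
    have hterm : ∀ j ∈ Finset.range (J + 1 - 1),
        ∑ s ∈ realWaves f ε v₀ (collisionTime f ε v₀ (1 + j)),
          |waveSpeed f ε v₀ (collisionTime f ε v₀ (1 + j)) s -
            waveSpeed f ε v₀ (collisionTime f ε v₀ (1 + j - 1)) s| * ε ≤
        4 * (L * ε) * ε * (N j - N (j + 1)) + L * ε * n * ε * (a j - a (j + 1)) := by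
      intro j hj
      have hj : j < J := by simpa using hj
      rw [add_comm 1 j, Nat.add_sub_cancel, realWaves_eq_aliveSet (hstage (j + 1) hj)]
      simp only [waveSpeed, hstage (j + 1) hj, hstage j hj.le]
      rw [← Finset.sum_mul]
      refine (mul_le_mul_of_nonneg_right (hstep j hj).2.2.1 hε.le).trans_eq ?_
      ring
    refine (Finset.sum_le_sum hterm).trans ?_
    rw [Finset.sum_add_distrib, ← Finset.mul_sum, ← Finset.mul_sum, Nat.add_sub_cancel,
      Finset.sum_range_sub', Finset.sum_range_sub']
    have e1 : L * ε * n * ε * (a 0 - a J) ≤ L * (n * ε) ^ 2 :=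
      (mul_le_mul_of_nonneg_left ha0 (mul_nonneg (mul_nonneg (mul_nonneg hL0 hε.le) hn0)
        hε.le)).trans_eq (by ring)
    have e2 := mul_nonneg hlog hLV
    linarith
  · have hterm : ∀ j ∈ Finset.range J,
        interactionAmount f ε v₀ j ≤ 2 * (L * ε) * ε * (N j - N (j + 1)) := fun j hj =>
      (hstep j (Finset.mem_range.1 hj)).2.1.trans_eq (by ring)
    refine (Finset.sum_le_sum hterm).trans ?_
    rw [← Finset.mul_sum, Finset.sum_range_sub']
    have e2 := mul_nonneg hlog hLV
    linarith
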